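/- Let $n\ge 1$ and order $\mathbb Z^n$ right-lexicographically (the coordinate of largest index at which two tuples differ decides); $\mathbb Z^k\subset\mathbb Z^n$ ($k\le n$) denotes the tuples whose coordinates after the first $k$ vanish, and $1=(1,0,\dots,0)$. A $\mathbb Z^n$-word over a set $X$ is a function $w:[1,|w|]\to X^{\pm}$ with $|w|\in\mathbb Z^n$, $|w|\ge 0$; let $R(\mathbb Z^n,X)$ be the set of reduced words, with the partial product $u*v=\tilde u^{-1}\tilde v$, where $u^{-1}=c\tilde u$, $v=c\tilde v$ and $c$ is the longest common initial segment of $u^{-1}$ and $v$ (if it exists), and let $CDR(\mathbb Z^n,X)$ be the set of reduced words of the form $c^{-1}uc$ with $c$ reduced and $u$ cyclically reduced. Let $G\subset CDR(\mathbb Z^n,X)$ be a finitely generated non-abelian group under $*$ (a set of words closed under $*$ and inversion), and assume that $G$ is irreducible: there are no $k<n$ and $r\in R(\mathbb Z^n,X)$ such that $r^{-1}*G*r$ is a subgroup of $CDR(\mathbb Z^k,X)$. Let $\Gamma_G$ be the universal $\mathbb Z^n$-tree of $G$: the set of pairs $(\alpha,g)$, $g\in G$, $0\le\alpha\le|g|$,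 modulo $(\alpha,f)\sim(\beta,g)$ iff $\alpha=\beta\le c(f,g)$, where $c(f,g)$ is the length of the longest common initial segment of $f$ and $g$, with metric $d(\langle\alpha,f\rangle,\langle\beta,g\rangle)=\alpha+\beta-2\min(\alpha,\beta,c(f,g))$ and the natural isometric action of $G$. A $\mathbb Z^k$-subtree is a class of the relation $d(v,w)\in\mathbb Z^k$. For $1\le k\le n$ let $\partial_k\Gamma_G$ be the set of ends of $\mathbb Z^k$-type, that is, of isometries $[0,\infty)_{\mathbb Z^k}\to\Gamma_G$ up to having a common tail. Let $\overline\Gamma_G$ be $\Gamma_G\cup\bigcup_{k=1}^n\partial_k\Gamma_G$, where for $k<n$ the two ends of $\mathbb Z^k$-type through which two adjacent $\mathbb Z^k$-subtrees of a common $\mathbb Z^{k+1}$-subtree are joined are identified. (Adjacent means at distance $1$ in the simplicial tree obtained from the $\mathbb Z^{k+1}$-subtree by collapsing its $\mathbb Z^k$-subtrees to points.) Give $\overline\Gamma_G$ the following metric. The compactification $\overline T$ of a $\mathbb Z$-subtree $T$ with base point $w\in T$ has the metric $e^{-(x\cdot y)_w}$ ($x\ne y$), where $(x\cdot y)_w$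 is the Gromov product. For a $\mathbb Z^{k+1}$-subtree $T$ ($k\ge 1$) fix a $\mathbb Z^k$-subtree $T_0$ of $T$; the level of a $\mathbb Z^k$-subtree $S$ of $T$ is its distance from $T_0$ after collapsing the $\mathbb Z^k$-subtrees of $T$ to points. Enumerate the subtrees of each level $l\ge1$ and rescale the metric of $\overline S$ by $2^{-(l+m)}$ if $S$ has number $m$ in level $l$ (the metric of $\overline T_0$ is not rescaled). The distance of $x,y\in\overline T$ is the (finite or infinite) sum, over the $\mathbb Z^k$-subtrees $S$ crossed by the geodesic from $x$ to $y$, of the rescaled distances in $\overline S$ between the points where the geodesic enters and leaves $\overline S$. The base points, the subtrees $T_0$ and the enumerations are arbitrary. Let $\mu$ be a probability measure on $G$ whose support generates $G$ as a semigroup, and let $P_\mu$ be the law of the right random walk $\tau_i=h_1\cdots h_i$, $i\ge 0$, where the $h_j$ are independent with distribution $\mu$. A Borel probability measure $\nu$ on $\overline\Gamma_G$ is called $\mu$-stationary if $\sum_{g\in G}\mu(g)\,g\cdot\nu=\nu$, where $(g\cdot\nu)(E)=\nu(g^{-1}E)$. Then there is exactly one $\mu$-stationary Borel probability measure $\nu_\mu$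 on $\overline\Gamma_G$, and: (i) $\nu_\mu(\{x\})=0$ for every $x\in\overline\Gamma_G$; $\partial_n\Gamma_G$ is a Borel set and $\nu_\mu(\partial_n\Gamma_G)=1$; and $\nu_\mu(E)>0$ for every open $E\subset\overline\Gamma_G$ with $E\cap\partial_n\Gamma_G\neq\varnothing$; (ii) $(\overline\Gamma_G,\nu_\mu)$ is a $\mu$-boundary of $G$: for $P_\mu$-almost every path $\tau=(\tau_i)$ the measures $\tau_i\cdot\nu_\mu$ converge weakly to a Dirac measure $\delta_{\omega(\tau)}$ with $\omega(\tau)\in\overline\Gamma_G$; moreover, almost surely $\omega(\tau)\in\partial_n\Gamma_G$. -/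

import Mathlib

open Filter Topology MeasureTheory
open scoped BoundedContinuousFunction

noncomputable section

namespace ZnFree

/-! ### The ordered group `ℤⁿ` -/

/-- `ℤⁿ` with the right lexicographic order: the coordinate of largest index at which two tuples
differ decides. -/
def Zn (n : ℕ) : Type := Colex (Fin n → ℤ)

instance instAddCommGroupZn (n : ℕ) : AddCommGroup (Zn n) :=
  inferInstanceAs (AddCommGroup (Colex (Fin n → ℤ)))

instance instLinearOrderZn (n : ℕ) : LinearOrder (Zn n) :=
  inferInstanceAs (LinearOrder (Colex (Fin n → ℤ)))

theorem Zn.lt_iff {n : ℕ} {α β : Zn n} :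
    α < β ↔ ∃ i : Fin n, (∀ j, i < j → ofColex α j = ofColex β j) ∧ ofColex α i < ofColex β i :=
  Iff.rfl

instance instIsOrderedAddMonoidZn (n : ℕ) : IsOrderedAddMonoid (Zn n) where
  add_le_add_left a b hab c := by
    rcases hab.eq_or_lt with h | h
    · rw [h]
    · obtain ⟨i, h1, h2⟩ := Zn.lt_iff.1 h
      exact le_of_lt (Zn.lt_iff.2 ⟨i, fun j hj => congrArg (· + ofColex c j) (h1 j hj),
        add_lt_add_left h2 (ofColex c i)⟩)

/-- The tuple `(1, 0, …, 0)`, the smallest positive element of `ℤⁿ` (for `n ≥ 1`). -/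
def unit (n : ℕ) : Zn n := toColex fun i => if i.val = 0 then 1 else 0

/-- The coordinate of index `k` (counted from `0`), and `0` if there is none. -/
def coord {n : ℕ} (k : ℕ) (α : Zn n) : ℤ := if h : k < n then ofColex α ⟨k, h⟩ else 0

/-- `α` lies in the convex subgroup `ℤᵏ` of `ℤⁿ`: all coordinates after the first `k` vanish. -/
def InZ {n : ℕ} (k : ℕ) (α : Zn n) : Prop := ∀ j, k ≤ j → coord j α = 0

theorem ofColex_unit {n : ℕ} (i : Fin n) :
    ofColex (unit n) i = if i.val = 0 then 1 else 0 := rfl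

theorem ofColex_zero {n : ℕ} (i : Fin n) : ofColex (0 : Zn n) i = 0 := rfl

theorem unit_le_of_pos {n : ℕ} {α : Zn n} (h : 0 < α) : unit n ≤ α := by
  obtain ⟨i, h1, h2⟩ := Zn.lt_iff.1 h
  simp only [ofColex_zero] at h1 h2
  by_cases hi : i.val = 0
  · by_cases h3 : ofColex α i = 1
    · refine le_of_eq (funext fun j => ?_)
      change ofColex (unit n) j = ofColex α j
      rw [ofColex_unit]
      by_cases hj : j.val = 0
      · have : j = i := Fin.ext (by omega)
        rw [if_pos hj, this, h3]
      · rw [if_neg hj]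
        exact h1 j (Fin.lt_def.2 (by omega))
    · refine le_of_lt (Zn.lt_iff.2 ⟨i, fun j hj => ?_, ?_⟩)
      · rw [ofColex_unit, if_neg (by have := Fin.lt_def.1 hj; omega)]
        exact h1 j hj
      · rw [ofColex_unit, if_pos hi]; omega
  · refine le_of_lt (Zn.lt_iff.2 ⟨i, fun j hj => ?_, ?_⟩)
    · rw [ofColex_unit, if_neg (by have := Fin.lt_def.1 hj; omega)]
      exact h1 j hj
    · rw [ofColex_unit, if_neg hi]; exact h2

theorem unit_pos_of_pos {n : ℕ} {α : Zn n} (h : 0 < α) : 0 < unit n := by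
  obtain ⟨i, -, -⟩ := Zn.lt_iff.1 h
  have hn : 0 < n := by have := i.isLt; omega
  refine Zn.lt_iff.2 ⟨⟨0, hn⟩, fun j hj => ?_, ?_⟩
  · rw [ofColex_unit, if_neg (by have := Fin.lt_def.1 hj; simp at this; omega)]
    rfl
  · rw [ofColex_unit, if_pos rfl]
    exact one_pos

/-! ### Infinite words -/

/-- The formal inverse of a letter of `X^±`; `(x, true)` is `x` and `(x, false)` is `x⁻¹`. -/
def letterInv {X : Type*} (x : X × Bool) : X × Bool := (x.1, !x.2)

/-- A `ℤⁿ`-word over `X`: a function `[1, len] → X^±`, as a partial function on `ℤⁿ`. -/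
@[ext]
structure ZnWord (n : ℕ) (X : Type*) where
  len : Zn n
  letter : Zn n → Option (X × Bool)
  len_nonneg : 0 ≤ len
  isSome_iff : ∀ β, (letter β).isSome ↔ unit n ≤ β ∧ β ≤ len

namespace ZnWord

variable {n : ℕ} {X : Type*}

/-- Concatenation. -/
def concat (u v : ZnWord n X) : ZnWord n X where
  len := u.len + v.len
  letter β := if β ≤ u.len then u.letter β else v.letter (β - u.len)
  len_nonneg := add_nonneg u.len_nonneg v.len_nonneg
  isSome_iff β := by
    have hu := u.len_nonneg
    have hv := v.len_nonneg
    split_ifs with h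
    · rw [u.isSome_iff]
      constructor <;> rintro ⟨h1, h2⟩ <;> refine ⟨h1, ?_⟩ <;> grind
    · rw [v.isSome_iff]
      have h1 : 0 < β - u.len := by grind
      have h2 := unit_le_of_pos h1
      have h3 : 0 < β := by grind
      have h4 := unit_le_of_pos h3
      constructor <;> rintro ⟨h5, h6⟩ <;> refine ⟨by assumption, ?_⟩ <;> grind

/-- The inverse word. -/
def inv (w : ZnWord n X) : ZnWord n X where
  len := w.len
  letter β := (w.letter (w.len + unit n - β)).map letterInv
  len_nonneg := w.len_nonneg
  isSome_iff β := by
    rw [Option.isSome_map, w.isSome_iff]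
    constructor <;> rintro ⟨h1, h2⟩ <;> constructor <;> grind

/-- No two consecutive letters are inverse to each other. -/
def IsReduced (w : ZnWord n X) : Prop :=
  ∀ β, unit n ≤ β → β < w.len → w.letter (β + unit n) ≠ (w.letter β).map letterInv

/-- The first letters of `a` and `b`, if both words are non-empty, are different. -/
def FirstNe (a b : ZnWord n X) : Prop :=
  ∀ x, a.letter (unit n) = some x → b.letter (unit n) ≠ some x

/-- `w = u ∗ v`: if `u⁻¹ = c a` and `v = c b`, where `c` is the longest common initial segment of
`u⁻¹` and `v`, then `u ∗ v = a⁻¹ b`. The product is only partially defined, because two words need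
not have a longest common initial segment. -/
def IsMul (u v w : ZnWord n X) : Prop :=
  ∃ c a b : ZnWord n X,
    u.inv = c.concat a ∧ v = c.concat b ∧ FirstNe a b ∧ w = a.inv.concat b

/-- The last letter is not the inverse of the first one. -/
def IsCyclicallyReduced (u : ZnWord n X) : Prop :=
  u.IsReduced ∧ ∀ x, u.letter (unit n) = some x → u.letter u.len ≠ some (letterInv x)

/-- `v ∈ CDR(ℤⁿ, X)`: `v` is reduced and has a cyclic decomposition `v = c⁻¹ ∘ u ∘ c`. -/
def IsCDR (v : ZnWord n X) : Prop :=
  v.IsReduced ∧ ∃ c u : ZnWord n X,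
    c.IsReduced ∧ u.IsCyclicallyReduced ∧ v = (c.inv.concat u).concat c

end ZnWord

/-- A realisation of the group `G` as a subgroup of `CDR(ℤⁿ, X)`: an injection of `G` onto a set
of words in `CDR(ℤⁿ, X)` under which the group operations are the operations on words. -/
structure WordGroup (n : ℕ) (X G : Type*) [Group G] where
  word : G → ZnWord n X
  injective : Function.Injective word
  isCDR : ∀ g, (word g).IsCDR
  word_one_len : (word 1).len = 0
  word_inv : ∀ g, word g⁻¹ = (word g).inv
  word_mul : ∀ g h, (word g).IsMul (word h) (word (g * h))

namespace WordGroup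

variable {n : ℕ} {X G : Type*} [Group G] (ρ : WordGroup n X G)

/-- The length `|g|`. -/
def len (g : G) : Zn n := (ρ.word g).len

/-- `G` is irreducible: there are no `k < n`, subgroup `H` of `CDR(ℤᵏ, X)` and reduced word `r`
with `r⁻¹ ∗ G ∗ r = H`. -/
def IsIrreducible : Prop :=
  ¬ ∃ k < n, ∃ σ : WordGroup n X G, (∀ g, InZ k (σ.len g)) ∧
    ∃ r : ZnWord n X, r.IsReduced ∧
      ∀ g, ∃ w : ZnWord n X, r.inv.IsMul (ρ.word g) w ∧ w.IsMul r (σ.word g)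

theorem exists_com (f g : G) : ∃ c a b : ZnWord n X,
    ρ.word f = c.concat a ∧ ρ.word g = c.concat b ∧ a.FirstNe b ∧
      ρ.word (f⁻¹ * g) = a.inv.concat b := by
  obtain ⟨c, a, b, h1, h2, h3, h4⟩ := ρ.word_mul f⁻¹ g
  exact ⟨c, a, b, by rw [← h1, ← ρ.word_inv, inv_inv], h2, h3, h4⟩

/-- The longest common initial segment `com(f, g)`. -/
def com (f g : G) : ZnWord n X := (ρ.exists_com f g).choose

/-- `c(f, g) = |com(f, g)|`. -/
def c (f g : G) : Zn n := (ρ.com f g).len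

theorem len_nonneg (g : G) : 0 ≤ ρ.len g := (ρ.word g).len_nonneg

theorem len_one : ρ.len 1 = 0 := ρ.word_one_len

theorem len_inv (g : G) : ρ.len g⁻¹ = ρ.len g := by
  unfold len; rw [ρ.word_inv]; rfl

theorem c_nonneg (f g : G) : 0 ≤ ρ.c f g := (ρ.com f g).len_nonneg

theorem c_le_left (f g : G) : ρ.c f g ≤ ρ.len f := by
  obtain ⟨a, b, h1, -⟩ := (ρ.exists_com f g).choose_spec
  change _ ≤ (ρ.word f).len
  rw [h1]
  exact le_add_of_nonneg_right a.len_nonneg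

theorem c_le_right (f g : G) : ρ.c f g ≤ ρ.len g := by
  obtain ⟨a, b, -, h1, -⟩ := (ρ.exists_com f g).choose_spec
  change _ ≤ (ρ.word g).len
  rw [h1]
  exact le_add_of_nonneg_right b.len_nonneg

theorem c_add_c (f g : G) : ρ.c f g + ρ.c f g + ρ.len (f⁻¹ * g) = ρ.len f + ρ.len g := by
  obtain ⟨a, b, h1, h2, -, h4⟩ := (ρ.exists_com f g).choose_spec
  have e1 : ρ.len f = ρ.c f g + a.len := by
    change (ρ.word f).len = _; rw [h1]; rfl
  have e2 : ρ.len g = ρ.c f g + b.len := by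
    change (ρ.word g).len = _; rw [h2]; rfl
  have e3 : ρ.len (f⁻¹ * g) = a.len + b.len := by
    change (ρ.word _).len = _; rw [h4]; rfl
  rw [e1, e2, e3]; abel

theorem le_c_iff (f g : G) (α : Zn n) : α ≤ ρ.c f g ↔ α ≤ ρ.len f ∧ α ≤ ρ.len g ∧
    ∀ β ≤ α, (ρ.word f).letter β = (ρ.word g).letter β := by
  constructor
  · intro h
    refine ⟨h.trans (ρ.c_le_left f g), h.trans (ρ.c_le_right f g), fun β hβ => ?_⟩
    have hc : β ≤ (ρ.com f g).len := hβ.trans h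
    obtain ⟨a, b, h1, h2, -⟩ := (ρ.exists_com f g).choose_spec
    change ρ.word f = (ρ.com f g).concat a at h1
    change ρ.word g = (ρ.com f g).concat b at h2
    rw [h1, h2]
    simp only [ZnWord.concat, if_pos hc]
  · rintro ⟨h1, h2, h3⟩
    by_contra hlt
    rw [not_le] at hlt
    obtain ⟨a, b, e1, e2, e3, -⟩ := (ρ.exists_com f g).choose_spec
    change ρ.word f = (ρ.com f g).concat a at e1
    change ρ.word g = (ρ.com f g).concat b at e2
    have hpos : 0 < α - ρ.c f g := sub_pos.2 hlt
    have hu := unit_pos_of_pos hpos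
    have hle : ρ.c f g + unit n ≤ α := by
      have := unit_le_of_pos hpos
      grind
    have hsome : ((ρ.word f).letter (ρ.c f g + unit n)).isSome := by
      rw [ZnWord.isSome_iff]
      exact ⟨le_add_of_nonneg_left (ρ.c_nonneg f g), hle.trans h1⟩
    obtain ⟨x, hx⟩ := Option.isSome_iff_exists.1 hsome
    have hx' := hx
    rw [h3 _ hle] at hx'
    have hn : ¬ (ρ.c f g + unit n ≤ (ρ.com f g).len) := by
      change ¬ (ρ.c f g + unit n ≤ ρ.c f g)
      grind
    have hs : ρ.c f g + unit n - (ρ.com f g).len = unit n := by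
      change ρ.c f g + unit n - ρ.c f g = unit n
      abel
    rw [e1] at hx
    rw [e2] at hx'
    simp only [ZnWord.concat, if_neg hn, hs] at hx hx'
    exact e3 x hx hx'

theorem c_self (g : G) : ρ.c g g = ρ.len g :=
  le_antisymm (ρ.c_le_left g g) ((ρ.le_c_iff g g _).2 ⟨le_rfl, le_rfl, fun _ _ => rfl⟩)

theorem c_comm (f g : G) : ρ.c f g = ρ.c g f := by
  refine eq_of_forall_le_iff fun α => ?_
  rw [le_c_iff, le_c_iff]
  constructor <;> exact fun ⟨h1, h2, h3⟩ => ⟨h2, h1, fun β hβ => (h3 β hβ).symm⟩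

theorem c_trans {f g h : G} {α : Zn n} (h1 : α ≤ ρ.c f g) (h2 : α ≤ ρ.c g h) : α ≤ ρ.c f h := by
  rw [le_c_iff] at *
  exact ⟨h1.1, h2.2.1, fun β hβ => (h1.2.2 β hβ).trans (h2.2.2 β hβ)⟩

theorem min_c_eq {f f' : G} (g : G) {α : Zn n} (h : α ≤ ρ.c f f') :
    min α (ρ.c f g) = min α (ρ.c f' g) := by
  refine eq_of_forall_le_iff fun γ => ?_
  rw [le_min_iff, le_min_iff]
  constructor <;> rintro ⟨h1, h2⟩ <;> refine ⟨h1, ?_⟩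
  · exact ρ.c_trans (by rw [ρ.c_comm]; exact h1.trans h) h2
  · exact ρ.c_trans (h1.trans h) h2

/-! ### The universal tree -/

/-- The set `S_G` of pairs `(α, g)` with `g ∈ G` and `α ∈ [0, |g|]`. -/
structure PreTree where
  ht : Zn n
  elt : G
  ht_nonneg : 0 ≤ ht
  ht_le : ht ≤ ρ.len elt

/-- `(α, f) ∼ (β, g)` if and only if `α = β ∈ [0, c(f, g)]`. -/
instance preTreeSetoid : Setoid ρ.PreTree where
  r p q := p.ht = q.ht ∧ p.ht ≤ ρ.c p.elt q.elt
  iseqv :=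
    { refl := fun p => ⟨rfl, by rw [ρ.c_self]; exact p.ht_le⟩
      symm := fun {p q} h => ⟨h.1.symm, by rw [← h.1, ρ.c_comm]; exact h.2⟩
      trans := fun {p q r} h1 h2 => ⟨h1.1.trans h2.1, ρ.c_trans h1.2 (by rw [h1.1]; exact h2.2)⟩ }

/-- The (set of points of the) universal `ℤⁿ`-tree `Γ_G = S_G / ∼`. -/
def Tree : Type _ := Quotient ρ.preTreeSetoid

/-- The base point `ε = ⟨0, 1⟩`. -/
def root : ρ.Tree := Quotient.mk ρ.preTreeSetoid ⟨0, 1, le_rfl, by rw [ρ.len_one]⟩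

/-- The distance on representatives: the segments from `ε` to `⟨α, f⟩` and to `⟨β, g⟩` have exactly
a segment of length `min (α, β, c(f, g))` in common. -/
def preDist (p q : ρ.PreTree) : Zn n :=
  p.ht + q.ht - 2 • min (min p.ht q.ht) (ρ.c p.elt q.elt)

/-- The distance from `⟨α, g⟩` to `f · ε = ⟨|f|, f⟩`. -/
def preDistTo (p : ρ.PreTree) (f : G) : Zn n :=
  p.ht + ρ.len f - 2 • min p.ht (ρ.c p.elt f)

/-- The action on representatives, with `c = c(h⁻¹, g)`: `h · ⟨α, g⟩ = ⟨|h| - α, h⟩` if `α ≤ c`,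
and `h · ⟨α, g⟩ = ⟨|h| + α - 2 c, h ∗ g⟩` if `α ≥ c`. -/
def preAct (h : G) (p : ρ.PreTree) : ρ.PreTree :=
  if hp : p.ht ≤ ρ.c h⁻¹ p.elt then
    ⟨ρ.len h - p.ht, h, by
      have := ρ.c_le_left h⁻¹ p.elt
      rw [ρ.len_inv] at this
      grind, by
      have := p.ht_nonneg
      grind⟩
  else
    ⟨ρ.len h + p.ht - 2 • ρ.c h⁻¹ p.elt, h * p.elt, by
      have h1 := ρ.c_le_left h⁻¹ p.elt
      rw [ρ.len_inv] at h1
      grind, by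
      have h2 := ρ.c_add_c h⁻¹ p.elt
      rw [ρ.len_inv, inv_inv] at h2
      have := p.ht_le
      grind⟩

theorem equiv_iff_preDistTo (p q : ρ.PreTree) : p ≈ q ↔ ρ.preDistTo p = ρ.preDistTo q := by
  constructor
  · intro h
    funext f
    unfold preDistTo
    rw [ρ.min_c_eq f h.2, h.1]
  · intro h
    have h1 := congrFun h 1
    have h2 := congrFun h p.elt
    have h3 := congrFun h q.elt
    simp only [preDistTo, ρ.c_self, ρ.len_one] at h1 h2 h3
    have a1 := ρ.c_nonneg p.elt 1
    have a2 := ρ.c_le_right p.elt 1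
    have a3 := ρ.c_nonneg q.elt 1
    have a4 := ρ.c_le_right q.elt 1
    rw [ρ.len_one] at a2 a4
    have b1 := p.ht_nonneg
    have b2 := q.ht_nonneg
    have b3 := p.ht_le
    have b4 := q.ht_le
    rw [le_antisymm a2 a1, le_antisymm a4 a3, min_eq_right b1, min_eq_right b2] at h1
    have e : p.ht = q.ht := by simpa using h1
    refine ⟨e, ?_⟩
    rw [min_eq_left b4] at h3
    by_contra hlt
    grind

theorem preDistTo_preAct (h : G) (p : ρ.PreTree) (f : G) :
    ρ.preDistTo (ρ.preAct h p) f = ρ.preDistTo p (h⁻¹ * f) := by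
  obtain ⟨α, g, hp1, hp2⟩ := p
  have e1 := ρ.c_add_c h⁻¹ g
  have e2 := ρ.c_add_c h f
  have e3 := ρ.c_add_c (h * g) f
  have e4 := ρ.c_add_c g (h⁻¹ * f)
  have e5 := ρ.c_add_c h⁻¹ (h⁻¹ * f)
  rw [mul_inv_rev, mul_assoc] at e3
  rw [inv_inv, mul_inv_cancel_left, ρ.len_inv] at e5
  rw [inv_inv, ρ.len_inv] at e1
  have t1 : ∀ γ, γ ≤ ρ.c h⁻¹ g → γ ≤ ρ.c g (h⁻¹ * f) → γ ≤ ρ.c h⁻¹ (h⁻¹ * f) :=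
    fun γ => ρ.c_trans
  have t2 : ∀ γ, γ ≤ ρ.c h⁻¹ g → γ ≤ ρ.c h⁻¹ (h⁻¹ * f) → γ ≤ ρ.c g (h⁻¹ * f) :=
    fun γ k1 k2 => ρ.c_trans (by rwa [ρ.c_comm]) k2
  have t3 : ∀ γ, γ ≤ ρ.c g (h⁻¹ * f) → γ ≤ ρ.c h⁻¹ (h⁻¹ * f) → γ ≤ ρ.c h⁻¹ g :=
    fun γ k1 k2 => ρ.c_trans k2 (by rwa [ρ.c_comm])
  have m1 := t1 _ (min_le_left _ _) (min_le_right _ _)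
  have m2 := t2 _ (min_le_left _ _) (min_le_right _ _)
  have m3 := t3 _ (min_le_left _ _) (min_le_right _ _)
  clear t1 t2 t3
  unfold preAct preDistTo
  dsimp only
  split_ifs with hα
  · dsimp only
    generalize ρ.c h⁻¹ g = c1 at *
    generalize ρ.c h f = c2 at *
    generalize ρ.c (h * g) f = c3 at *
    generalize ρ.c g (h⁻¹ * f) = c4 at *
    generalize ρ.c h⁻¹ (h⁻¹ * f) = c5 at *
    clear e3
    grind
  · dsimp only
    generalize ρ.c h⁻¹ g = c1 at *
    generalize ρ.c h f = c2 at *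
    generalize ρ.c (h * g) f = c3 at *
    generalize ρ.c g (h⁻¹ * f) = c4 at *
    generalize ρ.c h⁻¹ (h⁻¹ * f) = c5 at *
    grind

/-- The `ℤⁿ`-metric of `Γ_G`. -/
def dist (p q : ρ.Tree) : Zn n :=
  Quotient.liftOn₂ p q ρ.preDist (by
    intro p q p' q' h1 h2
    have e1 := ρ.min_c_eq q.elt h1.2
    have e2 := ρ.min_c_eq p'.elt h2.2
    rw [ρ.c_comm q.elt, ρ.c_comm q'.elt] at e2
    unfold preDist
    rw [min_right_comm, e1, min_right_comm, min_assoc, e2, ← min_assoc, h1.1, h2.1])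

/-- The action of `G` on `Γ_G`. -/
def act (h : G) : ρ.Tree → ρ.Tree :=
  Quotient.map (ρ.preAct h) (by
    intro p q hpq
    rw [equiv_iff_preDistTo] at hpq ⊢
    funext f
    rw [preDistTo_preAct, preDistTo_preAct, hpq])

theorem preDist_isGreatest (p q : ρ.PreTree) :
    IsGreatest (Set.range fun f => ρ.preDistTo p f - ρ.preDistTo q f) (ρ.preDist p q) := by
  have hp := p.ht_nonneg
  have hp' := p.ht_le
  have hq := q.ht_nonneg
  have hq' := q.ht_le
  constructor
  · by_cases h : min p.ht (ρ.c p.elt q.elt) ≤ q.ht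
    · refine ⟨q.elt, ?_⟩
      dsimp only
      unfold preDistTo preDist
      rw [ρ.c_self, min_eq_left hq']
      grind
    · refine ⟨1, ?_⟩
      have a1 := ρ.c_nonneg p.elt 1
      have a2 := ρ.c_le_right p.elt 1
      have a3 := ρ.c_nonneg q.elt 1
      have a4 := ρ.c_le_right q.elt 1
      rw [ρ.len_one] at a2 a4
      dsimp only
      unfold preDistTo preDist
      rw [le_antisymm a2 a1, le_antisymm a4 a3, min_eq_right hp, min_eq_right hq, ρ.len_one]
      grind
  · rintro _ ⟨f, rfl⟩
    have h : min (ρ.c p.elt q.elt) (ρ.c q.elt f) ≤ ρ.c p.elt f :=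
      ρ.c_trans (min_le_left _ _) (min_le_right _ _)
    dsimp only
    unfold preDistTo preDist
    grind

/-- `G` acts on `Γ_G`. -/
instance instMulActionTree : MulAction G ρ.Tree where
  smul := ρ.act
  one_smul p := by
    induction p using Quotient.inductionOn with | _ p
    refine Quotient.sound ((ρ.equiv_iff_preDistTo _ _).2 (funext fun f => ?_))
    rw [preDistTo_preAct, inv_one, one_mul]
  mul_smul g h p := by
    induction p using Quotient.inductionOn with | _ p
    refine Quotient.sound ((ρ.equiv_iff_preDistTo _ _).2 (funext fun f => ?_))
    rw [preDistTo_preAct, preDistTo_preAct, preDistTo_preAct, mul_inv_rev, mul_assoc]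

/-- The action is by isometries. -/
theorem dist_smul (h : G) (p q : ρ.Tree) : ρ.dist (h • p) (h • q) = ρ.dist p q := by
  induction p using Quotient.inductionOn with | _ p
  induction q using Quotient.inductionOn with | _ q
  have h1 := ρ.preDist_isGreatest (ρ.preAct h p) (ρ.preAct h q)
  have h2 := ρ.preDist_isGreatest p q
  change ρ.preDist (ρ.preAct h p) (ρ.preAct h q) = ρ.preDist p q
  refine h1.unique ?_
  convert h2 using 1
  simp only [preDistTo_preAct]
  exact (Equiv.mulLeft h⁻¹).surjective.range_comp
    fun f => ρ.preDistTo p f - ρ.preDistTo q f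

/-! ### Ends and the points of the compactification -/

/-- The segment `[v, w]`. -/
def seg (v w : ρ.Tree) : Set ρ.Tree := {x | ρ.dist v x + ρ.dist x w = ρ.dist v w}

/-- The `ℤᵏ`-subtrees: the classes of the equivalence relation `d(v, w) ∈ ℤᵏ`. -/
def IsSubtree (k : ℕ) (T : Set ρ.Tree) : Prop := ∃ v, T = {w | InZ k (ρ.dist v w)}

/-- The half-line `[0, ∞)` of `ℤᵏ ⊆ ℤⁿ`. -/
abbrev HalfLine (n k : ℕ) : Type := {α : Zn n // 0 ≤ α ∧ InZ k α}

/-- The origin of the half-line. -/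
def origin (n k : ℕ) : HalfLine n k := ⟨0, le_rfl, fun j _ => by unfold coord; split_ifs <;> rfl⟩

/-- A ray of `ℤᵏ`-type: an isometry from the half-line `[0, ∞)` of `ℤᵏ` to `Γ_G`. -/
structure Ray (k : ℕ) where
  toFun : HalfLine n k → ρ.Tree
  isometry : ∀ a b, ρ.dist (toFun a) (toFun b) = |a.1 - b.1|

/-- Representatives of the points of the compactification: the points of `Γ_G`, and the rays of
`ℤᵏ`-type with `1 ≤ k ≤ n`. -/
inductive PrePoint
  | vertex (v : ρ.Tree) : PrePoint
  | ray (k : ℕ) (one_le : 1 ≤ k) (le_n : k ≤ n) (γ : ρ.Ray k) : PrePoint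

/-- The identifications. Two rays represent the same end if they have a common tail. For `k < n`,
the end `α` of `ℤᵏ`-type of a `ℤᵏ`-subtree `T` is glued to the end `α'` of `ℤᵏ`-type of `T'` if `T`
and `T'` are adjacent in a `ℤᵏ⁺¹`-subtree (their distance is `1` after collapsing all
`ℤᵏ`-subtrees to points) and the segments from `T` to `T'` leave `T` through `α` and enter `T'`
through `α'`. -/
inductive Glue : ρ.PrePoint → ρ.PrePoint → Prop
  | tail (k : ℕ) (h1 : 1 ≤ k) (hn : k ≤ n) (γ γ' : ρ.Ray k)
      (h : ∃ a b, γ.toFun '' Set.Ici a = γ'.toFun '' Set.Ici b) :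
      Glue (.ray k h1 hn γ) (.ray k h1 hn γ')
  | adjacent (k : ℕ) (h1 : 1 ≤ k) (hn : k < n) (γ γ' : ρ.Ray k)
      (h : InZ (k + 1) (ρ.dist (γ.toFun (origin n k)) (γ'.toFun (origin n k))))
      (h' : coord k (ρ.dist (γ.toFun (origin n k)) (γ'.toFun (origin n k))) = 1)
      (hγ : ∀ a, γ.toFun a ∈ ρ.seg (γ.toFun (origin n k)) (γ'.toFun (origin n k)))
      (hγ' : ∀ a, γ'.toFun a ∈ ρ.seg (γ.toFun (origin n k)) (γ'.toFun (origin n k))) :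
      Glue (.ray k h1 hn.le γ) (.ray k h1 hn.le γ')

/-- The points of the compactification: `Γ_G ∪ (∂Γ_G / ∼)`. -/
def Points : Type _ := Quot ρ.Glue

/-- The ends of `ℤᵏ`-type, for `1 ≤ k ≤ n`. -/
def ends (k : ℕ) : Set ρ.Points :=
  {x | ∃ (h1 : 1 ≤ k) (hn : k ≤ n) (γ : ρ.Ray k), x = Quot.mk _ (.ray k h1 hn γ)}

/-- `v` lies on the geodesic from `w` to the given vertex or end. -/
def PrePoint.Between {ρ : WordGroup n X G} (w v : ρ.Tree) : ρ.PrePoint → Prop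
  | .vertex u => v ∈ ρ.seg w u
  | .ray _ _ _ γ => ∃ a, ∀ b, a ≤ b → v ∈ ρ.seg w (γ.toFun b)

/-- The set of all `v ∈ Γ_G` on the geodesic from `w` to `x`. -/
def geodesic (w : ρ.Tree) (x : ρ.Points) : Set ρ.Tree :=
  {v | ∃ p, Quot.mk _ p = x ∧ PrePoint.Between w v p}

/-- The image of a ray under an element of the group. -/
def Ray.smul {ρ : WordGroup n X G} {k : ℕ} (g : G) (γ : ρ.Ray k) : ρ.Ray k where
  toFun a := g • γ.toFun a
  isometry a b := by rw [ρ.dist_smul, γ.isometry]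

/-- The action on representatives. -/
def PrePoint.smul {ρ : WordGroup n X G} (g : G) : ρ.PrePoint → ρ.PrePoint
  | .vertex v => .vertex (g • v)
  | .ray k h1 hn γ => .ray k h1 hn (γ.smul g)

theorem Glue.smul {ρ : WordGroup n X G} (g : G) {p q : ρ.PrePoint} (h : ρ.Glue p q) :
    ρ.Glue (p.smul g) (q.smul g) := by
  have hs : ∀ v w x : ρ.Tree, x ∈ ρ.seg v w → g • x ∈ ρ.seg (g • v) (g • w) := by
    intro v w x hx
    change _ + _ = _
    rw [ρ.dist_smul, ρ.dist_smul, ρ.dist_smul]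
    exact hx
  cases h with
  | tail k h1 hn γ γ' h =>
    obtain ⟨a, b, h⟩ := h
    refine Glue.tail k h1 hn _ _ ⟨a, b, ?_⟩
    have := congrArg (fun s => (fun v => g • v) '' s) h
    simp only [Set.image_image] at this
    exact this
  | adjacent k h1 hn γ γ' h h' hγ hγ' =>
    refine Glue.adjacent k h1 hn _ _ ?_ ?_ (fun a => hs _ _ _ (hγ a)) (fun a => hs _ _ _ (hγ' a))
    · change InZ (k + 1) (ρ.dist (g • _) (g • _))
      rwa [ρ.dist_smul]
    · change coord k (ρ.dist (g • _) (g • _)) = 1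
      rwa [ρ.dist_smul]

/-- The action of `G` on the compactification. -/
instance instMulActionPoints : MulAction G ρ.Points where
  smul g := Quot.map (PrePoint.smul g) fun _ _ => Glue.smul g
  one_smul x := by
    induction x using Quot.inductionOn with | _ p
    change Quot.mk _ (p.smul 1) = Quot.mk _ p
    cases p <;> simp [PrePoint.smul, Ray.smul]
  mul_smul g h x := by
    induction x using Quot.inductionOn with | _ p
    change Quot.mk _ (p.smul (g * h)) = Quot.mk _ ((p.smul h).smul g)
    cases p <;> simp [PrePoint.smul, Ray.smul, mul_smul]

/-! ### The metric of the compactification -/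

/-- The arbitrary choices in the construction of the metric.
* `base k T` is a point of the `ℤᵏ`-subtree `T`. If `k = 1`, it is the base point of the simplicial
  tree `T`; if `k = j + 1` with `j ≥ 1`, the `ℤʲ`-subtree of `T` that contains it is the subtree
  `T₀` of level `0` in `T`.
* `index j S` is the number of the `ℤʲ`-subtree `S` in an enumeration of all the `ℤʲ`-subtrees
  that lie in the same `ℤʲ⁺¹`-subtree `T` as `S` and have the same level in `T`. -/
structure MetricChoice where
  base : ℕ → Set ρ.Tree → ρ.Tree
  base_mem : ∀ k T, ρ.IsSubtree k T → base k T ∈ T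
  index : ℕ → Set ρ.Tree → ℕ
  index_injective : ∀ j T S S', ρ.IsSubtree (j + 1) T → ρ.IsSubtree j S → ρ.IsSubtree j S' →
    S ⊆ T → S' ⊆ T →
    (∃ v ∈ S, ∃ v' ∈ S',
      coord j (ρ.dist (base (j + 1) T) v) = coord j (ρ.dist (base (j + 1) T) v')) →
    index j S = index j S' → S = S'

variable {ρ}

namespace MetricChoice

/-- The level of a `ℤʲ`-subtree `S` of a `ℤʲ⁺¹`-subtree `T`: its distance from the subtree `T₀` of
level `0` after collapsing all `ℤʲ`-subtrees of `T` to points. -/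
def level (C : ρ.MetricChoice) (j : ℕ) (T S : Set ρ.Tree) : ℕ :=
  sInf {m : ℕ | ∃ v ∈ S, coord j (ρ.dist (C.base (j + 1) T) v) = m}

open Classical in
/-- The rescaling constant of a `ℤʲ`-subtree `S` of a `ℤʲ⁺¹`-subtree `T`: it is `1` for `T₀`, and
`1 / 2 ^ (k + m)` for the subtree with number `m` in level `k ≥ 1`. -/
def scale (C : ρ.MetricChoice) (j : ℕ) (T S : Set ρ.Tree) : ℝ :=
  if C.base (j + 1) T ∈ S then 1 else 1 / 2 ^ (C.level j T S + C.index j S)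

open Classical in
/-- The metric of the compactification of a `ℤᵏ`-subtree `T`, applied to the projections of `x` and
`y` to this compactification.

If `k = 1`, it is the visual metric `exp (-(x · y)_w)` of the simplicial tree `T` for `x ≠ y`. Here
`w` is the base point of `T`, and the Gromov product `(x · y)_w` is the number of points other than
`w` which the geodesics in `T` from `w` to `x` and to `y` have in common.

If `k = j + 1` with `j ≥ 1`, then the geodesic from `x` to `y` crosses a sequence of consecutively
adjacent `ℤʲ`-subtrees `S` of `T`, and the distance is the sum of the rescaled distances in these
`S` between the point at which the geodesic enters `S` and the one at which it leaves `S`. These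
two points are the projections of `x` and `y` to the compactification of `S`; for all the other
`S` the two projections agree, and the corresponding term is `0`. -/
def subtreeDist (C : ρ.MetricChoice) : ℕ → Set ρ.Tree → ρ.Points → ρ.Points → ℝ
  | 0, _, _, _ => 0
  | 1, T, x, y =>
    if T ∩ ρ.geodesic (C.base 1 T) x = T ∩ ρ.geodesic (C.base 1 T) y then 0
    else Real.exp
      (-(((T ∩ ρ.geodesic (C.base 1 T) x ∩ ρ.geodesic (C.base 1 T) y) \ {C.base 1 T}).ncard : ℝ))
  | j + 2, T, x, y =>
    ∑' S : {S : Set ρ.Tree // ρ.IsSubtree (j + 1) S ∧ S ⊆ T},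
      C.scale (j + 1) T S.1 * C.subtreeDist (j + 1) S.1 x y

end MetricChoice

/-- The compactification of `Γ_G`. -/
def Compactification (_C : ρ.MetricChoice) : Type _ := ρ.Points

variable (C : ρ.MetricChoice)

instance instMulActionCompactification : MulAction G (Compactification C) :=
  ρ.instMulActionPoints

/-- The metric of the compactification; `Γ_G` is its own unique `ℤⁿ`-subtree. -/
def compactDist (x y : Compactification C) : ℝ := C.subtreeDist n Set.univ x y

/-- The topology of the metric. -/
instance instTopologicalSpaceCompactification : TopologicalSpace (Compactification C) where
  IsOpen U := ∀ x ∈ U, ∃ ε > 0, ∀ y, compactDist C x y < ε → y ∈ U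
  isOpen_univ := fun _ _ => ⟨1, one_pos, fun _ _ => trivial⟩
  isOpen_inter U V hU hV := by
    rintro x ⟨hxU, hxV⟩
    obtain ⟨ε, hε, h1⟩ := hU x hxU
    obtain ⟨δ, hδ, h2⟩ := hV x hxV
    exact ⟨min ε δ, lt_min hε hδ, fun y hy =>
      ⟨h1 y (hy.trans_le (min_le_left _ _)), h2 y (hy.trans_le (min_le_right _ _))⟩⟩
  isOpen_sUnion s hs := by
    rintro x ⟨U, hU, hx⟩
    obtain ⟨ε, hε, h⟩ := hs U hU x hx
    exact ⟨ε, hε, fun y hy => ⟨U, hU, h y hy⟩⟩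

instance instMeasurableSpaceCompactification : MeasurableSpace (Compactification C) := borel _

instance instBorelSpaceCompactification : BorelSpace (Compactification C) := ⟨rfl⟩

/-- The set `∂_n Γ_G` of ends of `ℤⁿ`-type in the compactification. -/
def topEnds : Set (Compactification C) := ρ.ends n

end WordGroup

/-! ### Random walks, stationary measures and `μ`-boundaries -/

section RandomWalk

variable {G : Type*} [Group G] [MeasurableSpace G]

/-- The support of `μ` generates `G` as a semigroup. -/
def IsNonDegenerate (μ : Measure G) : Prop :=
  Subsemigroup.closure {g : G | μ {g} ≠ 0} = ⊤

/-- The measure `P_μ` on the path space `G^{ℤ_+}` of the right random walk with distribution `μ`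
started at `1`: the law of `(τ_i)` with `τ_i = h_0 h_1 ⋯ h_{i-1}`, where the increments `h_j` are
independent with distribution `μ`. -/
def walkMeasure (μ : Measure G) [IsProbabilityMeasure μ] : Measure (ℕ → G) :=
  (Measure.infinitePi fun _ : ℕ => μ).map fun h i => ((List.range i).map h).prod

variable {M : Type*} [MulAction G M] [MeasurableSpace M]

/-- `ν` is `μ`-stationary: `∑_g μ(g) (g · ν) = ν`. -/
def IsStationary (μ : Measure G) (ν : Measure M) : Prop :=
  Measure.sum (fun g : G => μ {g} • ν.map (g • ·)) = ν

/-- Weak convergence of measures, tested on bounded continuous functions. -/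
def WeaklyTendsto [TopologicalSpace M] (ν : ℕ → Measure M) (ν' : Measure M) : Prop :=
  ∀ f : M →ᵇ ℝ, Tendsto (fun i => ∫ x, f x ∂(ν i)) atTop (𝓝 (∫ x, f x ∂ν'))

/-- `(M, ν)` is a `μ`-boundary: `ν` is `μ`-stationary, and for almost every path `τ` of the random
walk the measures `τ_i · ν` converge weakly to a Dirac measure. -/
def IsMuBoundary [TopologicalSpace M] (μ : Measure G) [IsProbabilityMeasure μ]
    (ν : Measure M) : Prop :=
  IsStationary μ ν ∧ ∀ᵐ τ ∂(walkMeasure μ), ∃ ω : M,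
    WeaklyTendsto (fun i => ν.map (τ i • ·)) (Measure.dirac ω)

end RandomWalk

end ZnFree

end

noncomputable section

namespace ZnFree

open scoped ENNReal

set_option linter.unusedSectionVars false

/-! ### The maximum principle and recurrence of the walk on a `G`-set. -/

section RandomWalkTheory

variable {G : Type*} [Group G] [MeasurableSpace G] [DiscreteMeasurableSpace G] [Countable G]

/-! Only the top coordinate of the `ℤⁿ`-metric matters for the measure theory. It is an
integer-valued tree pseudometric on `Γ_G` (`intTree`), and irreducibility makes its orbits unbounded
(`exists_len_ge`): otherwise some point would be moved by every `g` inside its `ℤⁿ⁻¹`-subtree only,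
and reading labels from that point would conjugate `G` into `CDR(ℤⁿ⁻¹, X)`.

The compactification need not be compact, so existence is proved elsewhere. A point is encoded by
its orientation: for each pair `(w, v)`, whether the path from `w` to the point passes `v`. All
orientations form the compact space `Ori`. The closed invariant set `K` of limits of vertices splits
into the vertices and the set `E` of ends (`exists_eq_ori`). Krylov–Bogoliubov averages give a
stationary measure on `K`.

The engine is a maximum principle (`finite_orbit_of_subharmonic`): a summable subharmonic function
on a `G`-set vanishes on infinite orbits. Hence a stationary measure has no atom with infinite
orbit. Vertices have infinite orbits because displacements are unbounded. Ends have infinite orbits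
(`infinite_orbit`) because otherwise a normal subgroup of finite index would fix an end; the
Busemann cocycle embeds it in `ℤⁿ`, conjugation preserves translation lengths, so this subgroup is
central, and the transfer to the centre makes the torsion-free group `G` abelian.

For convergence, the mass of a half-space along the walk is a bounded martingale. For an atomless
measure only finitely many half-spaces have mass in `[η, 1 - η]` (`finite_half`), and the walk does
not stay in a finite part of the infinite orbit of a half-space (`measure_eventually_mem_finite`).
So every limit is `0` or `1` (`ae_tendsto_zero_or_one`), that is, the translated measures converge
to a point mass. The stationary measure is the law of this limit. Uniqueness follows since the mean
of two stationary measures is stationary too, and the mean of two values in `{0, 1}` is again in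
`{0, 1}` only if they agree.

To return to the compactification, `orient` maps the ends of `ℤⁿ`-type equivariantly and bijectively
onto `E`, with measurable inverse `endPoint`. The other points carry no stationary mass
(`ae_mem_topEnds`), again by the maximum principle, applied to the `ℤⁿ⁻¹`-subtrees. Finally a
neighbourhood of a top end contains all points lying in the direction of some vertex
(`exists_orient_subset`), which turns convergence and positivity on half-spaces into weak
convergence and positivity on open sets. -/

theorem tsum_measure_singleton (μ : Measure G) [IsProbabilityMeasure μ] :
    ∑' g : G, μ {g} = 1 := by
  have := tsum_measure_preimage_singleton (μ := μ) (f := id) (Set.to_countable Set.univ)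
    (fun y _ => by simp)
  rw [tsum_univ (fun g : G => μ (id ⁻¹' {g}))] at this
  simpa using this

/-- Maximum principle for summable subharmonic functions on a `G`-set. -/
theorem finite_orbit_of_subharmonic {𝒮 : Type*} [MulAction G 𝒮] (μ : Measure G)
    [IsProbabilityMeasure μ] (hμ : IsNonDegenerate μ) (f : 𝒮 → ℝ≥0∞) (hf : ∑' s, f s ≠ ∞)
    (hfμ : ∀ s, f s ≤ ∑' g : G, μ {g} * f (g⁻¹ • s)) {s₀ : 𝒮} (h₀ : f s₀ ≠ 0) :
    (MulAction.orbit G s₀).Finite := by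
  set O := MulAction.orbit G s₀ with hO
  have hfin : ∀ s, f s ≠ 0 → {t | f s ≤ f t}.Finite := fun s hs =>
    ENNReal.finite_const_le_of_tsum_ne_top hf hs
  have hne : ({t | f s₀ ≤ f t} ∩ O).Nonempty := ⟨s₀, le_refl (f s₀), MulAction.mem_orbit_self s₀⟩
  -- Superlevel sets of a summable function are finite, so the maximum over the orbit is attained.
  obtain ⟨s₁, ⟨h1, h1O⟩, hmax⟩ := Set.exists_max_image _ f ((hfin s₀ h₀).inter_of_left O) hne
  have hmax' : ∀ t ∈ O, f t ≤ f s₁ := by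
    intro t ht
    by_cases h : f s₀ ≤ f t
    · exact hmax t ⟨h, ht⟩
    · exact (le_of_not_ge h).trans h1
  have hs1 : f s₁ ≠ 0 := fun h => h₀ (le_antisymm (h ▸ h1) bot_le)
  have hs1' : f s₁ ≠ ∞ := ne_top_of_le_ne_top hf (ENNReal.le_tsum s₁)
  -- At a maximum the average can only be as large if the value is maximal at every `g⁻¹ • s` with
  -- `μ {g} ≠ 0`. Since the support generates `G`, the function is constant on the orbit, which then
  -- lies in one finite superlevel set.
  have key : ∀ g : G, ∀ s ∈ O, f s = f s₁ → f (g⁻¹ • s) = f s₁ := by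
    intro g
    have hg : g ∈ Subsemigroup.closure {g : G | μ {g} ≠ 0} := by
      rw [show Subsemigroup.closure {g : G | μ {g} ≠ 0} = ⊤ from hμ]; trivial
    induction hg using Subsemigroup.closure_induction with
    | mem g hg =>
      intro s hs e
      have hO' : ∀ h : G, h⁻¹ • s ∈ O := fun h => by
        rw [hO, MulAction.mem_orbit_iff] at *
        obtain ⟨k, rfl⟩ := hs
        exact ⟨h⁻¹ * k, mul_smul _ _ _⟩
      by_contra hlt
      have hlt : f (g⁻¹ • s) < f s₁ := lt_of_le_of_ne (hmax' _ (hO' g)) hlt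
      have hsum : ∑' h : G, μ {h} * f s₁ = f s₁ := by
        rw [ENNReal.tsum_mul_right, tsum_measure_singleton, one_mul]
      have : ∑' h : G, μ {h} * f (h⁻¹ • s) < ∑' h : G, μ {h} * f s₁ := by
        refine ENNReal.tsum_lt_tsum (i := g) ?_ (fun h => ?_) ?_
        · refine ne_top_of_le_ne_top hs1' ?_
          rw [← hsum]
          exact ENNReal.tsum_le_tsum fun h => mul_le_mul_right (hmax' _ (hO' h)) _
        · exact mul_le_mul_right (hmax' _ (hO' h)) _
        · exact ENNReal.mul_lt_mul_right hg (measure_ne_top μ _) hlt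
      have h3 := hfμ s
      rw [hsum] at this
      rw [e] at h3
      exact absurd (h3.trans_lt this) (lt_irrefl _)
    | mul a b _ _ iha ihb =>
      intro s hs e
      rw [mul_inv_rev, mul_smul]
      refine ihb _ ?_ (iha s hs e)
      rw [hO, MulAction.mem_orbit_iff] at *
      obtain ⟨k, rfl⟩ := hs
      exact ⟨a⁻¹ * k, mul_smul _ _ _⟩
  refine (hfin s₁ hs1).subset ?_
  rintro t ht
  have : ∃ g : G, g⁻¹ • s₁ = t := by
    rw [hO, MulAction.mem_orbit_iff] at *
    obtain ⟨k, rfl⟩ := ht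
    obtain ⟨l, rfl⟩ := h1O
    exact ⟨l * k⁻¹, by simp [mul_smul]⟩
  obtain ⟨g, rfl⟩ := this
  exact (key g s₁ h1O rfl).ge

/-- The position of the walk with increments `h` at time `i`. -/
def walk (h : ℕ → G) (i : ℕ) : G := ((List.range i).map h).prod

theorem walk_zero (h : ℕ → G) : walk h 0 = 1 := by simp [walk]

theorem walk_succ (h : ℕ → G) (i : ℕ) : walk h (i + 1) = walk h i * h i := by
  simp [walk, List.range_succ]

/-- Prepend an increment. -/
def consPath (p : G × (ℕ → G)) (i : ℕ) : G := Nat.casesOn i p.1 p.2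

theorem walk_consPath (p : G × (ℕ → G)) (i : ℕ) :
    walk (consPath p) (i + 1) = p.1 * walk p.2 i := by
  simp [walk, List.range_succ_eq_map, consPath, Function.comp_def]

theorem measurable_consPath : Measurable (consPath (G := G)) := by
  refine measurable_pi_lambda _ fun i => ?_
  cases i with
  | zero => exact measurable_fst
  | succ i => exact (measurable_pi_apply i).comp measurable_snd

theorem measurable_walk (i : ℕ) : Measurable fun h : ℕ → G => walk h i := by
  induction i with
  | zero => simp only [walk_zero]; exact measurable_const
  | succ i ih =>
    simp only [walk_succ]
    exact (measurable_of_countable fun p : G × G => p.1 * p.2).comp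
      (ih.prodMk (measurable_pi_apply i))

/-- The law of the increments. -/
abbrev incrMeasure (μ : Measure G) [IsProbabilityMeasure μ] : Measure (ℕ → G) :=
  Measure.infinitePi fun _ : ℕ => μ

/-- Prepending an independent increment reproduces the product law; every conditioning on the first
step goes through this. -/
theorem map_consPath (μ : Measure G) [IsProbabilityMeasure μ] :
    (μ.prod (incrMeasure μ)).map consPath = incrMeasure μ := by
  refine Measure.eq_infinitePi _ fun s t ht => ?_
  rw [Measure.map_apply measurable_consPath (MeasurableSet.pi s.countable_toSet fun i _ => ht i)]
  have hpre : consPath ⁻¹' (Set.pi (s : Set ℕ) t) =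
      (if 0 ∈ s then t 0 else Set.univ) ×ˢ
        Set.pi ((s.preimage Nat.succ Nat.succ_injective.injOn : Finset ℕ) : Set ℕ)
          fun i => t (i + 1) := by
    ext ⟨g, h⟩
    simp only [Set.mem_preimage, Set.mem_pi, Set.mem_prod, Finset.mem_coe, Finset.mem_preimage]
    constructor
    · intro H
      refine ⟨?_, fun i hi => H (i + 1) hi⟩
      split_ifs with h0
      · exact H 0 h0
      · trivial
    · rintro ⟨H0, H⟩ i hi
      cases i with
      | zero => rw [if_pos hi] at H0; exact H0
      | succ i => exact H i hi
  rw [hpre, Measure.prod_prod, Measure.infinitePi_pi _ fun i _ => ht (i + 1)]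
  have hs : s = (if 0 ∈ s then {0} else ∅) ∪
      (s.preimage Nat.succ Nat.succ_injective.injOn).image Nat.succ := by
    ext i
    cases i with
    | zero => by_cases h0 : 0 ∈ s <;> simp [h0]
    | succ i => by_cases h0 : 0 ∈ s <;> simp [h0]
  conv_rhs => rw [hs]
  rw [Finset.prod_union, Finset.prod_image (fun a _ b _ h => Nat.succ_injective h)]
  · congr 1
    split_ifs <;> simp
  · rw [Finset.disjoint_left]
    intro i hi
    split_ifs at hi
    · simp at hi; subst hi; simp
    · simp at hi

theorem incrMeasure_apply_eq_tsum (μ : Measure G) [IsProbabilityMeasure μ] {A : Set (ℕ → G)}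
    (hA : MeasurableSet A) :
    incrMeasure μ A = ∑' g : G, μ {g} * incrMeasure μ {h | consPath (g, h) ∈ A} := by
  conv_lhs => rw [← map_consPath μ]
  rw [Measure.map_apply measurable_consPath hA, Measure.prod_apply (measurable_consPath hA),
    lintegral_countable']
  exact tsum_congr fun g => mul_comm _ _

/-- A walk on an infinite orbit does not stay in a finite set from some time on. -/
theorem measure_eventually_mem_finite {𝒮 : Type*} [MulAction G 𝒮] (μ : Measure G)
    [IsProbabilityMeasure μ] (hμ : IsNonDegenerate μ) {F : Set 𝒮} (hF : F.Finite) {s : 𝒮}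
    (hs : (MulAction.orbit G s).Infinite) :
    ∀ᵐ h ∂(incrMeasure μ), ¬ ∀ᶠ i in atTop, (walk h i)⁻¹ • s ∈ F := by
  set A : ℕ → 𝒮 → Set (ℕ → G) := fun k t => {h | ∀ i, k ≤ i → (walk h i)⁻¹ • t ∈ F} with hA
  have hAm : ∀ k t, MeasurableSet (A k t) := by
    intro k t
    have : A k t = ⋂ i, ⋂ (_ : k ≤ i), (fun h => walk h i) ⁻¹' {g | g⁻¹ • t ∈ F} := by
      ext h; simp [hA]
    rw [this]
    exact MeasurableSet.iInter fun i => MeasurableSet.iInter fun _ =>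
      measurable_walk i (MeasurableSet.of_discrete)
  have hstep : ∀ k t, incrMeasure μ (A (k + 1) t) =
      ∑' g : G, μ {g} * incrMeasure μ (A k (g⁻¹ • t)) := by
    intro k t
    rw [incrMeasure_apply_eq_tsum μ (hAm _ _)]
    refine tsum_congr fun g => ?_
    congr 2
    ext h
    simp only [hA, Set.mem_ofPred_eq]
    constructor
    · intro H i hi
      have := H (i + 1) (by omega)
      rwa [walk_consPath, mul_inv_rev, mul_smul] at this
    · intro H i hi
      obtain ⟨j, rfl⟩ : ∃ j, i = j + 1 := ⟨i - 1, by omega⟩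
      rw [walk_consPath, mul_inv_rev, mul_smul]
      exact H j (by omega)
  have hzero : ∀ t, (MulAction.orbit G t).Infinite → incrMeasure μ (A 0 t) = 0 := by
    intro t ht
    by_contra hne
    -- The probability of staying in `F` from time `0` on vanishes outside the finite set `F`, so it
    -- is summable; it is subharmonic because staying from time `0` on implies staying from time `1`
    -- on.
    refine ht (finite_orbit_of_subharmonic μ hμ (fun t => incrMeasure μ (A 0 t)) ?_ ?_ hne)
    · have hsupp : ∀ t ∉ hF.toFinset, incrMeasure μ (A 0 t) = 0 := by
        intro t ht
        have : A 0 t = ∅ := by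
          ext h
          simp only [hA, Set.mem_ofPred_eq, Set.mem_empty_iff_false, iff_false]
          intro H
          have := H 0 le_rfl
          rw [walk_zero, inv_one, one_smul] at this
          exact ht (by simpa using this)
        rw [this, measure_empty]
      rw [tsum_eq_sum hsupp]
      exact ENNReal.sum_ne_top.2 fun _ _ => measure_ne_top _ _
    · intro t
      rw [← hstep]
      exact measure_mono fun h H i _ => H i (Nat.zero_le i)
  have hall : ∀ k t, (MulAction.orbit G t).Infinite → incrMeasure μ (A k t) = 0 := by
    intro k
    induction k with
    | zero => exact hzero
    | succ k ih =>
      intro t ht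
      rw [hstep]
      refine ENNReal.tsum_eq_zero.2 fun g => ?_
      rw [ih, mul_zero]
      rwa [MulAction.orbit_smul]
  have : ∀ᵐ h ∂(incrMeasure μ), ∀ k, h ∉ A k s :=
    ae_all_iff.2 fun k => measure_eq_zero_iff_ae_notMem.1 (hall k s hs)
  filter_upwards [this] with h hh H
  obtain ⟨k, hk⟩ := eventually_atTop.1 H
  exact hh k hk

end RandomWalkTheory

end ZnFree

namespace ZnFree

open scoped ENNReal

set_option linter.unusedSectionVars false

/-! ### Bounded harmonic functions along the walk. -/

section Harmonic

variable {G : Type*} [Group G] [MeasurableSpace G] [DiscreteMeasurableSpace G] [Countable G]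

theorem walk_congr {h h' : ℕ → G} {k : ℕ} (H : ∀ j < k, h j = h' j) : walk h k = walk h' k := by
  unfold walk
  congr 1
  exact List.map_congr_left fun j hj => H j (List.mem_range.1 hj)

/-- The product of the increments at times `0, …, i`. -/
def initialProd (i : ℕ) (x : Finset.Iic i → G) : G :=
  walk (fun j => if hj : j ∈ Finset.Iic i then x ⟨j, hj⟩ else 1) (i + 1)

theorem initialProd_frestrictLe (i : ℕ) (h : ℕ → G) :
    initialProd i (Preorder.frestrictLe i h) = walk h (i + 1) := by
  refine walk_congr fun j hj => ?_
  rw [dif_pos (Finset.mem_Iic.2 (by omega))]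
  rfl

/-- Independence of the next increment from the past, in the form in which Fubini can be applied to
it. -/
theorem map_frestrictLe_prodMk (μ : Measure G) [IsProbabilityMeasure μ] (i : ℕ) :
    (incrMeasure μ).map (fun h => (Preorder.frestrictLe (π := fun _ => G) i h, h (i + 1))) =
      ((incrMeasure μ).map (Preorder.frestrictLe (π := fun _ => G) i)).prod μ := by
  have hind := ProbabilityTheory.iIndepFun_infinitePi (P := fun _ : ℕ => μ)
    (X := fun _ x => x) fun _ => measurable_id
  have h2 := hind.indepFun_finset (Finset.Iic i) {i + 1} (by simp)
    fun j => measurable_pi_apply j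
  have h3 := h2.comp (φ := id) (ψ := fun x => x ⟨i + 1, by simp⟩) measurable_id
    (measurable_of_countable _)
  have h4 := (ProbabilityTheory.indepFun_iff_map_prod_eq_prod_map_map
    (Preorder.measurable_frestrictLe i).aemeasurable (measurable_pi_apply (i + 1)).aemeasurable).1 h3
  refine h4.trans ?_
  congr 1
  exact Measure.infinitePi_map_eval _ _

theorem integrable_of_le_one {α : Type*} [MeasurableSpace α] {P : Measure α} [IsFiniteMeasure P]
    {f : α → ℝ} (hf : Measurable f) (h0 : ∀ a, 0 ≤ f a) (h1 : ∀ a, f a ≤ 1) : Integrable f P :=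
  Integrable.of_bound hf.aestronglyMeasurable 1
    (Eventually.of_forall fun a => by rw [Real.norm_of_nonneg (h0 a)]; exact h1 a)

/-- A bounded harmonic function evaluated along the walk is a martingale. -/
theorem martingale_harmonic (μ : Measure G) [IsProbabilityMeasure μ] {m : G → ℝ}
    (h0 : ∀ g, 0 ≤ m g) (h1 : ∀ g, m g ≤ 1) (hm : ∀ g, ∫ x, m (g * x) ∂μ = m g) :
    Martingale (fun (i : ℕ) (h : ℕ → G) => m (walk h (i + 1))) Filtration.piLE
      (incrMeasure μ) := by
  have hmeas : ∀ i, Measurable fun h : ℕ → G => m (walk h (i + 1)) := fun i =>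
    (measurable_of_countable m).comp (measurable_walk _)
  refine martingale_of_setIntegral_eq_succ (fun i => ?_) (fun i => ?_) ?_
  -- The filtration at time `i` sees the increments `0, …, i`, hence the position at time `i + 1`;
  -- this is the reason for the shift of the index.
  · refine Measurable.stronglyMeasurable ?_
    rw [Filtration.piLE_eq_comap_frestrictLe]
    have : (fun h : ℕ → G => m (walk h (i + 1))) =
        (fun x => m (initialProd i x)) ∘ Preorder.frestrictLe i := by
      ext h; simp only [Function.comp, initialProd_frestrictLe]
    rw [this]
    exact (measurable_of_countable _).comp (comap_measurable _)
  · exact integrable_of_le_one (hmeas i) (fun _ => h0 _) fun _ => h1 _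
  · intro i s hs
    rw [Filtration.piLE_eq_comap_frestrictLe] at hs
    obtain ⟨B, hB, rfl⟩ := hs
    set X : (ℕ → G) → (Finset.Iic i → G) := Preorder.frestrictLe (π := fun _ => G) i with hX
    have hXm : Measurable X := Preorder.measurable_frestrictLe i
    set Φ : (Finset.Iic i → G) × G → ℝ := fun p =>
      B.indicator (fun x => m (initialProd i x * p.2)) p.1 with hΦ
    have e1 : ∫ h in X ⁻¹' B, m (walk h (i + 1 + 1)) ∂(incrMeasure μ) =
        ∫ h, Φ (X h, h (i + 1)) ∂(incrMeasure μ) := by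
      rw [← integral_indicator (hXm hB)]
      refine integral_congr_ae (Eventually.of_forall fun h => ?_)
      simp only [hΦ, Set.indicator, Set.mem_preimage, hX, initialProd_frestrictLe,
        walk_succ h (i + 1)]
      rfl
    have e2 : ∫ h in X ⁻¹' B, m (walk h (i + 1)) ∂(incrMeasure μ) =
        ∫ h, B.indicator (fun x => m (initialProd i x)) (X h) ∂(incrMeasure μ) := by
      rw [← integral_indicator (hXm hB)]
      refine integral_congr_ae (Eventually.of_forall fun h => ?_)
      simp only [Set.indicator, Set.mem_preimage, hX, initialProd_frestrictLe]
      rfl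
    have hΦm : Measurable Φ := measurable_of_countable _
    rw [e1, e2, ← integral_map (μ := incrMeasure μ) (φ := fun h => (X h, h (i + 1)))
      (hXm.prodMk (measurable_pi_apply _)).aemeasurable hΦm.aestronglyMeasurable,
      map_frestrictLe_prodMk,
      ← integral_map (μ := incrMeasure μ) (φ := X) hXm.aemeasurable
        (measurable_of_countable _).aestronglyMeasurable]
    have : IsProbabilityMeasure ((incrMeasure μ).map X) :=
      Measure.isProbabilityMeasure_map hXm.aemeasurable
    -- Integrating over the new increment first, harmonicity removes it.
    rw [integral_prod _ (integrable_of_le_one hΦm (fun p => ?_) fun p => ?_)]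
    · refine integral_congr_ae (Eventually.of_forall fun x => ?_)
      simp only [hΦ, Set.indicator]
      split_ifs
      · exact (hm _).symm
      · simp
    · exact Set.indicator_nonneg (fun _ _ => h0 _) _
    · simp only [hΦ, Set.indicator]
      split_ifs
      · exact h1 _
      · exact zero_le_one

theorem ae_tendsto_harmonic (μ : Measure G) [IsProbabilityMeasure μ] {m : G → ℝ}
    (h0 : ∀ g, 0 ≤ m g) (h1 : ∀ g, m g ≤ 1) (hm : ∀ g, ∫ x, m (g * x) ∂μ = m g) :
    ∀ᵐ h ∂(incrMeasure μ), ∃ c, Tendsto (fun i => m (walk h i)) atTop (𝓝 c) := by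
  have := (martingale_harmonic μ h0 h1 hm).submartingale.exists_ae_tendsto_of_bdd (R := 1)
    fun i => by
      refine (eLpNorm_le_of_ae_bound (C := 1) (Eventually.of_forall fun h => ?_)).trans ?_
      · rw [Real.norm_of_nonneg (h0 _)]; exact h1 _
      · simp
  filter_upwards [this] with h hh
  obtain ⟨c, hc⟩ := hh
  exact ⟨c, (tendsto_add_atTop_iff_nat (f := fun i => m (walk h i)) 1).1 hc⟩

theorem integral_harmonic_walk (μ : Measure G) [IsProbabilityMeasure μ] {m : G → ℝ}
    (h0 : ∀ g, 0 ≤ m g) (h1 : ∀ g, m g ≤ 1) (hm : ∀ g, ∫ x, m (g * x) ∂μ = m g) (i : ℕ) (g : G) :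
    ∫ h, m (g * walk h i) ∂(incrMeasure μ) = m g := by
  induction i generalizing g with
  | zero => simp [walk_zero]
  | succ i ih =>
    have hmeas : Measurable fun h : ℕ → G => m (g * walk h (i + 1)) :=
      (measurable_of_countable fun x => m (g * x)).comp (measurable_walk _)
    have hi : Integrable (fun p : G × (ℕ → G) => m (g * walk (consPath p) (i + 1)))
        (μ.prod (incrMeasure μ)) :=
      integrable_of_le_one (hmeas.comp measurable_consPath) (fun _ => h0 _) fun _ => h1 _
    conv_lhs => rw [← map_consPath μ]
    rw [integral_map measurable_consPath.aemeasurable hmeas.aestronglyMeasurable,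
      integral_prod _ hi]
    simp only [walk_consPath, ← mul_assoc, ih]
    exact hm g

end Harmonic

/-! ### Stationary measures on a `G`-space. -/

section Stationary

variable {G : Type*} [Group G] [MeasurableSpace G] [DiscreteMeasurableSpace G] [Countable G]
variable {M : Type*} [MulAction G M] [MeasurableSpace M]

theorem IsStationary.apply {μ : Measure G} {ν : Measure M} (h : IsStationary μ ν)
    (hact : ∀ g : G, Measurable fun x : M => g • x) {E : Set M} (hE : MeasurableSet E) :
    ν E = ∑' g : G, μ {g} * ν ((g • ·) ⁻¹' E) := by
  conv_lhs => rw [← show Measure.sum (fun g : G => μ {g} • ν.map (g • ·)) = ν from h]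
  rw [Measure.sum_apply _ hE]
  exact tsum_congr fun g => by rw [Measure.smul_apply, Measure.map_apply (hact g) hE, smul_eq_mul]

theorem isStationary_of_apply {μ : Measure G} {ν : Measure M}
    (hact : ∀ g : G, Measurable fun x : M => g • x)
    (h : ∀ E, MeasurableSet E → ν E = ∑' g : G, μ {g} * ν ((g • ·) ⁻¹' E)) :
    IsStationary μ ν := by
  refine Measure.ext fun E hE => ?_
  rw [Measure.sum_apply _ hE, h E hE]
  exact tsum_congr fun g => by rw [Measure.smul_apply, Measure.map_apply (hact g) hE, smul_eq_mul]

/-- The mass of a translated set is a harmonic function of the group element, so along the walk it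
becomes a martingale. -/
theorem IsStationary.harmonic {μ : Measure G} [IsProbabilityMeasure μ] {ν : Measure M}
    [IsProbabilityMeasure ν] (h : IsStationary μ ν)
    (hact : ∀ g : G, Measurable fun x : M => g • x) {E : Set M} (hE : MeasurableSet E) (g : G) :
    ∫ x, ν.real (((g * x) • ·) ⁻¹' E) ∂μ = ν.real ((g • ·) ⁻¹' E) := by
  rw [integral_countable (integrable_of_le_one (measurable_of_countable _)
    (fun _ => measureReal_nonneg) fun _ => measureReal_le_one)]
  unfold Measure.real
  rw [h.apply hact (hact g hE), ENNReal.tsum_toReal_eq fun x =>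
    ENNReal.mul_ne_top (measure_ne_top _ _) (measure_ne_top _ _)]
  refine tsum_congr fun x => ?_
  rw [ENNReal.toReal_mul, smul_eq_mul]
  congr 3
  ext y
  simp [mul_smul]

/-- A null set of a stationary measure has null translates. -/
theorem IsStationary.measure_preimage_eq_zero {μ : Measure G} (hμ : IsNonDegenerate μ)
    {ν : Measure M} (h : IsStationary μ ν)
    (hact : ∀ g : G, Measurable fun x : M => g • x) {E : Set M} (hE : MeasurableSet E)
    (h0 : ν E = 0) (g : G) : ν ((g • ·) ⁻¹' E) = 0 := by
  have hg : g ∈ Subsemigroup.closure {g : G | μ {g} ≠ 0} := by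
    rw [show Subsemigroup.closure {g : G | μ {g} ≠ 0} = ⊤ from hμ]; trivial
  induction hg using Subsemigroup.closure_induction generalizing E with
  | mem g hg =>
    rw [h.apply hact hE, ENNReal.tsum_eq_zero] at h0
    exact (mul_eq_zero.1 (h0 g)).resolve_left hg
  | mul a b _ _ iha ihb =>
    have := ihb (hact a hE) (iha hE h0)
    convert this using 2
    ext y
    simp [mul_smul]

theorem IsStationary.ae_tendsto {μ : Measure G} [IsProbabilityMeasure μ] {ν : Measure M}
    [IsProbabilityMeasure ν] (h : IsStationary μ ν)
    (hact : ∀ g : G, Measurable fun x : M => g • x) {E : Set M} (hE : MeasurableSet E) :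
    ∀ᵐ w ∂(incrMeasure μ), ∃ c, Tendsto (fun i => ν.real ((walk w i • ·) ⁻¹' E)) atTop (𝓝 c) :=
  ae_tendsto_harmonic μ (m := fun g => ν.real ((g • ·) ⁻¹' E)) (fun _ => measureReal_nonneg)
    (fun _ => measureReal_le_one) fun g => h.harmonic hact hE g

theorem IsStationary.integral_walk {μ : Measure G} [IsProbabilityMeasure μ] {ν : Measure M}
    [IsProbabilityMeasure ν] (h : IsStationary μ ν)
    (hact : ∀ g : G, Measurable fun x : M => g • x) {E : Set M} (hE : MeasurableSet E) (i : ℕ) :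
    ∫ w, ν.real ((walk w i • ·) ⁻¹' E) ∂(incrMeasure μ) = ν.real E := by
  have := integral_harmonic_walk μ (m := fun g => ν.real ((g • ·) ⁻¹' E))
    (fun _ => measureReal_nonneg) (fun _ => measureReal_le_one)
    (fun g => h.harmonic hact hE g) i 1
  simpa using this

/-- Equivariance is asked for almost everywhere only, because `endPoint` takes a junk value on
orientations without an end. -/
theorem IsStationary.map {μ : Measure G} {ν : Measure M} (h : IsStationary μ ν)
    (hact : ∀ g : G, Measurable fun x : M => g • x)
    {N : Type*} [MulAction G N] [MeasurableSpace N]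
    (hactN : ∀ g : G, Measurable fun x : N => g • x) {φ : M → N} (hφ : Measurable φ)
    (heq : ∀ g : G, ∀ᵐ x ∂ν, φ (g • x) = g • φ x) : IsStationary μ (ν.map φ) := by
  refine isStationary_of_apply hactN fun E hE => ?_
  rw [Measure.map_apply hφ hE, h.apply hact (hφ hE)]
  refine tsum_congr fun g => ?_
  rw [Measure.map_apply hφ (hactN g hE)]
  congr 1
  refine measure_congr ?_
  filter_upwards [heq g] with x hx
  exact congrArg E hx

end Stationary

/-! ### Existence of stationary measures on compact spaces. -/

section Existence

variable {G : Type*} [Group G] [MeasurableSpace G] [DiscreteMeasurableSpace G] [Countable G]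
variable {M : Type*} [TopologicalSpace M] [CompactSpace M] [T2Space M] [SecondCountableTopology M]
  [MeasurableSpace M] [BorelSpace M] [MulAction G M]

/-- The Krylov–Bogoliubov averages. -/
def cesaroMeasure (μ : Measure G) [IsProbabilityMeasure μ] (x : M) (N : ℕ) : Measure M :=
  ((N : ℝ≥0∞) + 1)⁻¹ • ∑ i ∈ Finset.range (N + 1), (incrMeasure μ).map fun h => walk h i • x

theorem measurable_walk_smul (x : M) (i : ℕ) : Measurable fun h : ℕ → G => walk h i • x :=
  (measurable_of_countable fun g : G => g • x).comp (measurable_walk i)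

/-- Used twice: with `K` the whole space for the total mass, and with a closed invariant set to
locate the limit measure. -/
theorem cesaroMeasure_eq_one (μ : Measure G) [IsProbabilityMeasure μ] (x : M) (N : ℕ) {K : Set M}
    (hK : MeasurableSet K) (hx : ∀ g : G, g • x ∈ K) : cesaroMeasure μ x N K = 1 := by
  unfold cesaroMeasure
  rw [Measure.smul_apply, Measure.finsetSum_apply]
  have : ∀ i ∈ Finset.range (N + 1), (incrMeasure μ).map (fun h => walk h i • x) K = 1 := by
    intro i _
    rw [Measure.map_apply (measurable_walk_smul x i) hK]
    have : (fun h : ℕ → G => walk h i • x) ⁻¹' K = Set.univ :=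
      Set.eq_univ_of_forall fun h => hx _
    rw [this, measure_univ]
  rw [Finset.sum_congr rfl this]
  simp only [Finset.sum_const, Finset.card_range, nsmul_eq_mul, mul_one, smul_eq_mul,
    Nat.cast_add, Nat.cast_one]
  exact ENNReal.inv_mul_cancel (by simp) (by finiteness)

instance (μ : Measure G) [IsProbabilityMeasure μ] (x : M) (N : ℕ) :
    IsProbabilityMeasure (cesaroMeasure μ x N) :=
  ⟨cesaroMeasure_eq_one μ x N MeasurableSet.univ fun _ => trivial⟩

theorem integral_cesaroMeasure (μ : Measure G) [IsProbabilityMeasure μ] (x : M) (N : ℕ)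
    (f : M →ᵇ ℝ) : ∫ y, f y ∂(cesaroMeasure μ x N) =
      ((N : ℝ) + 1)⁻¹ * ∑ i ∈ Finset.range (N + 1), ∫ h, f (walk h i • x) ∂(incrMeasure μ) := by
  unfold cesaroMeasure
  have hp : ∀ i, IsProbabilityMeasure ((incrMeasure μ).map (fun h : ℕ → G => walk h i • x)) :=
    fun i => Measure.isProbabilityMeasure_map (measurable_walk_smul x i).aemeasurable
  rw [integral_smul_measure, integral_finsetSum_measure fun i _ => f.integrable _]
  rw [smul_eq_mul]
  congr 1
  · rw [ENNReal.toReal_inv]; norm_cast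
  · refine Finset.sum_congr rfl fun i _ => ?_
    exact integral_map (measurable_walk_smul x i).aemeasurable
      f.continuous.measurable.aestronglyMeasurable

/-- The Markov operator on bounded continuous functions. -/
def averageBCF (μ : Measure G) [IsProbabilityMeasure μ]
    (hact : ∀ g : G, Continuous fun x : M => g • x) (f : M →ᵇ ℝ) : M →ᵇ ℝ :=
  BoundedContinuousFunction.ofNormedAddCommGroup (fun x => ∫ g, f (g • x) ∂μ)
    (continuous_of_dominated (bound := fun _ => ‖f‖)
      (fun x => (measurable_of_countable _).aestronglyMeasurable)
      (fun x => Eventually.of_forall fun g => f.norm_coe_le_norm _)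
      (integrable_const _)
      (Eventually.of_forall fun g => f.continuous.comp (hact g))) ‖f‖
    (fun x => by
      refine (norm_integral_le_of_norm_le_const
        (Eventually.of_forall fun g => f.norm_coe_le_norm _)).trans ?_
      simp)

/-- The Markov operator puts an increment on the left of the walk, and by `map_consPath` this moves
the law on by one step. -/
theorem integral_averageBCF_walk (μ : Measure G) [IsProbabilityMeasure μ]
    (hact : ∀ g : G, Continuous fun x : M => g • x) (f : M →ᵇ ℝ) (x : M) (i : ℕ) :
    ∫ h, averageBCF μ hact f (walk h i • x) ∂(incrMeasure μ) =
      ∫ h, f (walk h (i + 1) • x) ∂(incrMeasure μ) := by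
  have hmeas : Measurable fun h : ℕ → G => f (walk h (i + 1) • x) :=
    f.continuous.measurable.comp (measurable_walk_smul x _)
  have hi : Integrable (fun p : G × (ℕ → G) => f (walk (consPath p) (i + 1) • x))
      (μ.prod (incrMeasure μ)) :=
    Integrable.of_bound (hmeas.comp measurable_consPath).aestronglyMeasurable ‖f‖
      (Eventually.of_forall fun _ => f.norm_coe_le_norm _)
  conv_rhs => rw [← map_consPath μ]
  rw [integral_map measurable_consPath.aemeasurable hmeas.aestronglyMeasurable,
    integral_prod_symm _ hi]
  simp only [walk_consPath, mul_smul]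
  rfl

/-- A compact space with an action by homeomorphisms has a stationary probability measure, which
is carried by any given closed set that contains an orbit. -/
theorem exists_isStationary (μ : Measure G) [IsProbabilityMeasure μ]
    (hact : ∀ g : G, Continuous fun x : M => g • x) (x : M) {K : Set M} (hK : IsClosed K)
    (hx : ∀ g : G, g • x ∈ K) :
    ∃ ν : Measure M, IsProbabilityMeasure ν ∧ IsStationary μ ν ∧ ν K = 1 := by
  let νs : ℕ → ProbabilityMeasure M := fun N => ⟨cesaroMeasure μ x N, inferInstance⟩
  -- Probability measures on `M` form a compact space, so the averages converge along a free
  -- ultrafilter.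
  let F : Ultrafilter ℕ := hyperfilter ℕ
  obtain ⟨ν, -, hν⟩ := isCompact_univ.ultrafilter_le_nhds (F.map νs) (by simp)
  have hF : (F : Filter ℕ) ≤ atTop := by
    rw [← Nat.cofinite_eq_atTop]; exact hyperfilter_le_cofinite
  have hlim : Tendsto νs F (𝓝 ν) := hν
  refine ⟨ν, inferInstance, ?_, ?_⟩
  · have hint := ProbabilityMeasure.tendsto_iff_forall_integral_tendsto.1 hlim
    have hinv : ∀ f : M →ᵇ ℝ, ∫ y, averageBCF μ hact f y ∂(ν : Measure M) = ∫ y, f y ∂(ν : Measure M) := by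
      intro f
      have h1 := (hint (averageBCF μ hact f)).sub (hint f)
      have h2 : Tendsto (fun N : ℕ => ∫ y, averageBCF μ hact f y ∂(νs N : Measure M) -
          ∫ y, f y ∂(νs N : Measure M)) atTop (𝓝 0) := by
        have hle : ∀ N : ℕ, ‖∫ y, averageBCF μ hact f y ∂(νs N : Measure M) -
            ∫ y, f y ∂(νs N : Measure M)‖ ≤ ((N : ℝ) + 1)⁻¹ * (2 * ‖f‖) := by
          intro N
          change ‖∫ y, averageBCF μ hact f y ∂(cesaroMeasure μ x N) -
            ∫ y, f y ∂(cesaroMeasure μ x N)‖ ≤ _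
          rw [integral_cesaroMeasure, integral_cesaroMeasure, ← mul_sub, ← Finset.sum_sub_distrib]
          simp only [integral_averageBCF_walk]
          -- The sum telescopes; only the last and the first term survive, each bounded by `‖f‖`.
          rw [Finset.sum_range_sub (fun i => ∫ h, f (walk h i • x) ∂(incrMeasure μ)), norm_mul,
            Real.norm_of_nonneg (by positivity : (0 : ℝ) ≤ ((N : ℝ) + 1)⁻¹)]
          refine mul_le_mul_of_nonneg_left ?_ (by positivity)
          refine (norm_sub_le _ _).trans ?_
          have : ∀ i, ‖∫ h, f (walk h i • x) ∂(incrMeasure μ)‖ ≤ ‖f‖ := fun i => by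
            refine (norm_integral_le_of_norm_le_const
              (Eventually.of_forall fun g => f.norm_coe_le_norm _)).trans ?_
            simp
          linarith [this (N + 1), this 0]
        refine squeeze_zero_norm hle ?_
        have := (tendsto_one_div_add_atTop_nhds_zero_nat (𝕜 := ℝ)).mul_const (2 * ‖f‖)
        simpa using this
      exact sub_eq_zero.1 (tendsto_nhds_unique h1 (h2.mono_left hF))
    have hmeas : ∀ g : G, Measurable fun y : M => g • y := fun g => (hact g).measurable
    have hprod : Measurable fun p : G × M => p.1 • p.2 :=
      measurable_from_prod_countable_right hmeas
    -- Stationarity is invariance of `ν` under convolution with `μ`, and finite measures are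
    -- determined by their integrals of bounded continuous functions.
    have key : (μ.prod (ν : Measure M)).map (fun p => p.1 • p.2) = (ν : Measure M) := by
      have : IsProbabilityMeasure ((μ.prod (ν : Measure M)).map (fun p => p.1 • p.2)) :=
        Measure.isProbabilityMeasure_map hprod.aemeasurable
      refine ext_of_forall_integral_eq_of_IsFiniteMeasure fun f => ?_
      have hi : Integrable (fun p : G × M => f (p.1 • p.2)) (μ.prod (ν : Measure M)) :=
        Integrable.of_bound (f.continuous.measurable.comp hprod).aestronglyMeasurable ‖f‖
          (Eventually.of_forall fun _ => f.norm_coe_le_norm _)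
      rw [integral_map hprod.aemeasurable f.continuous.measurable.aestronglyMeasurable,
        integral_prod_symm _ hi, ← hinv f]
      rfl
    refine isStationary_of_apply hmeas fun E hE => ?_
    conv_lhs => rw [← key]
    rw [Measure.map_apply hprod hE, Measure.prod_apply (hprod hE), lintegral_countable']
    exact tsum_congr fun g => mul_comm _ _
  · have h1 := ProbabilityMeasure.limsup_measure_closed_le_of_tendsto hlim hK
    have h2 : ∀ N, (νs N : Measure M) K = 1 := fun N =>
      cesaroMeasure_eq_one μ x N hK.measurableSet hx
    simp only [h2, limsup_const] at h1
    exact le_antisymm prob_le_one h1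

end Existence

end ZnFree

/-! ### Integer trees, orientations and half-spaces. -/

namespace ZnFree

open scoped ENNReal Pointwise

set_option linter.unusedSectionVars false

/-- An integer-valued tree pseudometric with an unbounded isometric action whose orbit of the base
point spans the tree. -/
structure IntTree (G V : Type*) [Group G] [MulAction G V] where
  δ : V → V → ℤ
  base : V
  self : ∀ x, δ x x = 0
  comm : ∀ x y, δ x y = δ y x
  smul : ∀ (g : G) x y, δ (g • x) (g • y) = δ x y
  four : ∀ x y z w, δ x y + δ z w ≤ δ x z + δ y w ∨ δ x y + δ z w ≤ δ x w + δ y z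
  even : ∀ x y z, ∃ k, δ x y + δ y z + δ x z = 2 * k
  seg : ∀ x y j, 0 ≤ j → j ≤ δ x y → ∃ z, δ x z = j ∧ δ z y = δ x y - j
  unbounded : ∀ m : ℤ, ∃ g : G, m ≤ δ base (g • base)
  span : ∀ w, ∃ g : G, δ base w + δ w (g • base) = δ base (g • base)

/-- The space of orientations. -/
def Ori (V : Type*) : Type _ := V × V → Bool

namespace Ori

variable {V : Type*}

instance : TopologicalSpace (Ori V) := inferInstanceAs (TopologicalSpace (V × V → Bool))
instance : CompactSpace (Ori V) := inferInstanceAs (CompactSpace (V × V → Bool))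
instance : T2Space (Ori V) := inferInstanceAs (T2Space (V × V → Bool))
instance [Countable V] : SecondCountableTopology (Ori V) :=
  inferInstanceAs (SecondCountableTopology (V × V → Bool))
instance : MeasurableSpace (Ori V) := inferInstanceAs (MeasurableSpace (V × V → Bool))
instance [Countable V] : BorelSpace (Ori V) := inferInstanceAs (BorelSpace (V × V → Bool))

variable {G : Type*} [Group G] [MulAction G V]

instance : MulAction G (Ori V) where
  smul g s p := s (g⁻¹ • p.1, g⁻¹ • p.2)
  one_smul s := by
    funext p
    change s ((1 : G)⁻¹ • p.1, (1 : G)⁻¹ • p.2) = s p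
    simp
  mul_smul g h s := by
    funext p
    change s ((g * h)⁻¹ • p.1, (g * h)⁻¹ • p.2) = s (h⁻¹ • g⁻¹ • p.1, h⁻¹ • g⁻¹ • p.2)
    simp [mul_smul]

theorem smul_apply (g : G) (s : Ori V) (a b : V) : (g • s) (a, b) = s (g⁻¹ • a, g⁻¹ • b) := rfl

theorem continuous_smul (g : G) : Continuous fun s : Ori V => g • s :=
  continuous_pi fun _ => continuous_apply (A := fun _ : V × V => Bool) _

theorem measurable_smul (g : G) : Measurable fun s : Ori V => g • s :=
  measurable_pi_lambda _ fun _ => measurable_pi_apply (X := fun _ : V × V => Bool) _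

theorem measurable_eval (p : V × V) : Measurable fun s : Ori V => s p :=
  measurable_pi_apply (X := fun _ : V × V => Bool) _

/-- The orientations that send all pairs in `J` to `true`. -/
def cyl (J : Finset (V × V)) : Set (Ori V) := {s | ∀ p ∈ J, s p = true}

theorem measurableSet_cyl (J : Finset (V × V)) : MeasurableSet (cyl J) := by
  have : cyl J = ⋂ p ∈ J, (fun s : Ori V => s p) ⁻¹' {true} := by ext; simp [cyl]
  rw [this]
  exact MeasurableSet.biInter J.countable_toSet fun p _ => measurable_eval p (measurableSet_singleton _)

theorem measurableSet_one (p : V × V) : MeasurableSet {s : Ori V | s p = true} :=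
  measurable_eval p (measurableSet_singleton true)

/-- Conditions with value `true` suffice: they are closed under intersection and generate the
product σ-algebra. -/
theorem ext_of_cyl {ν₁ ν₂ : Measure (Ori V)} [IsProbabilityMeasure ν₁] [IsProbabilityMeasure ν₂]
    (h : ∀ J : Finset (V × V), ν₁ (cyl J) = ν₂ (cyl J)) : ν₁ = ν₂ := by
  classical
  refine ext_of_generate_finite (Set.range (cyl (V := V))) ?_ ?_ ?_ (by simp)
  · refine le_antisymm ?_ (MeasurableSpace.generateFrom_le ?_)
    · refine iSup_le fun p => ?_
      have : @Measurable _ _ (MeasurableSpace.generateFrom (Set.range (cyl (V := V)))) _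
          fun s : Ori V => s p := by
        refine @measurable_to_bool _ (MeasurableSpace.generateFrom _) _ ?_
        refine MeasurableSpace.measurableSet_generateFrom ⟨{p}, ?_⟩
        ext s
        simp [cyl]
      exact this.comap_le
    · rintro _ ⟨J, rfl⟩
      exact measurableSet_cyl J
  · rintro _ ⟨J, rfl⟩ _ ⟨J', rfl⟩ -
    refine ⟨J ∪ J', ?_⟩
    ext s
    simp only [cyl, Finset.mem_union, Set.mem_ofPred_eq, Set.mem_inter_iff]
    exact ⟨fun H => ⟨fun p hp => H p (Or.inl hp), fun p hp => H p (Or.inr hp)⟩,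
      fun H p hp => hp.elim (H.1 p) (H.2 p)⟩
  · rintro _ ⟨J, rfl⟩
    exact h J

end Ori

namespace IntTree

variable {G V : Type*} [Group G] [MulAction G V] (T : IntTree G V)

theorem tri (x y z : V) : T.δ x y ≤ T.δ x z + T.δ y z := by
  have := T.four x y z z
  rw [T.self] at this
  omega

theorem nonneg (x y : V) : 0 ≤ T.δ x y := by
  have := T.tri x x y
  rw [T.self] at this
  omega

/-- `v` lies on the path from `w` to `u`. -/
def Btw (w v u : V) : Prop := T.δ w v + T.δ v u = T.δ w u

/-- As `a` is not farther from `o` than `v`, the branch towards `a` leaves the path from `o` to `u`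
at or before `v`. -/
theorem btw_rebase {a o v u : V} (h : T.Btw o v u) (ha : T.δ o a ≤ T.δ o v) : T.Btw a v u := by
  unfold Btw at *
  have h1 := T.four a v o u
  have h2 := T.tri a u v
  have h3 := T.four o v a u
  have := T.comm o a
  have := T.comm o u
  have := T.comm o v
  have := T.comm a u
  have := T.comm v u
  have := T.comm a v
  have h4 := T.four a o v u
  have h5 := T.nonneg o a
  have h6 := T.nonneg a v
  have h7 := T.tri v u a
  omega

theorem btw_smul (g : G) (w v u : V) : T.Btw (g • w) (g • v) (g • u) ↔ T.Btw w v u := by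
  simp [Btw, T.smul]

open Classical in
/-- The orientation towards the vertex `u`. -/
def ori (u : V) : Ori V := fun p => decide (T.Btw p.1 p.2 u)

theorem ori_eq_true {u w v : V} : T.ori u (w, v) = true ↔ T.Btw w v u := by simp [ori]

theorem smul_ori (g : G) (u : V) : g • T.ori u = T.ori (g • u) := by
  funext ⟨a, b⟩
  rw [Ori.smul_apply, Bool.eq_iff_iff, ori_eq_true, ori_eq_true, ← T.btw_smul g]
  simp

/-- The orientations that look like a vertex on every finite set of pairs. -/
def K : Set (Ori V) := {s | ∀ J : Finset (V × V), ∃ u, ∀ p ∈ J, s p = T.ori u p}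

theorem isClosed_K : IsClosed T.K := by
  rw [← isOpen_compl_iff, isOpen_iff_forall_mem_open]
  intro s hs
  simp only [K, Set.mem_compl_iff, Set.mem_ofPred_eq, not_forall] at hs
  obtain ⟨J, hJ⟩ := hs
  refine ⟨⋂ p ∈ J, {s' : Ori V | s' p = s p}, ?_, ?_, ?_⟩
  · intro s' hs' hK
    obtain ⟨u, hu⟩ := hK J
    refine hJ ⟨u, fun p hp => ?_⟩
    rw [← hu p hp]
    exact (Set.mem_iInter₂.1 hs' p hp).symm
  · refine isOpen_biInter_finset fun p _ => ?_
    exact (isOpen_discrete {s p}).preimage (continuous_apply (A := fun _ : V × V => Bool) p)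
  · exact Set.mem_iInter₂.2 fun p _ => rfl

theorem ori_mem_K (u : V) : T.ori u ∈ T.K := fun _ => ⟨u, fun _ _ => rfl⟩

/-- The ends of the tree. -/
def E : Set (Ori V) := {s | s ∈ T.K ∧ ∀ m : ℕ, ∃ v, (m : ℤ) ≤ T.δ T.base v ∧ s (T.base, v) = true}

theorem measurableSet_E [Countable V] : MeasurableSet T.E := by
  have : T.E = T.K ∩ ⋂ m : ℕ, ⋃ v, ⋃ _ : (m : ℤ) ≤ T.δ T.base v, {s | s (T.base, v) = true} := by
    ext s; simp [E]
  rw [this]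
  exact T.isClosed_K.measurableSet.inter (MeasurableSet.iInter fun m => MeasurableSet.iUnion fun v =>
    MeasurableSet.iUnion fun _ => Ori.measurableSet_one _)

theorem exists_match {s : Ori V} (hs : s ∈ T.K) (l : List (V × V)) :
    ∃ u, ∀ p ∈ l, s p = true ↔ T.Btw p.1 p.2 u := by
  classical
  obtain ⟨u, hu⟩ := hs l.toFinset
  refine ⟨u, fun p hp => ?_⟩
  rw [hu p (by simpa using hp)]
  exact T.ori_eq_true

/-- All vertices approximating `s` or `s'` lie behind `v`, seen from `a` as well as from `b`. So
whether `b` is on the way from `a` depends on distances to `v` only, and passing `v` fixes the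
orientation on the whole ball up to `v`. -/
theorem eq_of_deep {s s' : Ori V} (hs : s ∈ T.K) (hs' : s' ∈ T.K) {v a b : V}
    (h : s (T.base, v) = true) (h' : s' (T.base, v) = true)
    (ha : T.δ T.base a ≤ T.δ T.base v) (hb : T.δ T.base b ≤ T.δ T.base v) :
    s (a, b) = s' (a, b) := by
  obtain ⟨u, hu⟩ := T.exists_match hs [(T.base, v), (a, b)]
  obtain ⟨u', hu'⟩ := T.exists_match hs' [(T.base, v), (a, b)]
  simp only [List.forall_mem_cons, h, h', true_iff] at hu hu'
  rw [Bool.eq_iff_iff, hu.2.1, hu'.2.1]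
  have h1 := T.btw_rebase hu.1 ha
  have h2 := T.btw_rebase hu.1 hb
  have h3 := T.btw_rebase hu'.1 ha
  have h4 := T.btw_rebase hu'.1 hb
  unfold Btw at *
  omega

/-- A half-space. -/
def half (w v : V) : Set V := {u | T.Btw w v u}

theorem smul_half (g : G) (w v : V) : g • T.half w v = T.half (g • w) (g • v) := by
  ext u
  rw [Set.mem_smul_set_iff_inv_smul_mem]
  change T.Btw w v (g⁻¹ • u) ↔ T.Btw (g • w) (g • v) u
  rw [← T.btw_smul g]
  simp

/-- Finite approximation by vertices makes the value of an orientation in `K` a function of the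
half-space and not of the pair defining it. -/
theorem eq_of_half_eq {s : Ori V} (hs : s ∈ T.K) {w v w' v' : V} (h : T.half w v = T.half w' v') :
    s (w, v) = s (w', v') := by
  obtain ⟨u, hu⟩ := T.exists_match hs [(w, v), (w', v')]
  simp only [List.forall_mem_cons] at hu
  rw [Bool.eq_iff_iff, hu.1, hu.2.1]
  exact Set.ext_iff.1 h u

theorem eq_of_half_eq_compl {s : Ori V} (hs : s ∈ T.K) {w v w' v' : V}
    (h : (T.half w v)ᶜ = T.half w' v') : s (w, v) = true ↔ ¬ s (w', v') = true := by
  obtain ⟨u, hu⟩ := T.exists_match hs [(w, v), (w', v')]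
  simp only [List.forall_mem_cons] at hu
  rw [hu.1, hu.2.1]
  have := Set.ext_iff.1 h u
  change ¬ T.Btw w v u ↔ T.Btw w' v' u at this
  tauto

theorem btw_of_zero {w v : V} (h : T.δ w v = 0) (u : V) : T.Btw w v u := by
  have h1 := T.tri w u v
  have h2 := T.tri v u w
  have := T.comm w v
  have := T.comm u v
  have := T.comm u w
  unfold Btw
  omega

/-- A half-space not containing `o` is a shadow seen from `o`. -/
theorem half_eq_of_not_btw {o w v : V} (h : ¬ T.Btw w v o) : T.half w v = T.half o v := by
  ext u
  change T.Btw w v u ↔ T.Btw o v u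
  unfold Btw at *
  have h1 := T.four w o v u
  have h2 := T.four w v o u
  have h3 := T.four w u v o
  have h4 := T.tri w o v
  have h5 := T.tri o u v
  have h6 := T.tri w u v
  have := T.comm w v
  have := T.comm u v
  have := T.comm o v
  have := T.comm o u
  have := T.comm u w
  omega

/-- The complement of a half-space containing `o` is a shadow seen from `o`. -/
theorem half_compl {o w v : V} (h : T.Btw w v o) (hwv : 1 ≤ T.δ w v) :
    ∃ v', T.δ o v' = T.δ o v + 1 ∧ (T.half w v)ᶜ = T.half o v' := by
  -- The neighbour of `v` on the way to `w`: the edge between them bounds the half-space.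
  obtain ⟨v', h1, h2⟩ := T.seg v w 1 zero_le_one (by rw [T.comm]; exact hwv)
  have c1 := T.comm w v
  have c2 := T.comm o v
  have c3 := T.comm o w
  have c4 := T.comm o v'
  have hov' : T.δ o v' = T.δ o v + 1 := by
    have a1 := T.tri o v' v
    have a2 := T.tri w o v'
    have := T.comm v v'
    have := T.comm w v'
    unfold Btw at h
    omega
  refine ⟨v', hov', ?_⟩
  ext u
  change ¬ T.Btw w v u ↔ T.Btw o v' u
  unfold Btw at *
  have b0 := T.four w u v o
  have b1 := T.four w o v u
  have b2 := T.four w v o u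
  have b3 := T.four w u v v'
  have b4 := T.four w v' v u
  have b5 := T.four w v v' u
  have b6 := T.four o u v v'
  have b7 := T.four o v v' u
  have b8 := T.four o v' v u
  have b9 := T.tri w u v'
  have b10 := T.tri o u v'
  have b11 := T.tri o u v
  have b12 := T.tri w u v
  obtain ⟨k, hk⟩ := T.even u v v'
  have := T.comm u v
  have := T.comm u v'
  have := T.comm u w
  have := T.comm u o
  have := T.comm v v'
  have := T.comm v' w
  omega

theorem exists_pred {o v : V} (h : 1 ≤ T.δ o v) : ∃ w, T.δ w v = 1 ∧ T.Btw o w v := by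
  obtain ⟨w, h1, h2⟩ := T.seg v o 1 zero_le_one (by rw [T.comm]; exact h)
  have := T.comm v w
  have := T.comm v o
  have := T.comm w o
  exact ⟨w, by omega, by unfold Btw; omega⟩

/-- The edge that bounds a half-space can be recovered from it: `v` and `v'` lie in the common
half-space, the predecessor of either lies outside, and the four-point condition leaves no distance
between `v` and `v'`. It is needed to tell translates of a half-space apart. -/
theorem dist_eq_zero_of_half_eq {w v w' v' : V} (h : T.half w v = T.half w' v')
    (h1 : 1 ≤ T.δ w v) (h2 : T.δ w' v' = T.δ w v) : T.δ v v' = 0 := by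
  obtain ⟨z, hz1, hz2⟩ := T.exists_pred h1
  obtain ⟨z', hz1', hz2'⟩ := T.exists_pred (o := w') (v := v') (by omega)
  have m1 : T.Btw w v v' := by
    have : v' ∈ T.half w' v' := by change T.Btw w' v' v'; simp [Btw, T.self]
    rw [← h] at this; exact this
  have m2 : T.Btw w' v' v := by
    have : v ∈ T.half w v := by change T.Btw w v v; simp [Btw, T.self]
    rw [h] at this; exact this
  have m3 : ¬ T.Btw w v z' := by
    intro H
    have : z' ∈ T.half w v := H
    rw [h] at this
    change T.Btw w' v' z' at this
    have := T.comm z' v'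
    unfold Btw at *
    omega
  unfold Btw at *
  have c1 := T.comm z z'
  have c2 := T.comm v v'
  have c3 := T.comm v z'
  have c4 := T.comm z' v'
  have e1 : T.δ z v' = 1 + T.δ v v' := by
    have a4 := T.tri w v' z
    have a5 := T.tri z v' v
    have := T.comm v' z
    omega
  have e2 : T.δ z' v = 1 + T.δ v v' := by
    have a6 := T.tri w' v z'
    have a7 := T.tri z' v v'
    have := T.comm v z'
    omega
  have a12 := T.four w v z z'
  have a13 := T.nonneg v v'
  have c5 := T.comm z v
  have a14 := T.tri w z' v
  have := T.comm z' v
  rcases T.four z v' z' v with a1 | a1 <;> omega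

/-- An unbounded function that factors through the orbit excludes a finite orbit. In the
applications it is the displacement of a vertex. -/
theorem infinite_orbit_of_unbounded {𝒮 : Type*} [MulAction G 𝒮] (s : 𝒮) (f : G → ℤ)
    (hf : ∀ g g', g • s = g' • s → f g = f g') (hunb : ∀ m, ∃ g, m ≤ f g) :
    (MulAction.orbit G s).Infinite := by
  intro hfin
  have hfac : Function.FactorsThrough f (fun g : G => g • s) := fun g g' h => hf g g' h
  have : (Set.range f).Finite := by
    rw [← hfac.extend_comp (fun _ => 0), Set.range_comp]
    exact Set.Finite.image _ hfin
  obtain ⟨M, hM⟩ := this.bddAbove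
  obtain ⟨g, hg⟩ := hunb (M + 1)
  have := hM ⟨g, rfl⟩
  omega

theorem unbounded_at (v : V) (m : ℤ) : ∃ g : G, m ≤ T.δ v (g • v) := by
  obtain ⟨g, hg⟩ := T.unbounded (m + 2 * T.δ T.base v)
  refine ⟨g, ?_⟩
  have h1 := T.tri T.base (g • T.base) v
  have h2 := T.tri v (g • T.base) (g • v)
  have h3 := T.smul g T.base v
  have := T.comm (g • T.base) v
  omega

theorem infinite_orbit_half {w v : V} (h : 1 ≤ T.δ w v) :
    (MulAction.orbit G (T.half w v)).Infinite := by
  refine infinite_orbit_of_unbounded _ (fun g => T.δ v (g • v)) (fun g g' e => ?_) (T.unbounded_at v)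
  rw [smul_half, smul_half] at e
  have := T.dist_eq_zero_of_half_eq e (by rwa [T.smul]) (by rw [T.smul, T.smul])
  have h1 := T.tri v (g • v) (g' • v)
  have h2 := T.tri v (g' • v) (g • v)
  have := T.comm (g • v) (g' • v)
  omega

theorem infinite_orbit_ori (u : V) : (MulAction.orbit G (T.ori u)).Infinite := by
  refine infinite_orbit_of_unbounded _ (fun g => T.δ u (g • u)) (fun g g' e => ?_) (T.unbounded_at u)
  rw [smul_ori, smul_ori] at e
  have h0 : T.ori (g • u) (g' • u, g • u) = true := by rw [ori_eq_true]; simp [Btw, T.self]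
  rw [e, ori_eq_true] at h0
  unfold Btw at h0
  rw [T.self, T.comm (g • u)] at h0
  have h1 := T.tri u (g • u) (g' • u)
  have h2 := T.tri u (g' • u) (g • u)
  have := T.comm (g • u) (g' • u)
  omega

/-- If the vertices passed by `s` stay at bounded distance from the base point, there is a farthest
one, and `s` points towards it from everywhere. With infinite branching, such an `s` may be a limit
of vertices escaping through different branches at that vertex. -/
theorem exists_eq_ori {s : Ori V} (hs : s ∈ T.K) (hE : s ∉ T.E) : ∃ u, s = T.ori u := by
  have hex : ∃ m : ℕ, ∀ v, s (T.base, v) = true → T.δ T.base v < m := by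
    by_contra hcon
    push Not at hcon
    exact hE ⟨hs, fun m => by obtain ⟨v, h1, h2⟩ := hcon m; exact ⟨v, h2, h1⟩⟩
  obtain ⟨v, hv, hmax⟩ : ∃ v, s (T.base, v) = true ∧
      ∀ v', s (T.base, v') = true → T.δ T.base v' ≤ T.δ T.base v := by
    classical
    obtain ⟨m, hm⟩ := hex
    have hb : s (T.base, T.base) = true := by
      obtain ⟨u, hu⟩ := T.exists_match hs [(T.base, T.base)]
      rw [hu _ (by simp)]
      simp [Btw, T.self]
    have h0 : ({k : ℕ | ∃ v, s (T.base, v) = true ∧ T.δ T.base v = k}).Nonempty :=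
      ⟨0, T.base, hb, by simp [T.self]⟩
    have hbd : BddAbove {k : ℕ | ∃ v, s (T.base, v) = true ∧ T.δ T.base v = k} :=
      ⟨m, by rintro k ⟨v, h1, h2⟩; have := hm v h1; omega⟩
    obtain ⟨v, h1, h2⟩ := Nat.sSup_mem h0 hbd
    refine ⟨v, h1, fun v' hv' => ?_⟩
    have hn := T.nonneg T.base v'
    have := le_csSup hbd ⟨v', hv', (Int.toNat_of_nonneg hn).symm⟩
    omega
  refine ⟨v, ?_⟩
  funext ⟨a, b⟩
  rw [Bool.eq_iff_iff, ori_eq_true]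
  -- A half-space containing the base point is replaced by its complement, so only pairs starting at
  -- the base point have to be compared with the farthest vertex.
  by_cases hab : T.Btw a b T.base
  · by_cases h1 : 1 ≤ T.δ a b
    · obtain ⟨b', hb', hc⟩ := T.half_compl hab h1
      have key := T.eq_of_half_eq_compl hs hc
      have hc' := Set.ext_iff.1 hc v
      change ¬ T.Btw a b v ↔ T.Btw T.base b' v at hc'
      rw [key]
      constructor
      · intro h
        by_contra h'
        refine h ?_
        rw [hc'] at h'
        obtain ⟨u, hu⟩ := T.exists_match hs [(T.base, v), (T.base, b')]
        simp only [List.forall_mem_cons, hv, true_iff] at hu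
        rw [hu.2.1]
        have := hu.1
        have t1 := T.tri T.base u b'
        have t2 := T.tri b' u v
        have := T.comm u v
        have := T.comm u b'
        unfold Btw at *
        omega
      · intro h h'
        have h'' := hmax b' h'
        obtain ⟨u, hu⟩ := T.exists_match hs [(T.base, v), (T.base, b')]
        simp only [List.forall_mem_cons, hv, h', true_iff] at hu
        have h1 := hu.1
        have h2 := hu.2.1
        have : ¬ T.Btw T.base b' v := fun hb => (hc'.2 hb) h
        refine this ?_
        have t1 := T.four T.base u b' v
        have t2 := T.tri T.base v b'
        have := T.comm u v
        have := T.comm u b'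
        have := T.comm v b'
        unfold Btw at *
        omega
    · have h0 : T.δ a b = 0 := by have := T.nonneg a b; omega
      obtain ⟨u, hu⟩ := T.exists_match hs [(a, b)]
      rw [hu _ (by simp)]
      exact iff_of_true (T.btw_of_zero h0 _) (T.btw_of_zero h0 _)
  · have hc := T.half_eq_of_not_btw hab
    rw [T.eq_of_half_eq hs hc]
    have hc' := Set.ext_iff.1 hc v
    change T.Btw a b v ↔ T.Btw T.base b v at hc'
    rw [hc']
    obtain ⟨u, hu⟩ := T.exists_match hs [(T.base, v), (T.base, b)]
    simp only [List.forall_mem_cons, hv, true_iff] at hu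
    have h1 := hu.1
    constructor
    · intro h
      have h'' := hmax b h
      have h2 := hu.2.1.1 h
      have t1 := T.four T.base u b v
      have t2 := T.tri T.base v b
      have := T.comm u v
      have := T.comm u b
      have := T.comm v b
      unfold Btw at *
      omega
    · intro h
      rw [hu.2.1]
      have t1 := T.tri T.base u b
      have t2 := T.tri b u v
      have := T.comm u v
      have := T.comm u b
      unfold Btw at *
      omega

end IntTree

end ZnFree

/-! ### Stationary measures on orientations: atoms, heavy half-spaces, limits, uniqueness. -/

namespace ZnFree

open scoped ENNReal Pointwise

set_option linter.unusedSectionVars false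

/-- The mass of points is a summable harmonic function on `M`, so the maximum principle applies. -/
theorem IsStationary.measure_singleton_eq_zero {G M : Type*} [Group G] [MeasurableSpace G]
    [DiscreteMeasurableSpace G] [Countable G] [MulAction G M] [MeasurableSpace M]
    {μ : Measure G} [IsProbabilityMeasure μ] (hμ : IsNonDegenerate μ) {ν : Measure M}
    [IsProbabilityMeasure ν] (h : IsStationary μ ν)
    (hact : ∀ g : G, Measurable fun x : M => g • x) (hs : ∀ x : M, MeasurableSet {x}) {x : M}
    (hx : (MulAction.orbit G x).Infinite) : ν {x} = 0 := by
  by_contra hne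
  refine hx (finite_orbit_of_subharmonic μ hμ (fun x => ν {x}) ?_ (fun y => ?_) hne)
  · refine ne_top_of_le_ne_top (measure_ne_top ν Set.univ)
      ((tsum_meas_le_meas_iUnion_of_disjoint ν hs fun a b hab => ?_).trans
        (measure_mono (Set.subset_univ _)))
    simpa using hab
  · rw [h.apply hact (hs y)]
    refine le_of_eq (tsum_congr fun g => ?_)
    congr 2
    ext z
    simp [eq_inv_smul_iff]

namespace IntTree

variable {G V : Type*} [Group G] [MulAction G V] (T : IntTree G V)

/-- The orientations that pass through `v`, seen from `w`. -/
def one (w v : V) : Set (Ori V) := {s | s (w, v) = true}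

theorem measurableSet_one (w v : V) : MeasurableSet (one w v) := Ori.measurableSet_one _

theorem preimage_one (g : G) (w v : V) : (g • ·) ⁻¹' (one w v) = one (g⁻¹ • w) (g⁻¹ • v) := rfl

variable {ν : Measure (Ori V)} [IsProbabilityMeasure ν]

theorem passes_mono {s : Ori V} (hs : s ∈ T.K) {v v' : V} (h : T.Btw T.base v' v)
    (h1 : s (T.base, v) = true) : s (T.base, v') = true := by
  obtain ⟨u, hu⟩ := T.exists_match hs [(T.base, v), (T.base, v')]
  simp only [List.forall_mem_cons, h1, true_iff] at hu
  rw [hu.2.1]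
  have h2 := hu.1
  have := T.tri T.base u v'
  have := T.tri v' u v
  have := T.comm u v
  have := T.comm u v'
  unfold Btw at *
  omega

theorem btw_of_passes {s : Ori V} (hs : s ∈ T.K) {v v' : V} (h : T.δ T.base v' ≤ T.δ T.base v)
    (h1 : s (T.base, v) = true) (h2 : s (T.base, v') = true) : T.Btw T.base v' v := by
  obtain ⟨u, hu⟩ := T.exists_match hs [(T.base, v), (T.base, v')]
  simp only [List.forall_mem_cons, h1, h2, true_iff] at hu
  have h3 := hu.1
  have h4 := hu.2.1
  have := T.four T.base u v' v
  have := T.tri T.base v v'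
  have := T.comm u v
  have := T.comm u v'
  have := T.comm v v'
  unfold Btw at *
  omega

theorem passes_of_zero {s : Ori V} (hs : s ∈ T.K) {w v : V} (h : T.δ w v = 0) :
    s (w, v) = true := by
  obtain ⟨u, hu⟩ := T.exists_match hs [(w, v)]
  exact (hu _ (by simp)).2 (T.btw_of_zero h u)

/-- A König argument with continuity of measure in place of local finiteness. If shadows of mass at
least `η` occurred arbitrarily far out, the decreasing sets `A l` of ends passing a heavy vertex of
level `l` would have a common point `s`; the heavy shadows along `s` shrink to `s`, which would then
be an atom. -/
theorem small_shadow [Countable V] (hE : ∀ᵐ s ∂ν, s ∈ T.E) (hna : ∀ s ∈ T.E, ν {s} = 0)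
    {η : ℝ≥0∞} (hη : η ≠ 0) :
    ∃ l : ℕ, ∀ v, (l : ℤ) ≤ T.δ T.base v → ν (one T.base v) < η := by
  by_contra hcon
  push Not at hcon
  set A : ℕ → Set (Ori V) := fun l => T.E ∩
    ⋃ v, ⋃ _ : T.δ T.base v = l ∧ η ≤ ν (one T.base v), one T.base v with hA
  have memA : ∀ l s, s ∈ A l ↔ s ∈ T.E ∧ ∃ v, T.δ T.base v = l ∧ η ≤ ν (one T.base v) ∧
      s (T.base, v) = true := by
    intro l s
    simp only [hA, Set.mem_inter_iff, Set.mem_iUnion, one, Set.mem_ofPred_eq]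
    simp only [exists_prop, and_assoc]
  have hAm : ∀ l, MeasurableSet (A l) := fun l => T.measurableSet_E.inter
    (MeasurableSet.iUnion fun v => MeasurableSet.iUnion fun _ => measurableSet_one _ _)
  have hmono : ∀ {v v'}, T.Btw T.base v' v → ν (one T.base v) ≤ ν (one T.base v') := by
    intro v v' h
    refine measure_mono_ae ?_
    filter_upwards [hE] with s hs h1 using T.passes_mono hs.1 h h1
  have hanc : ∀ (v : V) (l : ℕ), (l : ℤ) ≤ T.δ T.base v → ∃ v', T.δ T.base v' = l ∧
      T.Btw T.base v' v := by
    intro v l h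
    obtain ⟨v', h1, h2⟩ := T.seg T.base v l (by omega) h
    exact ⟨v', h1, by unfold Btw; omega⟩
  have hAanti : Antitone A := by
    refine antitone_nat_of_succ_le fun l s hs => ?_
    rw [memA] at hs ⊢
    obtain ⟨h1, v, h2, h3, h4⟩ := hs
    obtain ⟨v', h5, h6⟩ := hanc v l (by push_cast at h2; omega)
    exact ⟨h1, v', h5, h3.trans (hmono h6), T.passes_mono h1.1 h6 h4⟩
  have hAge : ∀ l, η ≤ ν (A l) := by
    intro l
    obtain ⟨v, h1, h2⟩ := hcon l
    obtain ⟨v', h3, h4⟩ := hanc v l h1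
    refine (h2.trans (hmono h4)).trans (measure_mono_ae ?_)
    filter_upwards [hE] with s hs h5
    exact (memA l s).2 ⟨hs, v', h3, h2.trans (hmono h4), h5⟩
  have hlim := tendsto_measure_iInter_atTop (μ := ν) (fun l => (hAm l).nullMeasurableSet) hAanti
    ⟨0, measure_ne_top _ _⟩
  have hge : η ≤ ν (⋂ l, A l) := ge_of_tendsto' hlim hAge
  obtain ⟨s, hs⟩ : (⋂ l, A l).Nonempty := by
    rw [Set.nonempty_iff_ne_empty]
    intro h
    rw [h, measure_empty] at hge
    exact hη (le_antisymm hge bot_le)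
  have hs' : ∀ l : ℕ, s ∈ T.E ∧ ∃ v, T.δ T.base v = l ∧ η ≤ ν (one T.base v) ∧
      s (T.base, v) = true := fun l => (memA l s).1 (Set.mem_iInter.1 hs l)
  choose v hv1 hv2 hv3 using fun l => (hs' l).2
  have hsE := (hs' 0).1
  set B : ℕ → Set (Ori V) := fun l => T.E ∩ one T.base (v l) with hB
  have hBm : ∀ l, MeasurableSet (B l) := fun l => T.measurableSet_E.inter (measurableSet_one _ _)
  have hBanti : Antitone B := by
    refine antitone_nat_of_succ_le fun l t ht => ⟨ht.1, T.passes_mono ht.1.1 ?_ ht.2⟩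
    exact T.btw_of_passes hsE.1 (by rw [hv1, hv1]; push_cast; omega) (hv3 (l + 1)) (hv3 l)
  have hBge : ∀ l, η ≤ ν (B l) := by
    intro l
    refine (hv2 l).trans (measure_mono_ae ?_)
    filter_upwards [hE] with t ht h5 using ⟨ht, h5⟩
  have hlimB := tendsto_measure_iInter_atTop (μ := ν) (fun l => (hBm l).nullMeasurableSet) hBanti
    ⟨0, measure_ne_top _ _⟩
  have hgeB : η ≤ ν (⋂ l, B l) := ge_of_tendsto' hlimB hBge
  -- An end passing all the `v l` agrees with `s` on every pair, since any pair is less deep than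
  -- some `v l`.
  have hsub : (⋂ l, B l) ⊆ {s} := by
    intro t ht
    rw [Set.mem_iInter] at ht
    rw [Set.mem_singleton_iff]
    funext ⟨a, b⟩
    have ha := T.nonneg T.base a
    have hb := T.nonneg T.base b
    refine T.eq_of_deep (v := v (T.δ T.base a + T.δ T.base b).toNat) (ht 0).1.1 hsE.1 (ht _).2
      (hv3 _) ?_ ?_ <;> rw [hv1] <;> omega
  have := hgeB.trans (measure_mono hsub)
  rw [hna s hsE] at this
  exact hη (le_antisymm this bot_le)

/-- Distinct shadows of one level are disjoint on the ends, so finitely many of them are heavy; and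
only finitely many levels have heavy shadows. -/
theorem finite_shadow [Countable V] (hE : ∀ᵐ s ∂ν, s ∈ T.E) (hna : ∀ s ∈ T.E, ν {s} = 0)
    {η : ℝ≥0∞} (hη : η ≠ 0) :
    {A : Set V | ∃ v, A = T.half T.base v ∧ η ≤ ν (one T.base v)}.Finite := by
  obtain ⟨l₀, hl₀⟩ := T.small_shadow hE hna hη
  have hlev : ∀ l : ℕ,
      {A : Set V | ∃ v, T.δ T.base v = l ∧ A = T.half T.base v ∧ η ≤ ν (one T.base v)}.Finite := by
    intro l
    set S := {A : Set V | ∃ v, T.δ T.base v = l ∧ A = T.half T.base v ∧ η ≤ ν (one T.base v)}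
    choose f hf1 hf2 hf3 using fun A : S => A.2
    have := Measure.finite_const_le_meas_of_disjoint_iUnion ν (ε := η) (pos_iff_ne_zero.2 hη)
      (As := fun A : S => T.E ∩ one T.base (f A))
      (fun A => T.measurableSet_E.inter (measurableSet_one _ _)) ?_ (measure_ne_top _ _)
    · have huniv : {A : S | η ≤ ν (T.E ∩ one T.base (f A))} = Set.univ := by
        refine Set.eq_univ_of_forall fun A => ?_
        refine (hf3 A).trans (measure_mono_ae ?_)
        filter_upwards [hE] with t ht h5 using ⟨ht, h5⟩
      rw [huniv, Set.finite_univ_iff] at this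
      exact Set.toFinite S
    · intro A B hAB
      rw [Function.onFun, Set.disjoint_left]
      rintro s ⟨hs, h1⟩ ⟨-, h2⟩
      refine hAB (Subtype.ext ?_)
      have hb := T.btw_of_passes hs.1 (by rw [hf1 A, hf1 B]) h1 h2
      have h0 : T.δ (f A) (f B) = 0 := by
        have := hf1 A
        have := hf1 B
        have := T.comm (f A) (f B)
        unfold Btw at hb
        omega
      rw [hf2 A, hf2 B]
      ext u
      change T.Btw _ _ u ↔ T.Btw _ _ u
      have e1 := T.btw_of_zero h0 u
      have := hf1 A
      have := hf1 B
      unfold Btw at *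
      omega
  refine ((Set.finite_lt_nat l₀).biUnion fun l _ => hlev l).subset ?_
  rintro A ⟨v, h1, h2⟩
  have hn := T.nonneg T.base v
  refine Set.mem_biUnion (x := (T.δ T.base v).toNat) ?_ ⟨v, by omega, h1, h2⟩
  by_contra hlt
  have : l₀ ≤ (T.δ T.base v).toNat := not_lt.1 hlt
  exact absurd h2 (not_le.2 (hl₀ v (by omega)))

/-- A half-space or its complement is a shadow seen from the base point, and both have mass at least
`η` here. -/
theorem finite_half [Countable V] (hE : ∀ᵐ s ∂ν, s ∈ T.E) (hna : ∀ s ∈ T.E, ν {s} = 0)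
    {η : ℝ≥0∞} (hη : η ≠ 0) :
    {A : Set V | ∃ w v, A = T.half w v ∧ η ≤ ν (one w v) ∧ η ≤ ν (one w v)ᶜ}.Finite := by
  have hfin := T.finite_shadow hE hna hη
  refine (hfin.union (hfin.image compl)).subset ?_
  rintro A ⟨w, v, rfl, h1, h2⟩
  by_cases hb : T.Btw w v T.base
  · by_cases hwv : 1 ≤ T.δ w v
    · obtain ⟨v', -, hc⟩ := T.half_compl hb hwv
      refine Or.inr ⟨_, ⟨v', rfl, h2.trans (measure_mono_ae ?_)⟩, by rw [← hc, compl_compl]⟩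
      filter_upwards [hE] with s hs h5
      by_contra h6
      exact h5 ((T.eq_of_half_eq_compl hs.1 hc).2 h6)
    -- A pair at distance `0` defines the half-space of all vertices, whose complement is null.
    · exfalso
      have h0 : T.δ w v = 0 := by have := T.nonneg w v; omega
      have : ν (one w v)ᶜ = 0 := by
        rw [measure_eq_zero_iff_ae_notMem]
        filter_upwards [hE] with s hs h5 using h5 (T.passes_of_zero hs.1 h0)
      rw [this] at h2
      exact hη (le_antisymm h2 bot_le)
  · have hc := T.half_eq_of_not_btw hb
    refine Or.inl ⟨v, hc, h1.trans (measure_mono_ae ?_)⟩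
    filter_upwards [hE] with s hs h5
    have := T.eq_of_half_eq hs.1 hc
    exact this.symm.trans h5

variable [MeasurableSpace G] [DiscreteMeasurableSpace G] [Countable G] [Countable V]
  {μ : Measure G} [IsProbabilityMeasure μ]

/-- The rest of `K` consists of countably many orientations towards vertices, each with an infinite
orbit and therefore without mass. -/
theorem measure_E (hμ : IsNonDegenerate μ) (hν : IsStationary μ ν) (hK : ν T.K = 1) :
    ∀ᵐ s ∂ν, s ∈ T.E := by
  have hK' : ∀ᵐ s ∂ν, s ∈ T.K := by
    rw [← prob_compl_eq_zero_iff T.isClosed_K.measurableSet] at hK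
    exact measure_eq_zero_iff_ae_notMem.1 hK |>.mono fun s hs => not_not.1 hs
  have hc : ν (Set.range T.ori) = 0 := by
    rw [← Set.iUnion_singleton_eq_range]
    exact measure_iUnion_null fun u => hν.measure_singleton_eq_zero hμ Ori.measurable_smul
      (fun x => measurableSet_singleton x) (T.infinite_orbit_ori u)
  filter_upwards [hK', measure_eq_zero_iff_ae_notMem.1 hc] with s h1 h2
  by_contra h3
  obtain ⟨u, rfl⟩ := T.exists_eq_ori h1 h3
  exact h2 ⟨u, rfl⟩

/-- A stationary measure converges to `0` or `1` on each half-space along almost every path. -/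
theorem ae_tendsto_zero_or_one (hμ : IsNonDegenerate μ) (hν : IsStationary μ ν)
    (hE : ∀ᵐ s ∂ν, s ∈ T.E) (hna : ∀ s ∈ T.E, ν {s} = 0) (w v : V) :
    ∀ᵐ h ∂(incrMeasure μ),
      Tendsto (fun i => ν.real (one ((walk h i)⁻¹ • w) ((walk h i)⁻¹ • v))) atTop (𝓝 0) ∨
      Tendsto (fun i => ν.real (one ((walk h i)⁻¹ • w) ((walk h i)⁻¹ • v))) atTop (𝓝 1) := by
  have hconv := hν.ae_tendsto Ori.measurable_smul (measurableSet_one w v)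
  simp only [preimage_one] at hconv
  by_cases hwv : 1 ≤ T.δ w v
  · have hex : ∀ᵐ h ∂(incrMeasure μ), ∀ k : ℕ, ¬ ∀ᶠ i in atTop, (walk h i)⁻¹ • T.half w v ∈
        {A : Set V | ∃ w v, A = T.half w v ∧ ENNReal.ofReal (1 / (k + 1 : ℝ)) ≤ ν (one w v) ∧
          ENNReal.ofReal (1 / (k + 1 : ℝ)) ≤ ν (one w v)ᶜ} :=
      ae_all_iff.2 fun k => measure_eventually_mem_finite μ hμ
        (T.finite_half hE hna (by rw [ne_eq, ENNReal.ofReal_eq_zero, not_le]; positivity))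
        (T.infinite_orbit_half hwv)
    filter_upwards [hconv, hex] with h hc hex
    obtain ⟨c, hc⟩ := hc
    have hc0 : 0 ≤ c := ge_of_tendsto' hc fun _ => measureReal_nonneg
    have hc1 : c ≤ 1 := le_of_tendsto' hc fun _ => measureReal_le_one
    by_contra hcon
    rw [not_or] at hcon
    have h0 : 0 < c := lt_of_le_of_ne hc0 fun e => hcon.1 (e ▸ hc)
    have h1 : c < 1 := lt_of_le_of_ne hc1 fun e => hcon.2 (e ▸ hc)
    -- A limit strictly between `0` and `1` would keep the translated half-space, from some time on,
    -- among the finitely many with both masses at least `1 / (k + 1)`.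
    obtain ⟨k, hk⟩ := exists_nat_one_div_lt (lt_min h0 (sub_pos.2 h1))
    rw [lt_min_iff] at hk
    refine hex k ?_
    filter_upwards [hc.eventually (lt_mem_nhds hk.1),
      hc.eventually (gt_mem_nhds (show c < 1 - 1 / (k + 1 : ℝ) by linarith))] with i hi1 hi2
    refine ⟨(walk h i)⁻¹ • w, (walk h i)⁻¹ • v, T.smul_half _ _ _, ?_, ?_⟩
    · rw [ENNReal.ofReal_le_iff_le_toReal (measure_ne_top _ _)]
      exact hi1.le
    · rw [ENNReal.ofReal_le_iff_le_toReal (measure_ne_top _ _)]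
      change _ ≤ ν.real _
      rw [probReal_compl_eq_one_sub (measurableSet_one _ _)]
      linarith
  · refine Eventually.of_forall fun h => Or.inr ?_
    have h0 : T.δ w v = 0 := by have := T.nonneg w v; omega
    have : ∀ g : G, ν.real (one (g • w) (g • v)) = 1 := by
      intro g
      have : one (g • w) (g • v) =ᵐ[ν] Set.univ := by
        rw [ae_eq_univ, measure_eq_zero_iff_ae_notMem]
        filter_upwards [hE] with s hs h5
        exact h5 (T.passes_of_zero hs.1 (by rwa [T.smul]))
      unfold Measure.real
      rw [measure_congr this, measure_univ, ENNReal.toReal_one]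
    simp only [this]
    exact tendsto_const_nhds

/-- `(w, v)` is asymptotically of full measure along the path with increments `h`. -/
def limOri (ν : Measure (Ori V)) (τ : ℕ → G) : Ori V := by
  classical exact fun p => decide (∀ᶠ i in atTop, 1 / 2 < ν.real (one ((τ i)⁻¹ • p.1) ((τ i)⁻¹ • p.2)))

theorem limOri_eq_true {τ : ℕ → G} {w v : V} : limOri ν τ (w, v) = true ↔
    ∀ᶠ i in atTop, 1 / 2 < ν.real (one ((τ i)⁻¹ • w) ((τ i)⁻¹ • v)) := by simp [limOri]

theorem measurable_limOri : Measurable (limOri (G := G) ν) := by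
  refine measurable_pi_lambda _ fun p => measurable_to_bool ?_
  have : (fun τ : ℕ → G => limOri ν τ p) ⁻¹' {true} = ⋃ k : ℕ, ⋂ i, ⋂ _ : k ≤ i,
      (fun τ : ℕ → G => τ i) ⁻¹' {g | 1 / 2 < ν.real (one (g⁻¹ • p.1) (g⁻¹ • p.2))} := by
    ext τ
    simp [limOri, eventually_atTop]
  rw [this]
  exact MeasurableSet.iUnion fun k => MeasurableSet.iInter fun i => MeasurableSet.iInter fun _ =>
    measurable_pi_apply i MeasurableSet.of_discrete

/-- `ν` converges along `τ` to the point mass at `s` on all half-spaces. -/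
def ConvTo (ν : Measure (Ori V)) (τ : ℕ → G) (s : Ori V) : Prop :=
  ∀ w v, Tendsto (fun i => ν.real (one ((τ i)⁻¹ • w) ((τ i)⁻¹ • v))) atTop
    (𝓝 (if s (w, v) = true then 1 else 0))

theorem convTo_limOri {τ : ℕ → G} (h : ∀ w v,
    Tendsto (fun i => ν.real (one ((τ i)⁻¹ • w) ((τ i)⁻¹ • v))) atTop (𝓝 0) ∨
    Tendsto (fun i => ν.real (one ((τ i)⁻¹ • w) ((τ i)⁻¹ • v))) atTop (𝓝 1)) :
    ConvTo ν τ (limOri ν τ) := by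
  intro w v
  rcases h w v with h0 | h1
  · rw [if_neg]
    · exact h0
    · rw [limOri_eq_true]
      intro H
      obtain ⟨i, h2, h3⟩ := (H.and (h0.eventually (gt_mem_nhds one_half_pos))).exists
      exact lt_asymm h2 h3
  · rw [if_pos]
    · exact h1
    · rw [limOri_eq_true]
      exact h1.eventually (lt_mem_nhds one_half_lt_one)

/-- All limits are `0` or `1`: one factor tending to `0` kills the intersection, and if all tend to
`1`, inclusion–exclusion gives `1`. -/
theorem ConvTo.cyl {τ : ℕ → G} {s : Ori V} (h : ConvTo ν τ s) (J : Finset (V × V)) :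
    Tendsto (fun i => ν.real ((τ i • ·) ⁻¹' Ori.cyl J)) atTop
      (𝓝 ((Ori.cyl J).indicator (fun _ => 1) s)) := by
  classical
  induction J using Finset.induction_on with
  | empty => simp [Ori.cyl]
  | insert p J hp ih =>
    have hI : Ori.cyl (insert p J) = one p.1 p.2 ∩ Ori.cyl J := by
      ext t; simp [Ori.cyl, one]
    have hp' := h p.1 p.2
    have hle1 : ∀ i, ν.real ((τ i • ·) ⁻¹' Ori.cyl (insert p J)) ≤
        ν.real (one ((τ i)⁻¹ • p.1) ((τ i)⁻¹ • p.2)) := fun i => by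
      rw [hI, ← preimage_one]
      exact measureReal_mono (Set.preimage_mono Set.inter_subset_left)
    have hle2 : ∀ i, ν.real ((τ i • ·) ⁻¹' Ori.cyl (insert p J)) ≤
        ν.real ((τ i • ·) ⁻¹' Ori.cyl J) := fun i => by
      rw [hI]
      exact measureReal_mono (Set.preimage_mono Set.inter_subset_right)
    by_cases hs1 : s p = true
    · by_cases hs2 : s ∈ Ori.cyl J
      · rw [if_pos hs1] at hp'
        rw [Set.indicator_of_mem hs2] at ih
        have hs3 : s ∈ Ori.cyl (insert p J) := by rw [hI]; exact ⟨hs1, hs2⟩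
        rw [Set.indicator_of_mem hs3]
        have hsum := (hp'.add ih).sub_const 1
        norm_num at hsum
        refine tendsto_of_tendsto_of_tendsto_of_le_of_le hsum tendsto_const_nhds (fun i => ?_)
          fun i => measureReal_le_one
        have hmeas : MeasurableSet ((τ i • ·) ⁻¹' Ori.cyl J) :=
          Ori.measurable_smul _ (Ori.measurableSet_cyl J)
        have := measureReal_union_add_inter (μ := ν)
          (s := one ((τ i)⁻¹ • p.1) ((τ i)⁻¹ • p.2)) hmeas
        have h1 : ν.real (one ((τ i)⁻¹ • p.1) ((τ i)⁻¹ • p.2) ∪ (τ i • ·) ⁻¹' Ori.cyl J) ≤ 1 :=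
          measureReal_le_one
        have h2 : ν.real ((τ i • ·) ⁻¹' Ori.cyl (insert p J)) =
          ν.real (one ((τ i)⁻¹ • p.1) ((τ i)⁻¹ • p.2) ∩ (τ i • ·) ⁻¹' Ori.cyl J) := by
          rw [hI, Set.preimage_inter, preimage_one]
        dsimp only
        linarith
      · rw [Set.indicator_of_notMem hs2] at ih
        rw [Set.indicator_of_notMem (by rw [hI]; exact fun H => hs2 H.2)]
        exact squeeze_zero (fun _ => measureReal_nonneg) hle2 ih
    · rw [if_neg hs1] at hp'
      rw [Set.indicator_of_notMem (by rw [hI]; exact fun H => hs1 H.1)]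
      exact squeeze_zero (fun _ => measureReal_nonneg) hle1 hp'

/-- The expected mass of the translated cylinder does not depend on time, by harmonicity, and it
tends to the probability that the limit lies in the cylinder. -/
theorem measure_cyl_eq (hν : IsStationary μ ν) {L : (ℕ → G) → Ori V} (hL : Measurable L)
    (hconv : ∀ᵐ h ∂(incrMeasure μ), ConvTo ν (walk h) (L h)) (J : Finset (V × V)) :
    ν (Ori.cyl J) = (incrMeasure μ).map L (Ori.cyl J) := by
  have hJ := Ori.measurableSet_cyl J
  have : IsProbabilityMeasure ((incrMeasure μ).map L) :=
    Measure.isProbabilityMeasure_map hL.aemeasurable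
  have h1 : Tendsto (fun i => ∫ h, ν.real ((walk h i • ·) ⁻¹' Ori.cyl J) ∂(incrMeasure μ)) atTop
      (𝓝 (∫ h, (Ori.cyl J).indicator (fun _ => (1 : ℝ)) (L h) ∂(incrMeasure μ))) := by
    refine tendsto_integral_of_dominated_convergence (fun _ => 1) (fun i => ?_)
      (integrable_const _) (fun i => Eventually.of_forall fun h => ?_) ?_
    · exact ((measurable_of_countable fun g : G => ν.real ((g • ·) ⁻¹' Ori.cyl J)).comp
        (measurable_walk i)).aestronglyMeasurable
    · rw [Real.norm_of_nonneg measureReal_nonneg]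
      exact measureReal_le_one
    · filter_upwards [hconv] with h hh using hh.cyl J
  simp only [hν.integral_walk Ori.measurable_smul hJ] at h1
  have h2 := tendsto_nhds_unique tendsto_const_nhds h1
  rw [← (ENNReal.toReal_eq_toReal_iff' (measure_ne_top _ _) (measure_ne_top _ _))]
  change ν.real _ = ((incrMeasure μ).map L).real _
  rw [h2, map_measureReal_apply hL hJ, ← integral_indicator_one (hL hJ)]
  rfl

variable (hE : ∀ s ∈ T.E, (MulAction.orbit G s).Infinite)

include hE in
theorem measure_singleton_E (hμ : IsNonDegenerate μ) (hν : IsStationary μ ν) :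
    ∀ s ∈ T.E, ν {s} = 0 := fun s hs =>
  hν.measure_singleton_eq_zero hμ Ori.measurable_smul (fun x => measurableSet_singleton x) (hE s hs)

include hE in
theorem ae_convTo (hμ : IsNonDegenerate μ) (hν : IsStationary μ ν) (hK : ν T.K = 1) :
    ∀ᵐ h ∂(incrMeasure μ), ConvTo ν (walk h) (limOri ν (walk h)) := by
  have := fun w v => T.ae_tendsto_zero_or_one hμ hν (T.measure_E hμ hν hK)
    (T.measure_singleton_E hE hμ hν) w v
  filter_upwards [ae_all_iff.2 fun w => ae_all_iff.2 fun v => this w v] with h hh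
  exact convTo_limOri hh

theorem measurable_limOri_walk : Measurable fun h : ℕ → G => limOri ν (walk h) :=
  measurable_limOri.comp (measurable_pi_lambda _ fun i => measurable_walk i)

include hE in
theorem eq_map_limOri (hμ : IsNonDegenerate μ) (hν : IsStationary μ ν) (hK : ν T.K = 1) :
    ν = (incrMeasure μ).map fun h => limOri ν (walk h) := by
  have : IsProbabilityMeasure ((incrMeasure μ).map fun h => limOri ν (walk h)) :=
    Measure.isProbabilityMeasure_map measurable_limOri_walk.aemeasurable
  exact Ori.ext_of_cyl fun J => measure_cyl_eq hν measurable_limOri_walk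
    (T.ae_convTo hE hμ hν hK) J

include hE in
/-- Almost every path of the walk converges to an end. -/
theorem ae_limOri_mem_E (hμ : IsNonDegenerate μ) (hν : IsStationary μ ν) (hK : ν T.K = 1) :
    ∀ᵐ h ∂(incrMeasure μ), limOri ν (walk h) ∈ T.E := by
  have h1 := T.measure_E hμ hν hK
  rw [T.eq_map_limOri hE hμ hν hK] at h1
  exact ae_of_ae_map measurable_limOri_walk.aemeasurable h1

include hE in
-- The mean `ξ` is stationary as well, so along almost every path its half-space masses tend to `0`
-- or `1`. They are the means of those for `ν` and `ν'`, so the two limit orientations agree, and so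
-- do their laws.
theorem isStationary_unique (hμ : IsNonDegenerate μ) {ν' : Measure (Ori V)}
    [IsProbabilityMeasure ν'] (hν : IsStationary μ ν) (hK : ν T.K = 1)
    (hν' : IsStationary μ ν') (hK' : ν' T.K = 1) : ν = ν' := by
  set ξ : Measure (Ori V) := (2 : ℝ≥0∞)⁻¹ • (ν + ν') with hξ
  have hval : ∀ A, ξ A = 2⁻¹ * (ν A + ν' A) := fun A => by
    simp [hξ, mul_add]
  have htwo : (2 : ℝ≥0∞)⁻¹ * (1 + 1) = 1 := by
    rw [one_add_one_eq_two]; exact ENNReal.inv_mul_cancel (by simp) (by simp)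
  have hp : IsProbabilityMeasure ξ := ⟨by rw [hval, measure_univ, measure_univ, htwo]⟩
  have hξK : ξ T.K = 1 := by rw [hval, hK, hK', htwo]
  have hξs : IsStationary μ ξ := by
    refine isStationary_of_apply Ori.measurable_smul fun A hA => ?_
    simp only [hval]
    rw [hν.apply Ori.measurable_smul hA, hν'.apply Ori.measurable_smul hA, ← ENNReal.tsum_add,
      ← ENNReal.tsum_mul_left]
    exact tsum_congr fun g => by ring
  have hreal : ∀ A, ξ.real A = (ν.real A + ν'.real A) / 2 := fun A => by
    unfold Measure.real
    rw [hval, ENNReal.toReal_mul, ENNReal.toReal_add (measure_ne_top _ _) (measure_ne_top _ _),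
      ENNReal.toReal_inv, ENNReal.toReal_ofNat]
    ring
  have heq : ∀ᵐ h ∂(incrMeasure μ), limOri ν (walk h) = limOri ν' (walk h) := by
    filter_upwards [T.ae_convTo hE hμ hν hK, T.ae_convTo hE hμ hν' hK',
      T.ae_convTo hE hμ hξs hξK] with h h1 h2 h3
    funext ⟨w, v⟩
    have h4 := ((h1 w v).add (h2 w v)).div_const 2
    simp only [← hreal] at h4
    have h5 := tendsto_nhds_unique h4 (h3 w v)
    cases e1 : limOri ν (walk h) (w, v) <;> cases e2 : limOri ν' (walk h) (w, v) <;>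
      simp only [e1, e2] at h5 ⊢ <;> split_ifs at h5 <;> norm_num at h5 <;> contradiction
  rw [T.eq_map_limOri hE hμ hν hK, T.eq_map_limOri hE hμ hν' hK']
  exact Measure.map_congr heq

include hE in
/-- Every half-space that contains an end has positive measure. -/
theorem measure_one_pos (hμ : IsNonDegenerate μ) (hν : IsStationary μ ν) (hK : ν T.K = 1)
    {s : Ori V} (hs : s ∈ T.E) {v : V} (hv : s (T.base, v) = true) : ν (one T.base v) ≠ 0 := by
  intro h0
  have hEae := T.measure_E hμ hν hK
  -- From depth `l` on, no shadow has full measure.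
  obtain ⟨l, hl⟩ := T.small_shadow hEae (T.measure_singleton_E hE hμ hν) one_ne_zero
  have hn := T.nonneg T.base v
  obtain ⟨v', hv', hsv'⟩ := hs.2 (T.δ T.base v + l).toNat
  -- The path from the base point to `g • base` runs through `v'`, at least `l` levels beyond `v`.
  -- Translated by `g⁻¹`, the null half-space contains the base point, and its complement is a
  -- shadow deeper than `l` of full measure, a contradiction.
  obtain ⟨g, hg⟩ := T.span v'
  have hb := T.btw_of_passes hs.1 (by omega) hsv' hv
  have h1 : ν (one (g⁻¹ • T.base) (g⁻¹ • v)) = 0 := by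
    rw [← preimage_one]
    exact hν.measure_preimage_eq_zero hμ Ori.measurable_smul (measurableSet_one _ _) h0 g
  have hd : T.δ T.base (g⁻¹ • v) = T.δ v (g • T.base) := by
    rw [← T.smul g, smul_inv_smul, T.comm]
  have hbtw : T.Btw (g⁻¹ • T.base) (g⁻¹ • v) T.base ∧ (l : ℤ) ≤ T.δ v (g • T.base) := by
    rw [← T.btw_smul g, smul_inv_smul, smul_inv_smul]
    have := T.tri T.base (g • T.base) v
    have := T.tri v (g • T.base) v'
    have := T.comm (g • T.base) v
    have := T.comm (g • T.base) v'
    have := T.nonneg v' (g • T.base)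
    unfold Btw at *
    omega
  have hnull : ν (one (g⁻¹ • T.base) (g⁻¹ • v))ᶜ = 1 := by
    rw [prob_compl_eq_one_iff (measurableSet_one _ _)]; exact h1
  by_cases h2 : 1 ≤ T.δ (g⁻¹ • T.base) (g⁻¹ • v)
  · obtain ⟨b, hb1, hb2⟩ := T.half_compl hbtw.1 h2
    have h3 := hl b (by omega)
    refine absurd h3 (not_lt.2 ?_)
    rw [← hnull]
    refine measure_mono_ae ?_
    filter_upwards [hEae] with t ht h5
    by_contra h6
    exact h5 ((T.eq_of_half_eq_compl ht.1 hb2).2 h6)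
  · have h3 : T.δ (g⁻¹ • T.base) (g⁻¹ • v) = 0 := by
      have := T.nonneg (g⁻¹ • T.base) (g⁻¹ • v); omega
    have : ν (one (g⁻¹ • T.base) (g⁻¹ • v))ᶜ = 0 := by
      rw [measure_eq_zero_iff_ae_notMem]
      filter_upwards [hEae] with s hs h5 using h5 (T.passes_of_zero hs.1 h3)
    rw [this] at hnull
    exact zero_ne_one hnull

/-- There is a stationary measure. -/
theorem exists_stationary (μ : Measure G) [IsProbabilityMeasure μ] :
    ∃ ν : Measure (Ori V), IsProbabilityMeasure ν ∧ IsStationary μ ν ∧ ν T.K = 1 :=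
  exists_isStationary μ Ori.continuous_smul (T.ori T.base) T.isClosed_K fun g => by
    rw [smul_ori]; exact T.ori_mem_K _

end IntTree

end ZnFree

namespace ZnFree

set_option linter.unusedSectionVars false

/-! ### Coordinates, order and convex subgroups of `ℤⁿ`. -/

section Coordinates

variable {n : ℕ}

theorem coord_add (k : ℕ) (α β : Zn n) : coord k (α + β) = coord k α + coord k β := by
  unfold coord; split_ifs <;> rfl

theorem coord_zero (k : ℕ) : coord k (0 : Zn n) = 0 := by
  unfold coord; split_ifs <;> rfl

theorem coord_neg (k : ℕ) (α : Zn n) : coord k (-α) = -coord k α := by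
  have := coord_add k α (-α)
  rw [add_neg_cancel, coord_zero] at this
  omega

theorem coord_sub (k : ℕ) (α β : Zn n) : coord k (α - β) = coord k α - coord k β := by
  rw [sub_eq_add_neg, coord_add, coord_neg]; rfl

theorem coord_two_nsmul (k : ℕ) (α : Zn n) : coord k (2 • α) = 2 * coord k α := by
  rw [two_nsmul, coord_add]; omega

theorem coord_of_le {k : ℕ} (h : n ≤ k) (α : Zn n) : coord k α = 0 := by
  unfold coord; rw [dif_neg (by omega)]

theorem coord_ext {α β : Zn n} (h : ∀ k, coord k α = coord k β) : α = β := by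
  funext i
  have := h i
  unfold coord at this
  rw [dif_pos i.isLt, dif_pos i.isLt] at this
  exact this

theorem pos_iff {α : Zn n} : 0 < α ↔ ∃ k, (∀ j, k < j → coord j α = 0) ∧ 0 < coord k α := by
  rw [Zn.lt_iff]
  constructor
  · rintro ⟨i, h1, h2⟩
    refine ⟨i, fun j hj => ?_, ?_⟩
    · by_cases hjn : j < n
      · unfold coord
        rw [dif_pos hjn]
        exact (h1 ⟨j, hjn⟩ (Fin.lt_def.2 hj)).symm
      · exact coord_of_le (by omega) _
    · unfold coord
      rw [dif_pos i.isLt]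
      exact h2
  · rintro ⟨k, h1, h2⟩
    have hk : k < n := by
      by_contra hk
      rw [coord_of_le (by omega)] at h2
      omega
    refine ⟨⟨k, hk⟩, fun j hj => ?_, ?_⟩
    · have := h1 j (Fin.lt_def.1 hj)
      unfold coord at this
      rw [dif_pos j.isLt] at this
      exact this.symm
    · unfold coord at h2
      rw [dif_pos hk] at h2
      exact h2

theorem InZ.zero (k : ℕ) : InZ k (0 : Zn n) := fun j _ => coord_zero j

theorem InZ.add {k : ℕ} {α β : Zn n} (h : InZ k α) (h' : InZ k β) : InZ k (α + β) := fun j hj => by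
  rw [coord_add, h j hj, h' j hj]; rfl

theorem InZ.neg {k : ℕ} {α : Zn n} (h : InZ k α) : InZ k (-α) := fun j hj => by
  rw [coord_neg, h j hj]; rfl

theorem InZ.sub {k : ℕ} {α β : Zn n} (h : InZ k α) (h' : InZ k β) : InZ k (α - β) := by
  rw [sub_eq_add_neg]; exact h.add h'.neg

theorem InZ.mono {k l : ℕ} (hkl : k ≤ l) {α : Zn n} (h : InZ k α) : InZ l α := fun j hj =>
  h j (hkl.trans hj)

theorem inZ_top (α : Zn n) : InZ n α := fun _ hj => coord_of_le hj α

theorem InZ.pred {k : ℕ} {α : Zn n} (h : InZ (k + 1) α) (h0 : coord k α = 0) : InZ k α := by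
  intro j hj
  rcases hj.eq_or_lt with rfl | hj
  · exact h0
  · exact h j hj

/-- In `ℤᵏ⁺¹` the coordinate of index `k` is the leading one, so it carries the sign. -/
theorem InZ.coord_nonneg {k : ℕ} {α : Zn n} (h : InZ (k + 1) α) (h0 : 0 ≤ α) : 0 ≤ coord k α := by
  rcases h0.eq_or_lt with rfl | h0
  · rw [coord_zero]
  · obtain ⟨j, h1, h2⟩ := pos_iff.1 h0
    by_cases hj : k + 1 ≤ j
    · rw [h j hj] at h2; omega
    · rcases (show j = k ∨ j < k by omega) with rfl | hjk
      · exact h2.le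
      · rw [h1 k hjk]

theorem InZ.coord_mono {k : ℕ} {α β : Zn n} (h : InZ (k + 1) α) (h' : InZ (k + 1) β)
    (hle : α ≤ β) : coord k α ≤ coord k β := by
  have := (h'.sub h).coord_nonneg (sub_nonneg.2 hle)
  rw [coord_sub] at this
  omega

theorem InZ.lt_of_coord_lt {k : ℕ} {α β : Zn n} (h : InZ (k + 1) α) (h' : InZ (k + 1) β)
    (hlt : coord k α < coord k β) : α < β := by
  by_contra hle
  have := h'.coord_mono h (not_lt.1 hle)
  omega

/-- The leading coordinates of `α` are removed one after the other, each squeezed between `0` and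
`0`. -/
theorem InZ.convex {k : ℕ} {α β : Zn n} (h : InZ k β) (h0 : 0 ≤ α) (hle : α ≤ β) : InZ k α := by
  have key : ∀ m, InZ (k + m) α → InZ k α := by
    intro m
    induction m with
    | zero => exact id
    | succ m ih =>
      intro hm
      have hm : InZ (k + m + 1) α := hm
      refine ih (hm.pred ?_)
      have h1 := hm.coord_nonneg h0
      have h2 := hm.coord_mono (h.mono (by omega)) hle
      rw [h (k + m) (by omega)] at h2
      exact le_antisymm h2 h1
  exact key n ((inZ_top α).mono (by omega))

theorem InZ.abs {k : ℕ} {α : Zn n} (h : InZ k α) : InZ k |α| := by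
  rcases abs_choice α with e | e <;> rw [e]
  · exact h
  · exact h.neg

/-- The top coordinate. -/
def top (α : Zn n) : ℤ := coord (n - 1) α

theorem top_add (α β : Zn n) : top (α + β) = top α + top β := coord_add _ _ _
theorem top_sub (α β : Zn n) : top (α - β) = top α - top β := coord_sub _ _ _
theorem top_zero : top (0 : Zn n) = 0 := coord_zero _
theorem top_two_nsmul (α : Zn n) : top (2 • α) = 2 * top α := coord_two_nsmul _ _

theorem inZ_top_pred (α : Zn n) : InZ (n - 1 + 1) α := (inZ_top α).mono (by omega)

theorem top_mono {α β : Zn n} (h : α ≤ β) : top α ≤ top β :=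
  (inZ_top_pred α).coord_mono (inZ_top_pred β) h

theorem lt_of_top_lt {α β : Zn n} (h : top α < top β) : α < β :=
  (inZ_top_pred α).lt_of_coord_lt (inZ_top_pred β) h

theorem inZ_of_top_eq_zero {α : Zn n} (h : top α = 0) : InZ (n - 1) α :=
  (inZ_top_pred α).pred h

theorem top_eq_zero_of_inZ {k : ℕ} (hk : k < n) {α : Zn n} (h : InZ k α) : top α = 0 :=
  h _ (by omega)

/-- A tuple with given top coordinate. -/
theorem exists_top (hn : 1 ≤ n) (m : ℤ) : ∃ α : Zn n, top α = m := by
  refine ⟨toColex fun i => if i.val = n - 1 then m else 0, ?_⟩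
  unfold top coord
  rw [dif_pos (by omega)]
  exact if_pos rfl

theorem unit_pos (hn : 1 ≤ n) : 0 < unit n := by
  obtain ⟨α, hα⟩ := exists_top hn 1
  exact unit_pos_of_pos (α := α) (lt_of_top_lt (by rw [hα, top_zero]; exact one_pos))

theorem coord_unit_zero (hn : 1 ≤ n) : coord 0 (unit n) = 1 := by
  unfold coord
  rw [dif_pos (by omega), ofColex_unit, if_pos rfl]

theorem inZ_unit : InZ 1 (unit n) := by
  intro j hj
  unfold coord
  split_ifs
  · rw [ofColex_unit, if_neg]; dsimp only; omega
  · rfl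

theorem InZ.eq_of_coord_zero {α β : Zn n} (h : InZ 1 α) (h' : InZ 1 β)
    (he : coord 0 α = coord 0 β) : α = β := by
  refine coord_ext fun k => ?_
  cases k with
  | zero => exact he
  | succ k => rw [h _ (by omega), h' _ (by omega)]

theorem two_nsmul_cancel {α β : Zn n} (h : 2 • α = 2 • β) : α = β := by
  refine coord_ext fun k => ?_
  have := congrArg (coord k) h
  rw [coord_two_nsmul, coord_two_nsmul] at this
  omega

instance : Countable (Zn n) := inferInstanceAs (Countable (Fin n → ℤ))

end Coordinates

namespace WordGroup

variable {n : ℕ} {X G : Type*} [Group G] (ρ : WordGroup n X G)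

/-! ### The metric of the universal tree -/

/-- The distance from the root. -/
def ht (p : ρ.Tree) : Zn n := Quotient.liftOn p (fun p => p.ht) fun _ _ h => h.1

/-- The length of the common part of the segments from the root. -/
def meet (p q : ρ.Tree) : Zn n :=
  Quotient.liftOn₂ p q (fun p q => min (min p.ht q.ht) (ρ.c p.elt q.elt)) (by
    intro p q p' q' h1 h2
    have e1 := ρ.min_c_eq q.elt h1.2
    have e2 := ρ.min_c_eq p'.elt h2.2
    rw [ρ.c_comm q.elt, ρ.c_comm q'.elt] at e2
    rw [min_right_comm, e1, min_right_comm, min_assoc, e2, ← min_assoc, h1.1, h2.1])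

theorem dist_eq (p q : ρ.Tree) : ρ.dist p q = ρ.ht p + ρ.ht q - 2 • ρ.meet p q := by
  induction p using Quotient.inductionOn
  induction q using Quotient.inductionOn
  rfl

theorem meet_comm (p q : ρ.Tree) : ρ.meet p q = ρ.meet q p := by
  induction p using Quotient.inductionOn with | _ p
  induction q using Quotient.inductionOn with | _ q
  change min (min p.ht q.ht) _ = min (min q.ht p.ht) _
  rw [min_comm p.ht, ρ.c_comm]

theorem meet_le_left (p q : ρ.Tree) : ρ.meet p q ≤ ρ.ht p := by
  induction p using Quotient.inductionOn
  induction q using Quotient.inductionOn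
  exact (min_le_left _ _).trans (min_le_left _ _)

theorem meet_le_right (p q : ρ.Tree) : ρ.meet p q ≤ ρ.ht q := by
  rw [meet_comm]; exact ρ.meet_le_left q p

theorem meet_nonneg (p q : ρ.Tree) : 0 ≤ ρ.meet p q := by
  induction p using Quotient.inductionOn with | _ p
  induction q using Quotient.inductionOn with | _ q
  exact le_min (le_min p.ht_nonneg q.ht_nonneg) (ρ.c_nonneg _ _)

theorem meet_self (p : ρ.Tree) : ρ.meet p p = ρ.ht p := by
  induction p using Quotient.inductionOn with | _ p
  change min (min p.ht p.ht) (ρ.c p.elt p.elt) = p.ht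
  rw [min_self, ρ.c_self, min_eq_left p.ht_le]

/-- This ultrametric inequality contains the tree structure; `four_point` is derived from it alone.
-/
theorem meet_ultra (p q r : ρ.Tree) : min (ρ.meet p q) (ρ.meet q r) ≤ ρ.meet p r := by
  induction p using Quotient.inductionOn with | _ p
  induction q using Quotient.inductionOn with | _ q
  induction r using Quotient.inductionOn with | _ r
  change min (min (min p.ht q.ht) _) (min (min q.ht r.ht) _) ≤ min (min p.ht r.ht) _
  refine le_min (le_min ?_ ?_) ?_
  · exact (min_le_left _ _).trans ((min_le_left _ _).trans (min_le_left _ _))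
  · exact (min_le_right _ _).trans ((min_le_left _ _).trans (min_le_right _ _))
  · exact ρ.c_trans (g := q.elt) ((min_le_left _ _).trans (min_le_right _ _))
      ((min_le_right _ _).trans (min_le_right _ _))

theorem eq_of_meet {p q : ρ.Tree} (h1 : ρ.meet p q = ρ.ht p) (h2 : ρ.meet p q = ρ.ht q) :
    p = q := by
  induction p using Quotient.inductionOn with | _ p
  induction q using Quotient.inductionOn with | _ q
  refine Quotient.sound ⟨h1.symm.trans h2, ?_⟩
  have : min (min p.ht q.ht) (ρ.c p.elt q.elt) = p.ht := h1
  rw [← this]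
  exact min_le_right _ _

/-- The point at height `β` on the segment from the root to `p`. -/
theorem exists_trunc (p : ρ.Tree) {β : Zn n} (h0 : 0 ≤ β) (h1 : β ≤ ρ.ht p) :
    ∃ z, ρ.ht z = β ∧ ∀ q, ρ.meet z q = min β (ρ.meet p q) := by
  induction p using Quotient.inductionOn with | _ p
  refine ⟨Quotient.mk _ ⟨β, p.elt, h0, le_trans h1 p.ht_le⟩, rfl, fun q => ?_⟩
  induction q using Quotient.inductionOn with | _ q
  change min (min β q.ht) (ρ.c p.elt q.elt) = min β (min (min p.ht q.ht) (ρ.c p.elt q.elt))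
  have : β ≤ p.ht := h1
  rw [min_assoc, min_assoc, ← min_assoc β p.ht, min_eq_left this]

theorem dist_self (p : ρ.Tree) : ρ.dist p p = 0 := by
  rw [dist_eq, meet_self, two_nsmul]; abel

theorem dist_comm (p q : ρ.Tree) : ρ.dist p q = ρ.dist q p := by
  rw [dist_eq, dist_eq, meet_comm]; abel

theorem dist_nonneg (p q : ρ.Tree) : 0 ≤ ρ.dist p q := by
  have h1 := ρ.meet_le_left p q
  have h2 := ρ.meet_le_right p q
  rw [dist_eq]
  grind

theorem eq_of_dist_eq_zero {p q : ρ.Tree} (h : ρ.dist p q = 0) : p = q := by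
  have h1 := ρ.meet_le_left p q
  have h2 := ρ.meet_le_right p q
  rw [dist_eq] at h
  exact ρ.eq_of_meet (by grind) (by grind)

/-- The heights cancel, and a combination of ultrametric inequalities for `meet` remains. -/
theorem four_point (x y z w : ρ.Tree) : ρ.dist x y + ρ.dist z w ≤ ρ.dist x z + ρ.dist y w ∨
    ρ.dist x y + ρ.dist z w ≤ ρ.dist x w + ρ.dist y z := by
  have key : ρ.meet x z + ρ.meet y w ≤ ρ.meet x y + ρ.meet z w ∨
      ρ.meet x w + ρ.meet y z ≤ ρ.meet x y + ρ.meet z w := by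
    have h1 := ρ.meet_ultra x z y
    have h2 := ρ.meet_ultra x w y
    have h3 := ρ.meet_ultra z x w
    have h4 := ρ.meet_ultra z y w
    rw [ρ.meet_comm z y] at h1
    rw [ρ.meet_comm w y] at h2
    rw [ρ.meet_comm z x] at h3
    rw [ρ.meet_comm z y] at h4
    generalize ρ.meet x y = xy at *
    generalize ρ.meet x z = xz at *
    generalize ρ.meet x w = xw at *
    generalize ρ.meet y z = yz at *
    generalize ρ.meet y w = yw at *
    generalize ρ.meet z w = zw at *
    rw [min_le_iff] at h1 h2 h3 h4
    rcases h1 with h1 | h1 <;> rcases h2 with h2 | h2 <;> rcases h3 with h3 | h3 <;>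
      rcases h4 with h4 | h4 <;> grind
  simp only [dist_eq]
  rcases key with h | h
  · left; grind
  · right; grind

theorem dist_triangle (x y z : ρ.Tree) : ρ.dist x y ≤ ρ.dist x z + ρ.dist z y := by
  have := ρ.four_point x y z z
  rw [dist_self, ρ.dist_comm y z] at this
  grind

/-- Every height and every common part is counted twice. This parity later shows that no vertex is
equidistant from the two ends of an edge. -/
theorem dist_even (x y z : ρ.Tree) : ∃ e, ρ.dist x y + ρ.dist y z + ρ.dist x z = 2 • e := by
  refine ⟨ρ.ht x + ρ.ht y + ρ.ht z - ρ.meet x y - ρ.meet y z - ρ.meet x z, ?_⟩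
  simp only [dist_eq, two_nsmul]
  abel

theorem exists_seg (v w : ρ.Tree) {t : Zn n} (h0 : 0 ≤ t) (h1 : t ≤ ρ.dist v w) :
    ∃ z, ρ.dist v z = t ∧ ρ.dist z w = ρ.dist v w - t := by
  have m1 := ρ.meet_le_left v w
  have m2 := ρ.meet_le_right v w
  have m3 := ρ.meet_nonneg v w
  have e := ρ.dist_eq v w
  by_cases h : t ≤ ρ.ht v - ρ.meet v w
  · obtain ⟨z, hz1, hz2⟩ := ρ.exists_trunc v (β := ρ.ht v - t) (by grind) (by grind)
    have e1 : ρ.meet v z = ρ.ht v - t := by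
      rw [meet_comm, hz2, meet_self, min_eq_left (by grind)]
    have e2 : ρ.meet z w = ρ.meet v w := by
      rw [hz2, min_eq_right (by grind)]
    refine ⟨z, ?_, ?_⟩
    · rw [dist_eq, e1, hz1]; grind
    · rw [dist_eq, e2, hz1]; grind
  -- Beyond the branch point the segment climbs towards `w`; its point at distance `t` from `v` has
  -- this height.
  · obtain ⟨z, hz1, hz2⟩ := ρ.exists_trunc w (β := 2 • ρ.meet v w + t - ρ.ht v) (by grind) (by grind)
    have e1 : ρ.meet v z = ρ.meet v w := by
      rw [meet_comm, hz2, ρ.meet_comm w v, min_eq_right (by grind)]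
    have e2 : ρ.meet z w = 2 • ρ.meet v w + t - ρ.ht v := by
      rw [hz2, meet_self, min_eq_left (by grind)]
    refine ⟨z, ?_, ?_⟩
    · rw [dist_eq, e1, hz1]; grind
    · rw [dist_eq, e2, hz1]; grind

theorem smul_root (g : G) : g • ρ.root = Quotient.mk _ ⟨ρ.len g, g, ρ.len_nonneg g, le_rfl⟩ := by
  change Quotient.mk _ (ρ.preAct g _) = _
  have : (0 : Zn n) ≤ ρ.c g⁻¹ 1 := ρ.c_nonneg _ _
  unfold preAct
  simp only [this, dif_pos, sub_zero]

theorem ht_smul_root (g : G) : ρ.ht (g • ρ.root) = ρ.len g := by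
  rw [smul_root]; rfl

theorem ht_root : ρ.ht ρ.root = 0 := rfl

theorem meet_root (p : ρ.Tree) : ρ.meet ρ.root p = 0 :=
  le_antisymm (ρ.meet_le_left _ _) (ρ.meet_nonneg _ _)

theorem dist_root (p : ρ.Tree) : ρ.dist ρ.root p = ρ.ht p := by
  rw [dist_eq, meet_root, ht_root, smul_zero]; abel

theorem dist_root_smul_root (g : G) : ρ.dist ρ.root (g • ρ.root) = ρ.len g := by
  rw [dist_root, ht_smul_root]

theorem exists_elt (q : ρ.Tree) : ∃ g : G, ρ.meet q (g • ρ.root) = ρ.ht q := by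
  induction q using Quotient.inductionOn with | _ p
  refine ⟨p.elt, ?_⟩
  rw [smul_root]
  change min (min p.ht (ρ.len p.elt)) (ρ.c p.elt p.elt) = p.ht
  rw [ρ.c_self, min_eq_left p.ht_le, min_eq_left p.ht_le]

theorem exists_mem_seg_root (q : ρ.Tree) : ∃ g : G, q ∈ ρ.seg ρ.root (g • ρ.root) := by
  obtain ⟨g, hg⟩ := ρ.exists_elt q
  refine ⟨g, ?_⟩
  change _ + _ = _
  rw [dist_root, dist_root, dist_eq, hg, two_nsmul]
  abel

instance [Countable G] : Countable ρ.Tree := by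
  have : Function.Injective fun p : ρ.PreTree => (p.ht, p.elt) := by
    rintro ⟨a, g, _, _⟩ ⟨b, h, _, _⟩ e
    simp only [Prod.mk.injEq] at e
    obtain ⟨rfl, rfl⟩ := e
    rfl
  have := this.countable
  exact inferInstanceAs (Countable (Quotient ρ.preTreeSetoid))

end WordGroup

end ZnFree

namespace ZnFree

/-! ### Factorisation of words and labels of segments. -/

namespace ZnWord

variable {n : ℕ} {X : Type*}

theorem letterInv_letterInv (x : X × Bool) : letterInv (letterInv x) = x := by
  simp [letterInv]

theorem letter_eq_none {w : ZnWord n X} {β : Zn n} (h : ¬ (unit n ≤ β ∧ β ≤ w.len)) :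
    w.letter β = none := by
  rw [← w.isSome_iff] at h
  simpa using h

theorem ext_of_letter {u v : ZnWord n X} (h : u.len = v.len)
    (h' : ∀ β, unit n ≤ β → β ≤ u.len → u.letter β = v.letter β) : u = v := by
  refine ZnWord.ext h (funext fun β => ?_)
  by_cases hb : unit n ≤ β ∧ β ≤ u.len
  · exact h' β hb.1 hb.2
  · rw [letter_eq_none hb, letter_eq_none (by rwa [← h])]

theorem concat_letter_of_le {u : ZnWord n X} (v : ZnWord n X) {β : Zn n} (h : β ≤ u.len) :
    (u.concat v).letter β = u.letter β := if_pos h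

theorem concat_letter_of_lt {u : ZnWord n X} (v : ZnWord n X) {β : Zn n} (h : u.len < β) :
    (u.concat v).letter β = v.letter (β - u.len) := if_neg (not_le.2 h)

theorem concat_len (u v : ZnWord n X) : (u.concat v).len = u.len + v.len := rfl

theorem inv_len (u : ZnWord n X) : u.inv.len = u.len := rfl

theorem concat_assoc (u v w : ZnWord n X) :
    (u.concat v).concat w = u.concat (v.concat w) := by
  have hv := v.len_nonneg
  refine ZnWord.ext (add_assoc _ _ _) (funext fun β => ?_)
  by_cases h1 : β ≤ u.len
  · rw [concat_letter_of_le _ (by rw [concat_len]; grind), concat_letter_of_le _ h1,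
      concat_letter_of_le _ h1]
  · rw [not_le] at h1
    rw [concat_letter_of_lt (v.concat w) h1]
    by_cases h2 : β ≤ u.len + v.len
    · rw [concat_letter_of_le _ h2, concat_letter_of_lt _ h1, concat_letter_of_le _ (by grind)]
    · rw [concat_letter_of_lt _ (not_le.1 h2), concat_letter_of_lt _ (by grind), concat_len,
        sub_sub]

theorem inv_inv (u : ZnWord n X) : u.inv.inv = u := by
  refine ZnWord.ext rfl (funext fun β => ?_)
  simp only [inv, Option.map_map]
  rw [show u.len + unit n - (u.len + unit n - β) = β by abel]
  cases u.letter β <;> simp [letterInv]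

theorem inv_letter (u : ZnWord n X) (β : Zn n) :
    u.inv.letter β = (u.letter (u.len + unit n - β)).map letterInv := rfl

theorem inv_concat (hn : 1 ≤ n) (u v : ZnWord n X) :
    (u.concat v).inv = v.inv.concat u.inv := by
  have h0 := unit_pos hn
  refine ZnWord.ext (add_comm _ _) (funext fun β => ?_)
  rw [inv_letter, concat_len]
  by_cases h : β ≤ v.len
  · rw [concat_letter_of_lt _ (by grind), concat_letter_of_le (u := v.inv) _ h, inv_letter,
      show u.len + v.len + unit n - β - u.len = v.len + unit n - β by abel]
  · rw [not_le] at h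
    have h2 := unit_le_of_pos (sub_pos.2 h)
    rw [concat_letter_of_le _ (by grind), concat_letter_of_lt (u := v.inv) _ h, inv_letter, inv_len,
      show u.len + v.len + unit n - β = u.len + unit n - (β - v.len) by abel]

/-- The initial segment of length `α`. -/
def take (w : ZnWord n X) (α : Zn n) (h0 : 0 ≤ α) (h1 : α ≤ w.len) : ZnWord n X where
  len := α
  letter β := if β ≤ α then w.letter β else none
  len_nonneg := h0
  isSome_iff β := by
    split_ifs with h
    · rw [w.isSome_iff]
      exact ⟨fun h2 => ⟨h2.1, h⟩, fun h2 => ⟨h2.1, h.trans h1⟩⟩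
    · simp [h]

/-- The word without its initial segment of length `α`. -/
def drop (hn : 1 ≤ n) (w : ZnWord n X) (α : Zn n) (h0 : 0 ≤ α) (h1 : α ≤ w.len) : ZnWord n X where
  len := w.len - α
  letter β := if 0 < β then w.letter (β + α) else none
  len_nonneg := sub_nonneg.2 h1
  isSome_iff β := by
    have hu := unit_pos hn
    split_ifs with h
    · have := unit_le_of_pos h
      rw [w.isSome_iff]
      constructor <;> rintro ⟨h2, h3⟩ <;> refine ⟨?_, ?_⟩ <;> grind
    · have : ¬ unit n ≤ β := by grind
      simp [this]

theorem take_concat_drop (hn : 1 ≤ n) (w : ZnWord n X) {α : Zn n} (h0 : 0 ≤ α) (h1 : α ≤ w.len) :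
    (w.take α h0 h1).concat (w.drop hn α h0 h1) = w := by
  refine ZnWord.ext (add_sub_cancel α w.len) (funext fun β => ?_)
  simp only [concat, take, drop]
  split_ifs with h2 h3
  · rfl
  · rw [sub_add_cancel]
  · exact absurd (sub_pos.2 (not_le.1 h2)) h3

theorem concat_right_inj (hn : 1 ≤ n) {u v v' : ZnWord n X} (h : u.concat v = u.concat v') :
    v = v' := by
  have hu := unit_pos hn
  have h1 : u.len + v.len = u.len + v'.len := congrArg ZnWord.len h
  refine ext_of_letter (add_left_cancel h1) fun β hb _ => ?_
  have h2 := congrArg (fun w => ZnWord.letter w (u.len + β)) h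
  rwa [concat_letter_of_lt _ (by grind), concat_letter_of_lt _ (by grind),
    show u.len + β - u.len = β by abel] at h2

theorem take_concat_of_le {u : ZnWord n X} (v : ZnWord n X) {α : Zn n} (h0 : 0 ≤ α)
    (h1 : α ≤ u.len) (h2) : (u.concat v).take α h0 h2 = u.take α h0 h1 := by
  refine ext_of_letter rfl fun β _ hb => ?_
  have hb : β ≤ α := hb
  simp only [take, if_pos hb]
  exact concat_letter_of_le _ (hb.trans h1)

theorem take_len (u : ZnWord n X) (h0 h1) : u.take u.len h0 h1 = u := by
  refine ext_of_letter rfl fun β _ hb => ?_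
  have hb : β ≤ u.len := hb
  simp only [take, if_pos hb]

theorem eq_of_len_eq_zero (hn : 1 ≤ n) {u v : ZnWord n X} (hu : u.len = 0) (hv : v.len = 0) :
    u = v := by
  have := unit_pos hn
  exact ext_of_letter (hu.trans hv.symm) fun β _ _ => by grind

theorem concat_of_len_eq_zero (u : ZnWord n X) {v : ZnWord n X} (hv : v.len = 0) :
    u.concat v = u := by
  refine ext_of_letter (by rw [concat_len, hv, add_zero]) fun β _ hb => ?_
  rw [concat_len, hv, add_zero] at hb
  exact concat_letter_of_le _ hb

/-- Two factorisations of a word have a common refinement. -/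
theorem exists_of_concat_eq (hn : 1 ≤ n) {a b c d : ZnWord n X} (h : a.concat b = c.concat d)
    (hle : a.len ≤ c.len) : ∃ e, c = a.concat e ∧ b = e.concat d := by
  have h0 := a.len_nonneg
  have e1 : a = c.take a.len h0 hle := by
    have h2 : a.len ≤ (a.concat b).len := le_add_of_nonneg_right b.len_nonneg
    rw [← take_concat_of_le d h0 hle (by rw [← h]; exact h2)]
    simp only [← h]
    rw [take_concat_of_le b h0 le_rfl, take_len]
  have e2 : c = a.concat (c.drop hn a.len h0 hle) := by
    rw [← congrArg (fun t => concat t (c.drop hn a.len h0 hle)) e1.symm]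
    exact (take_concat_drop hn c h0 hle).symm
  refine ⟨_, e2, concat_right_inj hn (u := a) ?_⟩
  rw [← concat_assoc, ← e2, h]

theorem IsReduced.inv (hn : 1 ≤ n) {w : ZnWord n X} (h : w.IsReduced) : w.inv.IsReduced := by
  have hu := unit_pos hn
  intro β h1 h2 h3
  rw [inv_len] at h2
  have h4 := unit_le_of_pos (sub_pos.2 h2)
  refine h (w.len - β) (by grind) (by grind) ?_
  simp only [ZnWord.inv] at h3
  rw [show w.len + unit n - (β + unit n) = w.len - β by abel,
    show w.len + unit n - β = w.len - β + unit n by abel] at h3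
  rw [h3, Option.map_map]
  cases w.letter (w.len - β + unit n) <;> simp [letterInv]

theorem IsReduced.of_concat_left {u v : ZnWord n X} (h : (u.concat v).IsReduced) :
    u.IsReduced := by
  have hv := v.len_nonneg
  intro β h1 h2 h3
  have h4 := unit_le_of_pos (sub_pos.2 h2)
  refine h β h1 (by rw [concat_len]; grind) ?_
  rwa [concat_letter_of_le v (by grind), concat_letter_of_le v h2.le]

theorem IsReduced.of_concat_right (hn : 1 ≤ n) {u v : ZnWord n X} (h : (u.concat v).IsReduced) :
    v.IsReduced := by
  have h1 := h.inv hn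
  rw [inv_concat hn] at h1
  have := (h1.of_concat_left).inv hn
  rwa [inv_inv] at this

/-- In a product of non-empty words that is reduced, the last letter of the first factor is not
inverse to the first letter of the second. -/
theorem IsReduced.firstNe (hn : 1 ≤ n) {u v : ZnWord n X} (h : (u.concat v).IsReduced)
    (hu : 0 < u.len) : FirstNe u.inv v := by
  have h0 := unit_pos hn
  intro x h1 h2
  have h3 : unit n ≤ v.len := (v.isSome_iff _ |>.1 (by rw [h2]; rfl)).2
  refine h u.len (unit_le_of_pos hu) (by rw [concat_len]; grind) ?_
  rw [concat_letter_of_le v le_rfl, concat_letter_of_lt v (by grind),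
    show u.len + unit n - u.len = unit n by abel, h2]
  simp only [ZnWord.inv] at h1
  rw [show u.len + unit n - unit n = u.len by abel] at h1
  exact h1.symm

theorem IsReduced.concat (hn : 1 ≤ n) {u v : ZnWord n X} (hu : u.IsReduced) (hv : v.IsReduced)
    (h : FirstNe u.inv v) : (u.concat v).IsReduced := by
  have h0 := unit_pos hn
  intro β h1 h2 h3
  rw [concat_len] at h2
  rcases lt_trichotomy β u.len with hb | hb | hb
  · have := unit_le_of_pos (sub_pos.2 hb)
    rw [concat_letter_of_le v (by grind), concat_letter_of_le v hb.le] at h3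
    exact hu β h1 hb h3
  · subst hb
    rw [concat_letter_of_le v le_rfl, concat_letter_of_lt v (by grind),
      show u.len + unit n - u.len = unit n by abel] at h3
    have h5 : 0 < v.len := by grind
    obtain ⟨x, hx⟩ := Option.isSome_iff_exists.1 ((v.isSome_iff _).2 ⟨le_rfl, unit_le_of_pos h5⟩)
    refine h x ?_ hx
    simp only [ZnWord.inv]
    rw [show u.len + unit n - unit n = u.len by abel, ← h3, hx]
  · have := unit_le_of_pos (sub_pos.2 hb)
    rw [concat_letter_of_lt v hb, concat_letter_of_lt v (by grind),
      show β + unit n - u.len = β - u.len + unit n by abel] at h3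
    exact hv _ this (by grind) h3

theorem FirstNe.symm {u v : ZnWord n X} (h : FirstNe u v) : FirstNe v u :=
  fun x h1 h2 => h x h2 h1

theorem FirstNe.concat_left {u v : ZnWord n X} (h : FirstNe u v) (w : ZnWord n X)
    (hu : 0 < u.len) : FirstNe (u.concat w) v := by
  intro x h1
  rw [concat_letter_of_le w (unit_le_of_pos hu)] at h1
  exact h x h1

theorem FirstNe.of_concat {u v w w' : ZnWord n X} (h : FirstNe (u.concat w) (v.concat w'))
    (hu : 0 < u.len) (hv : 0 < v.len) : FirstNe u v := by
  intro x h1 h2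
  refine h x ?_ ?_
  · rwa [concat_letter_of_le w (unit_le_of_pos hu)]
  · rwa [concat_letter_of_le w' (unit_le_of_pos hv)]

theorem firstNe_of_len_eq_zero (hn : 1 ≤ n) {u : ZnWord n X} (hu : u.len = 0) (v : ZnWord n X) :
    FirstNe u v := by
  have := unit_pos hn
  intro x h1
  have := (u.isSome_iff _ |>.1 (by rw [h1]; rfl)).2
  grind

theorem not_firstNe_concat {e u v : ZnWord n X} (he : 0 < e.len) :
    ¬ FirstNe (e.concat u) (e.concat v) := by
  intro h
  obtain ⟨x, hx⟩ := Option.isSome_iff_exists.1 ((e.isSome_iff _).2 ⟨le_rfl, unit_le_of_pos he⟩)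
  refine h x ?_ ?_ <;> rwa [concat_letter_of_le _ (unit_le_of_pos he)]

/-- If `z` and `a` are the labels of the segments from a base point to `p` and to `q`, then `w` is
the label of the segment from `p` to `q`. -/
def Path (z a w : ZnWord n X) : Prop :=
  ∃ c z' a' : ZnWord n X, z = c.concat z' ∧ a = c.concat a' ∧ FirstNe z' a' ∧
    w = z'.inv.concat a'

theorem isMul_iff_path {u v w : ZnWord n X} : IsMul u v w ↔ Path u.inv v w := Iff.rfl

theorem Path.symm (hn : 1 ≤ n) {z a w : ZnWord n X} (h : Path z a w) : Path a z w.inv := by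
  obtain ⟨c, z', a', h1, h2, h3, rfl⟩ := h
  exact ⟨c, a', z', h2, h1, h3.symm, by rw [inv_concat hn, inv_inv]⟩

theorem path_cases (hn : 1 ≤ n) {c a b c' a' b' : ZnWord n X} (h1 : c.concat a = c'.concat a')
    (h2 : c.concat b = c'.concat b') (h : FirstNe a b) (h' : FirstNe a' b') :
    c = c' ∧ a = a' ∧ b = b' := by
  have key : ∀ {c a b c' a' b' : ZnWord n X}, c.concat a = c'.concat a' →
      c.concat b = c'.concat b' → FirstNe a b → c.len ≤ c'.len → c'.len ≤ c.len := by
    intro c a b c' a' b' h1 h2 h hle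
    obtain ⟨e, he1, he2⟩ := exists_of_concat_eq hn h1 hle
    obtain ⟨e', he1', he2'⟩ := exists_of_concat_eq hn h2 hle
    have : e = e' := concat_right_inj hn (he1.symm.trans he1')
    subst this
    by_contra hlt
    have : 0 < e.len := by
      have : c'.len = c.len + e.len := congrArg ZnWord.len he1
      grind
    rw [he2, he2'] at h
    exact not_firstNe_concat this h
  have hlen : c.len = c'.len := by
    rcases le_total c.len c'.len with hle | hle
    · exact le_antisymm hle (key h1 h2 h hle)
    · exact le_antisymm (key h1.symm h2.symm h' hle) hle
  obtain ⟨e, he1, he2⟩ := exists_of_concat_eq hn h1 hlen.le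
  have he : e.len = 0 := by
    have : c'.len = c.len + e.len := congrArg ZnWord.len he1
    grind
  rw [concat_of_len_eq_zero _ he] at he1
  subst he1
  exact ⟨rfl, concat_right_inj hn h1, concat_right_inj hn h2⟩

theorem Path.unique (hn : 1 ≤ n) {z a w w' : ZnWord n X} (h : Path z a w) (h' : Path z a w') :
    w = w' := by
  obtain ⟨c, z', a', rfl, rfl, h3, rfl⟩ := h
  obtain ⟨d, z'', a'', h1, h2, h4, rfl⟩ := h'
  obtain ⟨-, rfl, rfl⟩ := path_cases hn h1 h2 h3 h4
  rfl

theorem Path.isReduced (hn : 1 ≤ n) {z a w : ZnWord n X} (h : Path z a w) (hz : z.IsReduced)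
    (ha : a.IsReduced) : w.IsReduced := by
  obtain ⟨c, z', a', rfl, rfl, h3, rfl⟩ := h
  refine ((hz.of_concat_right hn).inv hn).concat hn (ha.of_concat_right hn) ?_
  rwa [inv_inv]

/-- Here `a = c a₁` branches off `z` earlier than `b = d b₂`. Seen from the end of `z`, both
segments begin with `z₂⁻¹`, and they part right after it because `b` is reduced where `e` meets
`b₂`. -/
theorem path_of_lt (hn : 1 ≤ n) {c z₁ a₁ d z₂ b₂ w : ZnWord n X}
    (hz : c.concat z₁ = d.concat z₂) (hlt : c.len < d.len)
    (h1 : FirstNe z₁ a₁) (hb : (d.concat b₂).IsReduced)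
    (h3 : Path (c.concat a₁) (d.concat b₂) w) :
    Path (z₁.inv.concat a₁) (z₂.inv.concat b₂) w := by
  obtain ⟨e, rfl, rfl⟩ := exists_of_concat_eq hn hz hlt.le
  have he : 0 < e.len := by rw [concat_len] at hlt; grind
  rw [concat_assoc] at h3 hb
  have hw : w = a₁.inv.concat (e.concat b₂) :=
    h3.unique hn ⟨c, a₁, e.concat b₂, rfl, rfl, by
      intro x hx1 hx2
      rw [concat_letter_of_le _ (unit_le_of_pos he)] at hx2
      refine h1 x ?_ hx1
      rw [concat_letter_of_le _ (unit_le_of_pos he)]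
      exact hx2, rfl⟩
  refine ⟨z₂.inv, e.inv.concat a₁, b₂, by rw [inv_concat hn, concat_assoc], rfl, ?_, ?_⟩
  · exact ((hb.of_concat_right hn).firstNe hn he).concat_left _ he
  · rw [hw, inv_concat hn, inv_inv, concat_assoc]

/-- Changing the base point does not change the label of a segment. -/
theorem Path.rebase (hn : 1 ≤ n) {z a b w₁ w₂ w₃ : ZnWord n X} (ha : a.IsReduced)
    (hb : b.IsReduced) (h1 : Path z a w₁) (h2 : Path z b w₂) (h3 : Path a b w₃) :
    Path w₁ w₂ w₃ := by
  obtain ⟨c, z₁, a₁, rfl, rfl, f1, rfl⟩ := h1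
  obtain ⟨d, z₂, b₂, hz, rfl, f2, rfl⟩ := h2
  rcases lt_trichotomy c.len d.len with hlt | heq | hlt
  · exact path_of_lt hn hz hlt f1 hb h3
  · obtain ⟨e, he1, he2⟩ := exists_of_concat_eq hn hz heq.le
    have he : e.len = 0 := by
      have : d.len = c.len + e.len := congrArg ZnWord.len he1
      grind
    rw [concat_of_len_eq_zero _ he] at he1
    subst he1
    have := concat_right_inj hn hz
    subst this
    obtain ⟨e, a', b', g1, g2, g3, rfl⟩ := h3
    -- Both words leave `z` at the same place, so `d` is an initial segment of what they have in
    -- common.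
    have hle : d.len ≤ e.len := by
      by_contra hlt
      obtain ⟨k, hk1, hk2⟩ := exists_of_concat_eq hn g1.symm (not_le.1 hlt).le
      obtain ⟨k', hk1', hk2'⟩ := exists_of_concat_eq hn g2.symm (not_le.1 hlt).le
      have : k = k' := concat_right_inj hn (hk1.symm.trans hk1')
      subst this
      rw [hk2, hk2'] at g3
      refine not_firstNe_concat ?_ g3
      have : d.len = e.len + k.len := congrArg ZnWord.len hk1
      grind
    obtain ⟨k, rfl, rfl⟩ := exists_of_concat_eq hn g1 hle
    rw [concat_assoc] at g2
    have := concat_right_inj hn g2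
    subst this
    exact ⟨z₁.inv.concat k, a', b', by rw [concat_assoc], by rw [concat_assoc], g3, rfl⟩
  · have := path_of_lt hn hz.symm hlt f2 ha (h3.symm hn)
    have := this.symm hn
    rwa [inv_inv] at this

/-- A reduced word `w` with `|w ∗ w| > |w|` has a cyclic decomposition. -/
theorem isCDR_of_lt (hn : 1 ≤ n) {w w₂ : ZnWord n X} (hw : w.IsReduced) (h : Path w.inv w w₂)
    (hlt : w.len < w₂.len) : w.IsCDR := by
  obtain ⟨c, z, a, h1, h2, h3, rfl⟩ := h
  have e1 : w.len = c.len + z.len := congrArg ZnWord.len h1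
  have e2 : w.len = c.len + a.len := congrArg ZnWord.len h2
  rw [concat_len, inv_len] at hlt
  -- The hypothesis on the lengths means `|c| < |z|`. Hence `c` is a proper initial segment of
  -- `z⁻¹`, and the rest `u` is the cyclically reduced core.
  have hwz : z.inv.concat c.inv = c.concat a := by
    rw [← h2, ← inv_concat hn, ← h1, inv_inv]
  obtain ⟨u, hu1, hu2⟩ := exists_of_concat_eq hn hwz.symm (by rw [inv_len]; grind)
  have e3 : z.len = c.len + u.len := congrArg ZnWord.len hu1
  have hu : 0 < u.len := by grind
  have hzu : z = u.inv.concat c.inv := by rw [← inv_concat hn, ← hu1, inv_inv]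
  have hcw : w = (c.concat u).concat c.inv := by rw [h2, hu2, concat_assoc]
  have hr : (c.concat u).IsReduced := by
    rw [hcw] at hw
    exact hw.of_concat_left
  refine ⟨hw, c.inv, u, (hr.of_concat_left).inv hn, ⟨hr.of_concat_right hn, ?_⟩, ?_⟩
  · intro x hx1 hx2
    rw [hzu, hu2] at h3
    refine h3.of_concat hu hu x ?_ hx1
    simp only [ZnWord.inv]
    rw [show u.len + unit n - unit n = u.len by abel, hx2]
    simp [letterInv]
  · rw [inv_inv, hcw]

theorem IsCDR.of_len_eq_zero (hn : 1 ≤ n) {w : ZnWord n X} (h : w.len = 0) : w.IsCDR := by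
  have h0 := unit_pos hn
  have hr : ∀ {v : ZnWord n X}, v.len = 0 → v.IsReduced := fun h β h1 h2 => by grind
  refine ⟨hr h, w, w, hr h, ⟨hr h, fun x hx => ?_⟩, ?_⟩
  · have := (w.isSome_iff _ |>.1 (by rw [hx]; rfl)).2
    grind
  · exact eq_of_len_eq_zero hn h (by simp [concat_len, inv_len, h])

/-- In a cyclic decomposition `c⁻¹ u c`, the word and its inverse have no longer common initial
segment than `c⁻¹`. -/
theorem IsCDR.exists_ne (hn : 1 ≤ n) {w : ZnWord n X} (h : w.IsCDR) (hw : w.len ≠ 0) :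
    ∃ γ, 0 ≤ γ ∧ 2 • γ < w.len ∧ w.inv.letter (γ + unit n) ≠ w.letter (γ + unit n) := by
  have h0 := unit_pos hn
  obtain ⟨hr, c, u, hc, hu, rfl⟩ := h
  have hc0 := c.len_nonneg
  have hupos : 0 < u.len := by
    refine lt_of_le_of_ne u.len_nonneg fun hu0 => ?_
    have h1 : (c.inv.concat u).concat c = c.inv.concat c := by
      rw [concat_of_len_eq_zero _ hu0.symm]
    rw [h1] at hr hw
    rcases c.len_nonneg.eq_or_lt with h2 | h2
    · exact hw (by rw [concat_len, inv_len, ← h2, add_zero])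
    · have h3 := hr.firstNe hn (by rwa [inv_len])
      rw [inv_inv] at h3
      obtain ⟨x, hx⟩ := Option.isSome_iff_exists.1 ((c.isSome_iff _).2 ⟨le_rfl, unit_le_of_pos h2⟩)
      exact h3 x hx hx
  have h1 := unit_le_of_pos hupos
  -- After the common `c⁻¹`, the word and its inverse continue with the first letters of `u` and of
  -- `u⁻¹`, which differ by cyclic reducedness.
  refine ⟨c.len, hc0, ?_, ?_⟩
  · simp only [concat_len, inv_len]; grind
  · rw [inv_concat hn, inv_concat hn, inv_inv, ← concat_assoc]
    have key : ∀ v : ZnWord n X, v.len = u.len →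
        ((c.inv.concat v).concat c).letter (c.len + unit n) = v.letter (unit n) := by
      intro v hv
      rw [concat_letter_of_le, concat_letter_of_lt, inv_len, add_sub_cancel_left]
      · rw [inv_len]; grind
      · rw [concat_len, inv_len]; grind
    rw [key _ (inv_len u), key _ rfl]
    intro h2
    obtain ⟨x, hx⟩ := Option.isSome_iff_exists.1 ((u.isSome_iff _).2 ⟨le_rfl, h1⟩)
    refine hu.2 x hx ?_
    rw [hx] at h2
    simp only [ZnWord.inv] at h2
    rw [show u.len + unit n - unit n = u.len by abel] at h2
    rw [Option.map_eq_some_iff] at h2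
    obtain ⟨y, hy, hyx⟩ := h2
    rw [hy, ← hyx, letterInv_letterInv]

end ZnWord

end ZnFree

namespace ZnFree

theorem exists_coord {n k : ℕ} (hk : k < n) (j : ℤ) : ∃ α : Zn n, InZ (k + 1) α ∧ coord k α = j := by
  refine ⟨toColex fun i => if i.val = k then j else 0, fun l hl => ?_, ?_⟩
  · unfold coord
    split_ifs
    · exact if_neg (by dsimp only; omega)
    · rfl
  · unfold coord
    rw [dif_pos hk]
    exact if_pos rfl

theorem exists_coord_between {n k : ℕ} (hk : k < n) {γ : Zn n} (hγ : InZ (k + 1) γ) (h0 : 0 ≤ γ)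
    {j : ℤ} (hj : 0 ≤ j) (hjγ : j ≤ coord k γ) : ∃ α, 0 ≤ α ∧ α ≤ γ ∧ coord k α = j := by
  rcases hjγ.eq_or_lt with rfl | hlt
  · exact ⟨γ, h0, le_rfl, rfl⟩
  rcases hj.eq_or_lt with rfl | hpos
  · exact ⟨0, le_rfl, h0, coord_zero k⟩
  obtain ⟨α, h1, h2⟩ := exists_coord hk j
  refine ⟨α, ((InZ.zero _).lt_of_coord_lt h1 ?_).le, (h1.lt_of_coord_lt hγ ?_).le, h2⟩
  · rw [coord_zero, h2]; exact hpos
  · rw [h2]; exact hlt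

namespace ZnWord

variable {n : ℕ} {X : Type*}

theorem take_of_eq_concat {w t e : ZnWord n X} (h : w = t.concat e) {α : Zn n} (hα : t.len = α)
    (h0 h1) : w.take α h0 h1 = t := by
  subst h hα
  rw [take_concat_of_le e h0 le_rfl, take_len]

theorem len_le_of_firstNe (hn : 1 ≤ n) {c a b d a' b' : ZnWord n X}
    (h1 : c.concat a = d.concat a') (h2 : c.concat b = d.concat b') (h : FirstNe a' b') :
    c.len ≤ d.len := by
  by_contra hlt
  obtain ⟨k, hk1, hk2⟩ := exists_of_concat_eq hn h1.symm (not_le.1 hlt).le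
  obtain ⟨k', hk1', hk2'⟩ := exists_of_concat_eq hn h2.symm (not_le.1 hlt).le
  have : k = k' := concat_right_inj hn (hk1.symm.trans hk1')
  subst this
  rw [hk2, hk2'] at h
  refine not_firstNe_concat ?_ h
  have : c.len = d.len + k.len := congrArg ZnWord.len hk1
  grind

theorem Path.of_concat_right (hn : 1 ≤ n) (z e : ZnWord n X) : Path z (z.concat e) e := by
  have h0 : (z.take 0 le_rfl z.len_nonneg).inv.len = 0 := rfl
  refine ⟨z, z.take 0 le_rfl z.len_nonneg, e, (concat_of_len_eq_zero _ rfl).symm, rfl,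
    firstNe_of_len_eq_zero hn rfl _, ?_⟩
  refine concat_right_inj hn (u := (z.take 0 le_rfl z.len_nonneg).inv) ?_
  rw [← concat_assoc, concat_of_len_eq_zero _ h0]

/-- Initial segments of words that have a longest common initial segment have one, too. -/
theorem Path.exists_of_prefix (hn : 1 ≤ n) {z z₂ a a₂ w : ZnWord n X}
    (h : Path (z.concat z₂) (a.concat a₂) w) : ∃ w', Path z a w' := by
  obtain ⟨c, z', a', h1, h2, h3, -⟩ := h
  have key : ∀ {z a : ZnWord n X}, (∃ e, z = a.concat e) → ∃ w', Path z a w' := by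
    rintro _ a ⟨e, rfl⟩
    exact ⟨_, (Path.of_concat_right hn a e).symm hn⟩
  have key' : ∀ {z a : ZnWord n X}, (∃ e, a = z.concat e) → ∃ w', Path z a w' := by
    rintro z _ ⟨e, rfl⟩
    exact ⟨_, Path.of_concat_right hn z e⟩
  rcases le_or_gt z.len c.len with hz | hz
  · obtain ⟨e, rfl, -⟩ := exists_of_concat_eq hn h1 hz
    rw [concat_assoc] at h2
    rcases le_total z.len a.len with hza | hza
    · exact key' ⟨_, (exists_of_concat_eq hn h2.symm hza).choose_spec.1⟩
    · exact key ⟨_, (exists_of_concat_eq hn h2 hza).choose_spec.1⟩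
  · obtain ⟨e, rfl, he⟩ := exists_of_concat_eq hn h1.symm hz.le
    have he0 : 0 < e.len := by rw [concat_len] at hz; grind
    rcases le_or_gt a.len c.len with ha | ha
    · obtain ⟨k, rfl, -⟩ := exists_of_concat_eq hn h2 ha
      exact key ⟨_, concat_assoc _ _ _⟩
    · obtain ⟨k, rfl, hk⟩ := exists_of_concat_eq hn h2.symm ha.le
      have hk0 : 0 < k.len := by rw [concat_len] at ha; grind
      rw [he, hk] at h3
      exact ⟨_, c, e, k, rfl, rfl, h3.of_concat he0 hk0, rfl⟩

end ZnWord

/-! ### Labels in the universal tree, hyperbolicity and unboundedness of the action. -/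

namespace WordGroup

variable {n : ℕ} {X G : Type*} [Group G] (ρ : WordGroup n X G)

open ZnWord

/-- The label of the segment from the root. -/
def label (p : ρ.Tree) : ZnWord n X :=
  Quotient.liftOn p (fun p => (ρ.word p.elt).take p.ht p.ht_nonneg p.ht_le) (by
    intro p q h
    have h3 := ((ρ.le_c_iff _ _ _).1 h.2).2.2
    refine ext_of_letter h.1 fun β _ hb => ?_
    have hb : β ≤ p.ht := hb
    simp only [take, if_pos hb, if_pos (h.1 ▸ hb : β ≤ q.ht)]
    exact h3 β hb)

theorem label_len (p : ρ.Tree) : (ρ.label p).len = ρ.ht p := by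
  induction p using Quotient.inductionOn
  rfl

theorem exists_label (hn : 1 ≤ n) (p : ρ.Tree) :
    ∃ g e, ρ.word g = (ρ.label p).concat e := by
  induction p using Quotient.inductionOn with | _ p
  exact ⟨p.elt, _, (take_concat_drop hn _ p.ht_nonneg p.ht_le).symm⟩

theorem label_isReduced (hn : 1 ≤ n) (p : ρ.Tree) : (ρ.label p).IsReduced := by
  obtain ⟨g, e, h⟩ := ρ.exists_label hn p
  have := (ρ.isCDR g).1
  rw [h] at this
  exact this.of_concat_left

theorem label_smul_root (g : G) : ρ.label (g • ρ.root) = ρ.word g := by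
  rw [smul_root]
  exact take_len (ρ.word g) (ρ.len_nonneg g) le_rfl

theorem exists_path (hn : 1 ≤ n) (p q : ρ.Tree) : ∃ w, Path (ρ.label p) (ρ.label q) w := by
  obtain ⟨f, e, hf⟩ := ρ.exists_label hn p
  obtain ⟨g, e', hg⟩ := ρ.exists_label hn q
  obtain ⟨c, a, b, h1, h2, h3, h4⟩ := ρ.exists_com f g
  have : Path ((ρ.label p).concat e) ((ρ.label q).concat e') (ρ.word (f⁻¹ * g)) :=
    ⟨c, a, b, by rw [← hf, h1], by rw [← hg, h2], h3, h4⟩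
  exact this.exists_of_prefix hn

theorem meet_eq_of_label (hn : 1 ≤ n) {p q : ρ.Tree} {c a b : ZnWord n X}
    (h1 : ρ.label p = c.concat a) (h2 : ρ.label q = c.concat b) (h3 : FirstNe a b) :
    ρ.meet p q = c.len := by
  induction p using Quotient.inductionOn with | _ p
  induction q using Quotient.inductionOn with | _ q
  change (ρ.word p.elt).take p.ht p.ht_nonneg p.ht_le = _ at h1
  change (ρ.word q.elt).take q.ht q.ht_nonneg q.ht_le = _ at h2
  change min (min p.ht q.ht) (ρ.c p.elt q.elt) = _
  have hp : p.ht = c.len + a.len := congrArg ZnWord.len h1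
  have hq : q.ht = c.len + b.len := congrArg ZnWord.len h2
  have ha := a.len_nonneg
  have hb := b.len_nonneg
  refine le_antisymm ?_ (le_min (le_min (by grind) (by grind)) ?_)
  · set m := min (min p.ht q.ht) (ρ.c p.elt q.elt) with hm
    have hm0 : 0 ≤ m := le_min (le_min p.ht_nonneg q.ht_nonneg) (ρ.c_nonneg _ _)
    have hm1 : m ≤ p.ht := (min_le_left _ _).trans (min_le_left _ _)
    have hm2 : m ≤ q.ht := (min_le_left _ _).trans (min_le_right _ _)
    have h := ((ρ.le_c_iff p.elt q.elt m).1 (min_le_right _ _)).2.2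
    have e1 := take_concat_drop hn ((ρ.word p.elt).take p.ht p.ht_nonneg p.ht_le) hm0 hm1
    have e2 := take_concat_drop hn ((ρ.word q.elt).take q.ht q.ht_nonneg q.ht_le) hm0 hm2
    have e3 : ((ρ.word p.elt).take p.ht p.ht_nonneg p.ht_le).take m hm0 hm1 =
        ((ρ.word q.elt).take q.ht q.ht_nonneg q.ht_le).take m hm0 hm2 := by
      refine ext_of_letter rfl fun β _ hb => ?_
      have hb : β ≤ m := hb
      simp only [take, if_pos hb, if_pos (hb.trans hm1), if_pos (hb.trans hm2)]
      exact h β hb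
    rw [e3] at e1
    exact len_le_of_firstNe hn (e1.trans h1) (e2.trans h2) h3
  · refine (ρ.le_c_iff _ _ _).2 ⟨?_, ?_, fun β hβ => ?_⟩
    · have := p.ht_le; grind
    · have := q.ht_le; grind
    · have e1 := congrArg (fun w => ZnWord.letter w β) h1
      have e2 := congrArg (fun w => ZnWord.letter w β) h2
      rw [concat_letter_of_le _ hβ] at e1 e2
      simp only [take, if_pos (show β ≤ p.ht by grind)] at e1
      simp only [take, if_pos (show β ≤ q.ht by grind)] at e2
      rw [e1, e2]

theorem path_len (hn : 1 ≤ n) {p q : ρ.Tree} {w : ZnWord n X}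
    (h : Path (ρ.label p) (ρ.label q) w) : w.len = ρ.dist p q := by
  obtain ⟨c, a, b, h1, h2, h3, rfl⟩ := h
  have e1 : ρ.ht p = c.len + a.len := by rw [← label_len, h1]; rfl
  have e2 : ρ.ht q = c.len + b.len := by rw [← label_len, h2]; rfl
  rw [dist_eq, ρ.meet_eq_of_label hn h1 h2 h3, e1, e2, concat_len, inv_len]
  abel

/-- The segments from `g⁻¹ • root` to `p` and from the root to `g • p` carry the same label. This is
invariance of labels for segments starting at an orbit point; `Path.rebase` extends it to all
segments. The two cases are those in the definition of `preAct`. -/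
theorem path_word_inv (hn : 1 ≤ n) (g : G) (p : ρ.Tree) :
    Path (ρ.word g⁻¹) (ρ.label p) (ρ.label (g • p)) := by
  induction p using Quotient.inductionOn with | _ p
  obtain ⟨α, f, h0, h1⟩ := p
  obtain ⟨z, a, e1, e2, e3, e4⟩ := (ρ.exists_com g⁻¹ f).choose_spec
  change ρ.word g⁻¹ = (ρ.com g⁻¹ f).concat z at e1
  change ρ.word f = (ρ.com g⁻¹ f).concat a at e2
  have hc : ρ.c g⁻¹ f = (ρ.com g⁻¹ f).len := rfl
  rw [_root_.inv_inv] at e4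
  have l1 : ρ.len g = (ρ.com g⁻¹ f).len + z.len := by
    rw [← ρ.len_inv]; exact congrArg ZnWord.len e1
  have l2 : ρ.len f = (ρ.com g⁻¹ f).len + a.len := congrArg ZnWord.len e2
  generalize ρ.com g⁻¹ f = c at *
  change Path _ ((ρ.word f).take α h0 h1) ((ρ.word (ρ.preAct g ⟨α, f, h0, h1⟩).elt).take
    (ρ.preAct g ⟨α, f, h0, h1⟩).ht (ρ.preAct g ⟨α, f, h0, h1⟩).ht_nonneg
    (ρ.preAct g ⟨α, f, h0, h1⟩).ht_le)
  by_cases h : α ≤ ρ.c g⁻¹ f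
  · have hac : α ≤ c.len := by rwa [← hc]
    have hE := take_concat_drop hn c h0 hac
    set t := c.take α h0 hac
    set e := c.drop hn α h0 hac
    have ht : t.len = α := rfl
    have hte : t.len + e.len = c.len := congrArg ZnWord.len hE
    have k1 : (ρ.word f).take α h0 h1 = t :=
      take_of_eq_concat (e := e.concat a) (by rw [e2, ← hE, concat_assoc]) ht _ _
    have k2 : ρ.word g = (e.concat z).inv.concat t.inv := by
      rw [← inv_concat hn, ← concat_assoc, hE, ← e1, ρ.word_inv, ZnWord.inv_inv]
    have k3 : ∀ h2 h3, (ρ.word g).take (ρ.len g - α) h2 h3 = (e.concat z).inv :=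
      take_of_eq_concat k2 (by rw [inv_len, concat_len]; grind)
    unfold preAct
    simp only [h, dif_pos]
    rw [k1, k3, e1, ← hE, concat_assoc]
    have := (Path.of_concat_right hn t (e.concat z)).symm hn
    exact this
  · have hac : c.len ≤ α := by rw [← hc]; exact (not_le.1 h).le
    have h2 : 0 ≤ α - c.len := sub_nonneg.2 hac
    have h3 : α - c.len ≤ a.len := by have : α ≤ ρ.len f := h1; grind
    have hE := take_concat_drop hn a h2 h3
    set t := a.take (α - c.len) h2 h3
    set e := a.drop hn (α - c.len) h2 h3
    have ht : t.len = α - c.len := rfl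
    have k1 : (ρ.word f).take α h0 h1 = c.concat t :=
      take_of_eq_concat (e := e) (by rw [e2, ← hE, concat_assoc]) (by rw [concat_len, ht]; abel) _ _
    have k3 : ∀ h2 h3, (ρ.word (g * f)).take (ρ.len g + α - 2 • ρ.c g⁻¹ f) h2 h3 =
        z.inv.concat t :=
      take_of_eq_concat (e := e) (by rw [e4, ← hE, concat_assoc])
        (by rw [concat_len, ht, hc, inv_len]; grind)
    unfold preAct
    simp only [h, dif_neg, not_false_eq_true]
    rw [k1, k3, e1]
    refine ⟨c, z, t, rfl, rfl, ?_, rfl⟩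
    intro x hx1 hx2
    have ht0 : unit n ≤ t.len := (t.isSome_iff _ |>.1 (by rw [hx2]; rfl)).2
    refine e3 x hx1 ?_
    rw [← hE, concat_letter_of_le _ ht0, hx2]

theorem path_smul (hn : 1 ≤ n) (g : G) {p q : ρ.Tree} {w : ZnWord n X}
    (h : Path (ρ.label p) (ρ.label q) w) : Path (ρ.label (g • p)) (ρ.label (g • q)) w :=
  Path.rebase hn (ρ.label_isReduced hn p) (ρ.label_isReduced hn q) (ρ.path_word_inv hn g p)
    (ρ.path_word_inv hn g q) h

/-! ### Hyperbolicity -/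

theorem len_eq_zero (hn : 1 ≤ n) {g : G} (h : ρ.len g = 0) : g = 1 :=
  ρ.injective (eq_of_len_eq_zero hn h ρ.word_one_len)

/-- The cyclic decomposition limits the common initial segment of `g` and `g⁻¹` to the conjugating
part, which fills less than half of `g`. So `g` has an axis. -/
theorem two_c_lt (hn : 1 ≤ n) {g : G} (hg : g ≠ 1) : 2 • ρ.c g⁻¹ g < ρ.len g := by
  obtain ⟨γ, h0, h1, h2⟩ := (ρ.isCDR g).exists_ne hn fun h => hg (ρ.len_eq_zero hn h)
  have hu := unit_pos hn
  rw [← ρ.word_inv] at h2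
  have : ρ.c g⁻¹ g < γ + unit n := by
    by_contra h
    exact h2 (((ρ.le_c_iff _ _ _).1 (not_lt.1 h)).2.2 _ le_rfl)
  have h3 : ρ.c g⁻¹ g ≤ γ := by
    by_contra h
    have := unit_le_of_pos (sub_pos.2 (not_le.1 h))
    grind
  have h1 : 2 • γ < ρ.len g := h1
  grind

/-- The axis of a non-trivial element. -/
theorem exists_axis (hn : 1 ≤ n) {g : G} (hg : g ≠ 1) : ∃ p : ρ.Tree,
    ρ.dist ρ.root p = ρ.c g⁻¹ g ∧ ρ.dist p (g • ρ.root) = ρ.len g - ρ.c g⁻¹ g ∧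
    0 < ρ.dist p (g • p) ∧ ρ.dist p (g • g • p) = 2 • ρ.dist p (g • p) := by
  have h1 := ρ.two_c_lt hn hg
  have h2 := ρ.c_nonneg g⁻¹ g
  have h3 := ρ.c_add_c g⁻¹ g
  rw [_root_.inv_inv, ρ.len_inv] at h3
  -- The point where the segments from the root to `g • root` and to `g⁻¹ • root` part lies on the
  -- axis of `g`.
  obtain ⟨p, hp1, hp2⟩ := ρ.exists_seg ρ.root (g • ρ.root) h2
    (by rw [dist_root_smul_root]; grind)
  rw [dist_root_smul_root] at hp2
  have hm : ρ.meet p (g⁻¹ • ρ.root) = ρ.c g⁻¹ g := by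
    have m1 : ρ.meet (g • ρ.root) (g⁻¹ • ρ.root) = ρ.c g⁻¹ g := by
      have := ρ.dist_eq (g • ρ.root) (g⁻¹ • ρ.root)
      rw [← ρ.dist_smul g, smul_inv_smul, smul_smul, ρ.dist_comm, dist_root_smul_root,
        ht_smul_root, ht_smul_root, ρ.len_inv] at this
      exact two_nsmul_cancel (by grind)
    have m2 : ρ.meet p (g • ρ.root) = ρ.c g⁻¹ g := by
      have := ρ.dist_eq p (g • ρ.root)
      rw [hp2, ht_smul_root, ← dist_root, hp1] at this
      exact two_nsmul_cancel (by grind)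
    have m3 := ρ.meet_ultra p (g • ρ.root) (g⁻¹ • ρ.root)
    have m4 := ρ.meet_le_left p (g⁻¹ • ρ.root)
    rw [m1, m2, min_self] at m3
    rw [← dist_root, hp1] at m4
    exact le_antisymm m4 m3
  have hp3 : ρ.dist ρ.root (g • p) = ρ.len g - ρ.c g⁻¹ g := by
    rw [← ρ.dist_smul g⁻¹, inv_smul_smul, ρ.dist_comm, dist_eq, hm, ht_smul_root, ← dist_root,
      hp1, ρ.len_inv]
    grind
  have hp4 : ρ.dist (g • ρ.root) (g • p) = ρ.c g⁻¹ g := by rw [dist_smul, hp1]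
  have k1 := ρ.four_point ρ.root (g • ρ.root) p (g • p)
  rw [dist_root_smul_root, hp1, hp4, hp3, ρ.dist_comm _ p, hp2] at k1
  have k2 := ρ.dist_triangle p (g • g • p) (g • p)
  rw [ρ.dist_smul] at k2
  have k3 := ρ.dist_triangle ρ.root (g • g • ρ.root) p
  have k4 := ρ.dist_triangle p (g • g • ρ.root) (g • g • p)
  rw [smul_smul, dist_root_smul_root, hp1, ← smul_smul] at k3
  rw [ρ.dist_smul, ρ.dist_smul, ρ.dist_comm p ρ.root, hp1] at k4
  have k5 := ρ.dist_triangle ρ.root (g • ρ.root) p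
  have k6 := ρ.dist_triangle p (g • ρ.root) (g • p)
  rw [dist_root_smul_root, hp1] at k5
  rw [ρ.dist_comm (g • p), hp4] at k6
  have e1 : ρ.dist p (g • p) = ρ.len g - 2 • ρ.c g⁻¹ g := by
    rcases k1 with k1 | k1 <;> grind
  refine ⟨p, hp1, hp2, by rw [e1]; grind, ?_⟩
  rw [e1] at *
  grind

/-- As `g • p` lies between `p` and `g • g • p`, one of these two is farther from `x` by the full
translation length. -/
theorem axis_max {g : G} {p : ρ.Tree} (h : ρ.dist p (g • g • p) = 2 • ρ.dist p (g • p))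
    (x : ρ.Tree) : ρ.dist x (g • p) + ρ.dist p (g • p) ≤ ρ.dist x p ∨
      ρ.dist x (g • p) + ρ.dist p (g • p) ≤ ρ.dist x (g • g • p) := by
  have := ρ.four_point x (g • p) p (g • g • p)
  rw [ρ.dist_smul, h, ρ.dist_comm (g • p) p] at this
  rcases this with h | h
  · left; grind
  · right; grind

/-- Every non-trivial element is hyperbolic. -/
theorem dist_smul_lt (hn : 1 ≤ n) {g : G} (hg : g ≠ 1) (x : ρ.Tree) :
    ρ.dist x (g • x) < ρ.dist x (g • g • x) := by
  obtain ⟨p, -, -, h1, h2⟩ := ρ.exists_axis hn hg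
  by_contra hle
  rw [not_lt] at hle
  -- If the claim fails, the four-point condition restricts the distances from `x` to three
  -- consecutive translates of any point `q`. Applied to two consecutive points of the axis, this
  -- contradicts `axis_max`.
  have key : ∀ q : ρ.Tree, ∃ a b c : Zn n, a = ρ.dist x q ∧ b = ρ.dist x (g • q) ∧
      c = ρ.dist x (g • g • q) ∧ (c ≤ a ∨ c ≤ b) ∧ (a ≤ b ∨ a ≤ c) := by
    intro q
    refine ⟨_, _, _, rfl, rfl, rfl, ?_⟩
    have e1 : ρ.dist (g • x) (g • g • q) = ρ.dist x (g • q) := ρ.dist_smul _ _ _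
    have e2 : ρ.dist (g • g • x) (g • g • q) = ρ.dist x q := by rw [ρ.dist_smul, ρ.dist_smul]
    have e3 : ρ.dist (g • x) (g • g • x) = ρ.dist x (g • x) := ρ.dist_smul _ _ _
    have f1 := ρ.four_point x (g • g • q) (g • x) (g • g • x)
    have f2 := ρ.four_point (g • g • x) (g • g • q) x (g • x)
    rw [e3, ρ.dist_comm (g • g • q), ρ.dist_comm (g • g • q), e1, e2] at f1
    rw [e2, ρ.dist_comm (g • g • q), ρ.dist_comm (g • g • q), e1, ρ.dist_comm (g • g • x),
      ρ.dist_comm (g • g • x), e3] at f2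
    constructor
    · rcases f1 with h | h
      · left; grind
      · right; grind
    · rcases f2 with h | h
      · left; grind
      · right; grind
  obtain ⟨a, b, c, ha, hb, hc, k1, k2⟩ := key p
  obtain ⟨b', c', d, hb', hc', hd, k3, k4⟩ := key (g • p)
  have h3 := ρ.axis_max h2 x
  have h4 := ρ.axis_max (g := g) (p := g • p)
    (by rw [ρ.dist_smul, ρ.dist_smul, h2]) x
  rw [ρ.dist_smul] at h4
  rw [← ha, ← hb, ← hc] at h3
  rw [← hc, ← hb, ← hd] at h4
  obtain rfl : b' = b := hb'.trans hb.symm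
  obtain rfl : c' = c := hc'.trans hc.symm
  generalize ρ.dist p (g • p) = ℓ at *
  clear ha hb hc hb' hc' hd hle h2 key
  rcases k1 with k1 | k1 <;> rcases k2 with k2 | k2 <;> rcases k3 with k3 | k3 <;>
    rcases k4 with k4 | k4 <;> rcases h3 with h3 | h3 <;> rcases h4 with h4 | h4 <;> grind

theorem smul_ne (hn : 1 ≤ n) {g : G} (hg : g ≠ 1) (x : ρ.Tree) : g • x ≠ x := by
  intro h
  have := ρ.dist_smul_lt hn hg x
  rw [h, h] at this
  exact lt_irrefl _ this

theorem smul_injective (hn : 1 ≤ n) {g h : G} {x : ρ.Tree} (e : g • x = h • x) : g = h := by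
  by_contra hne
  refine ρ.smul_ne hn (g := h⁻¹ * g) (fun h' => hne ?_) x ?_
  · rw [inv_mul_eq_one] at h'
    exact h'.symm
  · rw [mul_smul, e, inv_smul_smul]

/-! ### Unboundedness -/

/-- If the top coordinates of lengths were bounded with maximum `M`, attained at `g₀`, then the
midpoint `x` of the segment to `g₀ • root` would be a centre of the orbit of the root, so each `g`
would move `x` by an element of `ℤⁿ⁻¹`. Labels read from `x` then conjugate `G` into `CDR(ℤⁿ⁻¹, X)`,
against irreducibility. -/
theorem exists_len_ge (hn : 1 ≤ n) (hρ : ρ.IsIrreducible) (m : ℤ) : ∃ g, m ≤ top (ρ.len g) := by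
  by_contra hb
  push Not at hb
  obtain ⟨M, ⟨g₀, hg₀⟩, hM⟩ := Int.exists_greatest_of_bdd (P := fun z => ∃ g, top (ρ.len g) = z)
    ⟨m, fun z ⟨g, hg⟩ => hg ▸ (hb g).le⟩ ⟨_, 1, rfl⟩
  replace hM : ∀ g, top (ρ.len g) ≤ M := fun g => hM _ ⟨g, rfl⟩
  obtain ⟨x, hx1, hx2⟩ : ∃ x, 2 * top (ρ.dist ρ.root x) = M ∧
      2 * top (ρ.dist x (g₀ • ρ.root)) = M := by
    by_cases h : g₀ = 1
    · subst h
      rw [ρ.len_one, top_zero] at hg₀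
      refine ⟨ρ.root, ?_, ?_⟩ <;> simp [dist_self, top_zero, ← hg₀]
    -- The overlap of `g₀⁻¹` and `g₀` is at most half of `M` by `two_c_lt`, and at least half of it
    -- since `g₀ * g₀` is not longer than `M`. So the first point of the axis is a midpoint in the
    -- top coordinate.
    · obtain ⟨p, h1, h2, -⟩ := ρ.exists_axis hn h
      have h3 := top_mono (ρ.two_c_lt hn h).le
      have h4 := congrArg top (ρ.c_add_c g₀⁻¹ g₀)
      rw [_root_.inv_inv, ρ.len_inv, top_add, top_add, top_add] at h4
      rw [top_two_nsmul] at h3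
      have h5 := hM (g₀ * g₀)
      refine ⟨p, ?_, ?_⟩
      · rw [h1]; omega
      · rw [h2, top_sub]; omega
  have hr : top (ρ.dist ρ.root (g₀ • ρ.root)) = M := by rw [dist_root_smul_root, hg₀]
  -- A point within `M` of both ends of a segment of length `M` is within `M / 2` of the midpoint.
  have hfar : ∀ g : G, 2 * top (ρ.dist x (g • ρ.root)) ≤ M := by
    intro g
    have h1 := hM g
    have h2 := hM (g₀⁻¹ * g)
    rw [← dist_root_smul_root, mul_smul, ← ρ.dist_smul g₀, smul_inv_smul] at h2
    rw [← dist_root_smul_root] at h1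
    have h3 := ρ.four_point x (g • ρ.root) ρ.root (g₀ • ρ.root)
    rw [ρ.dist_comm x ρ.root, ρ.dist_comm (g • ρ.root), ρ.dist_comm (g • ρ.root)] at h3
    rcases h3 with h3 | h3 <;> replace h3 := top_mono h3 <;> rw [top_add, top_add] at h3 <;> omega
  -- The point `g • x` is a centre as well, and the centre is unique in the top coordinate.
  have hdist : ∀ g : G, top (ρ.dist x (g • x)) = 0 := by
    intro g
    have h0 := top_mono (ρ.dist_nonneg x (g • x))
    rw [top_zero] at h0
    have h1 := hfar g₀
    have h2 : ∀ f : G, 2 * top (ρ.dist (g • x) (f • ρ.root)) ≤ M := by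
      intro f
      rw [← ρ.dist_smul g⁻¹, inv_smul_smul, smul_smul]
      exact hfar _
    have h3 := h2 1
    have h4 := h2 g₀
    rw [one_smul] at h3
    have h5 := ρ.four_point x (g • x) ρ.root (g₀ • ρ.root)
    rw [ρ.dist_comm x ρ.root] at h5
    rcases h5 with h5 | h5 <;> replace h5 := top_mono h5 <;> rw [top_add, top_add] at h5 <;> omega
  -- The label from `x` to `g • x` is the conjugate of `g` by the label of `x`.
  choose σ hσ using fun g : G => ρ.exists_path hn x (g • x)
  have hlen : ∀ g, (σ g).len = ρ.dist x (g • x) := fun g => ρ.path_len hn (hσ g)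
  have hinv : ∀ g, σ g⁻¹ = (σ g).inv := by
    intro g
    have h1 := ρ.path_smul hn g⁻¹ ((hσ g).symm hn)
    rw [inv_smul_smul] at h1
    exact (hσ g⁻¹).unique hn h1
  have hmul : ∀ g h, (σ g).IsMul (σ h) (σ (g * h)) := by
    intro g h
    rw [isMul_iff_path, ← hinv]
    have h1 := ρ.path_smul hn g⁻¹ (hσ (g * h))
    rw [mul_smul, inv_smul_smul] at h1
    exact Path.rebase hn (ρ.label_isReduced hn _) (ρ.label_isReduced hn _) (hσ _) (hσ _) h1
  refine hρ ⟨n - 1, by omega, ⟨σ, ?_, ?_, ?_, hinv, hmul⟩, ?_, ρ.label x,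
    ρ.label_isReduced hn x, fun g => ?_⟩
  · intro g h e
    obtain ⟨w, hw⟩ := ρ.exists_path hn (g • x) (h • x)
    have h1 := Path.rebase hn (ρ.label_isReduced hn _) (ρ.label_isReduced hn _) (hσ g) (hσ h) hw
    rw [e] at h1
    have h2 : w.len = 0 := by
      have h3 := Path.of_concat_right hn (σ h) ((σ h).take 0 le_rfl (σ h).len_nonneg)
      rw [concat_of_len_eq_zero _ rfl] at h3
      rw [h1.unique hn h3]
      rfl
    rw [ρ.path_len hn hw] at h2
    exact ρ.smul_injective hn (ρ.eq_of_dist_eq_zero h2)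
  · intro g
    by_cases hg : g = 1
    · refine IsCDR.of_len_eq_zero hn ?_
      rw [hlen, hg, one_smul, dist_self]
    · refine isCDR_of_lt hn ((hσ g).isReduced hn (ρ.label_isReduced hn _) (ρ.label_isReduced hn _))
        (isMul_iff_path.1 (hmul g g)) ?_
      rw [hlen, hlen, mul_smul]
      exact ρ.dist_smul_lt hn hg x
  · rw [hlen, one_smul, dist_self]
  · intro g
    change InZ _ (σ g).len
    rw [hlen]
    exact inZ_of_top_eq_zero (hdist g)
  · obtain ⟨w, hw⟩ := ρ.exists_path hn x (g • ρ.root)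
    rw [label_smul_root] at hw
    refine ⟨w, ?_, ?_⟩
    · rwa [isMul_iff_path, ZnWord.inv_inv]
    · have h1 := ρ.path_word_inv hn g⁻¹ (g • x)
      rw [_root_.inv_inv, inv_smul_smul] at h1
      exact Path.rebase hn (ρ.label_isReduced hn _) (ρ.label_isReduced hn _) (hw.symm hn) h1 (hσ g)

/-- The universal tree with its top coordinate distance. -/
def intTree (hn : 1 ≤ n) (hρ : ρ.IsIrreducible) : IntTree G ρ.Tree where
  δ v w := top (ρ.dist v w)
  base := ρ.root
  self v := by rw [dist_self, top_zero]
  comm v w := by rw [ρ.dist_comm]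
  smul g v w := by rw [ρ.dist_smul]
  four x y z w := by
    rcases ρ.four_point x y z w with h | h <;> replace h := top_mono h <;>
      rw [top_add, top_add] at h
    · exact Or.inl h
    · exact Or.inr h
  even x y z := by
    obtain ⟨e, he⟩ := ρ.dist_even x y z
    refine ⟨top e, ?_⟩
    rw [← top_two_nsmul, ← he, top_add, top_add]
  seg x y j h0 h1 := by
    obtain ⟨t, ht0, ht1, ht⟩ := exists_coord_between (by omega : n - 1 < n) (inZ_top_pred _)
      (ρ.dist_nonneg x y) h0 h1
    obtain ⟨z, hz1, hz2⟩ := ρ.exists_seg x y ht0 ht1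
    refine ⟨z, ?_, ?_⟩
    · rw [hz1]; exact ht
    · rw [hz2, top_sub]; exact congrArg _ ht
  unbounded m := by
    obtain ⟨g, hg⟩ := ρ.exists_len_ge hn hρ m
    exact ⟨g, by rwa [dist_root_smul_root]⟩
  span w := by
    obtain ⟨g, hg⟩ := ρ.exists_mem_seg_root w
    exact ⟨g, by rw [← top_add, show _ + _ = _ from hg]⟩

end WordGroup

end ZnFree

namespace ZnFree

/-! ### Busemann cocycles and infinite orbits of ends. -/

namespace IntTree

variable {G V : Type*} [Group G] [MulAction G V] (T : IntTree G V)

/-- The vertices that converge to `s`. -/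
def toward (s : Ori V) : Filter V := comap T.ori (𝓝 s)

theorem eventually_toward (s : Ori V) (p : V × V) : ∀ᶠ u in T.toward s, T.ori u p = s p := by
  have : {s' : Ori V | s' p = s p} ∈ 𝓝 s :=
    (((isOpen_discrete {s p}).preimage
      (continuous_apply (A := fun _ : V × V => Bool) p))).mem_nhds rfl
  exact preimage_mem_comap this

theorem eventually_btw {s : Ori V} {w v : V} (h : s (w, v) = true) :
    ∀ᶠ u in T.toward s, T.Btw w v u := by
  filter_upwards [T.eventually_toward s (w, v)] with u hu
  rwa [h, ori_eq_true] at hu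

theorem toward_neBot {s : Ori V} (hs : s ∈ T.K) : (T.toward s).NeBot := by
  rw [toward, comap_neBot_iff]
  intro t ht
  have ht' : t ∈ Filter.pi fun p => 𝓝 (s p) := (nhds_pi (A := fun _ : V × V => Bool)).ge ht
  obtain ⟨I, t', h1, h2⟩ := Filter.mem_pi'.1 ht'
  obtain ⟨u, hu⟩ := hs I
  refine ⟨u, h2 fun p hp => ?_⟩
  rw [← hu p hp]
  exact mem_of_mem_nhds (h1 p)

theorem tendsto_smul_toward (g : G) (s : Ori V) :
    Tendsto (fun u => g • u) (T.toward s) (T.toward (g • s)) := by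
  refine tendsto_comap_iff.2 ?_
  have : T.ori ∘ (fun u => g • u) = (fun s => g • s) ∘ T.ori := by
    funext u
    exact (T.smul_ori g u).symm
  rw [this]
  exact ((Ori.continuous_smul g).tendsto s).comp tendsto_comap

end IntTree

namespace WordGroup

variable {n : ℕ} {X G : Type*} [Group G] (ρ : WordGroup n X G)

/-- The distance in the top coordinate. -/
def δ (v w : ρ.Tree) : ℤ := top (ρ.dist v w)

theorem δ_comm (v w : ρ.Tree) : ρ.δ v w = ρ.δ w v := by unfold δ; rw [ρ.dist_comm]

theorem δ_tri (x y z : ρ.Tree) : ρ.δ x y ≤ ρ.δ x z + ρ.δ z y := by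
  have := top_mono (ρ.dist_triangle x y z)
  rwa [top_add] at this

/-- Vertices behind `v` share the segment from `o` even in the full metric, as long as one stays
strictly before `v` in the top coordinate; inside the subtree of `v` the segments may already have
parted. -/
theorem mem_seg_of_btw {o v u u₀ x : ρ.Tree} (h : ρ.δ o v + ρ.δ v u = ρ.δ o u)
    (h₀ : ρ.δ o v + ρ.δ v u₀ = ρ.δ o u₀) (hx : x ∈ ρ.seg o u₀) (hlt : ρ.δ o x < ρ.δ o v) :
    x ∈ ρ.seg o u := by
  change ρ.dist o x + ρ.dist x u₀ = ρ.dist o u₀ at hx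
  change ρ.dist o x + ρ.dist x u = ρ.dist o u
  refine le_antisymm ?_ (ρ.dist_triangle _ _ _)
  rcases ρ.four_point x u o u₀ with h1 | h1
  · have h2 := top_mono h1
    have h3 := congrArg top hx
    rw [top_add, top_add] at h2
    rw [top_add] at h3
    have h4 := ρ.δ_tri u u₀ v
    have h5 := ρ.δ_tri o u x
    have h6 := ρ.δ_comm x o
    have h7 := ρ.δ_comm u v
    unfold δ at *
    omega
  · rw [ρ.dist_comm u o] at h1
    grind

theorem mem_seg_rebase {o b u x : ρ.Tree} (hx : x ∈ ρ.seg o u) (hlt : ρ.δ o b < ρ.δ o x) :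
    x ∈ ρ.seg b u := by
  change ρ.dist o x + ρ.dist x u = ρ.dist o u at hx
  change ρ.dist b x + ρ.dist x u = ρ.dist b u
  refine le_antisymm ?_ (ρ.dist_triangle _ _ _)
  rcases ρ.four_point b x o u with h1 | h1
  · have h2 := top_mono h1
    have h3 := congrArg top hx
    rw [top_add, top_add] at h2
    rw [top_add] at h3
    have h5 := ρ.δ_tri o x b
    have h6 := ρ.δ_comm b o
    unfold δ at *
    omega
  · rw [ρ.dist_comm x o] at h1
    grind

section Busemann

variable (hn : 1 ≤ n) (hρ : ρ.IsIrreducible)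

/-- The difference of distances is constant as soon as `u` lies behind a vertex of the end that is
deeper than `v` and `w` together. -/
theorem exists_busemann {s : Ori ρ.Tree} (hs : s ∈ (ρ.intTree hn hρ).E) (v w : ρ.Tree) :
    ∃ b, ∀ᶠ u in (ρ.intTree hn hρ).toward s, ρ.dist v u - ρ.dist w u = b := by
  have hne := (ρ.intTree hn hρ).toward_neBot hs.1
  obtain ⟨a, ha, hsa⟩ := hs.2 (ρ.δ ρ.root v + ρ.δ ρ.root w + 1).toNat
  have hev := (ρ.intTree hn hρ).eventually_btw hsa
  obtain ⟨u₀, hu₀⟩ := hev.exists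
  refine ⟨ρ.dist v u₀ - ρ.dist w u₀, ?_⟩
  filter_upwards [hev] with u hu
  replace ha : ρ.δ ρ.root v + ρ.δ ρ.root w + 1 ≤ ρ.δ ρ.root a := (Int.self_le_toNat _).trans ha
  change ρ.δ ρ.root a + ρ.δ a u = ρ.δ ρ.root u at hu
  change ρ.δ ρ.root a + ρ.δ a u₀ = ρ.δ ρ.root u₀ at hu₀
  have h1 := ρ.δ_tri v w ρ.root
  have h2 := ρ.δ_tri u u₀ a
  have h3 := ρ.δ_tri ρ.root u v
  have h4 := ρ.δ_tri ρ.root u₀ w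
  have h5 := ρ.δ_tri ρ.root u₀ v
  have h6 := ρ.δ_tri ρ.root u w
  have h7 := ρ.δ_comm v ρ.root
  have h8 := ρ.δ_comm u a
  have f1 := ρ.four_point v u w u₀
  have f2 := ρ.four_point v u₀ w u
  rw [ρ.dist_comm u₀ u] at f2
  rw [ρ.dist_comm u w] at f1
  rw [ρ.dist_comm u₀ w] at f2
  have g1 : ρ.dist v u + ρ.dist w u₀ ≤ ρ.dist v u₀ + ρ.dist w u := by
    rcases f1 with f1 | f1
    · replace f1 := top_mono f1
      rw [top_add, top_add] at f1
      unfold δ at *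
      omega
    · exact f1
  have g2 : ρ.dist v u₀ + ρ.dist w u ≤ ρ.dist v u + ρ.dist w u₀ := by
    rcases f2 with f2 | f2
    · replace f2 := top_mono f2
      rw [top_add, top_add] at f2
      unfold δ at *
      omega
    · exact f2
  grind

/-- The Busemann cocycle of an end. -/
def busemann {s : Ori ρ.Tree} (hs : s ∈ (ρ.intTree hn hρ).E) (v w : ρ.Tree) : Zn n :=
  (ρ.exists_busemann hn hρ hs v w).choose

theorem eventually_busemann {s : Ori ρ.Tree} (hs : s ∈ (ρ.intTree hn hρ).E) (v w : ρ.Tree) :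
    ∀ᶠ u in (ρ.intTree hn hρ).toward s, ρ.dist v u - ρ.dist w u = ρ.busemann hn hρ hs v w :=
  (ρ.exists_busemann hn hρ hs v w).choose_spec

theorem busemann_add {s : Ori ρ.Tree} (hs : s ∈ (ρ.intTree hn hρ).E) (v w x : ρ.Tree) :
    ρ.busemann hn hρ hs v w + ρ.busemann hn hρ hs w x = ρ.busemann hn hρ hs v x := by
  have hne := (ρ.intTree hn hρ).toward_neBot hs.1
  obtain ⟨u, ⟨h1, h2⟩, h3⟩ := ((ρ.eventually_busemann hn hρ hs v w).and
    (ρ.eventually_busemann hn hρ hs w x) |>.and (ρ.eventually_busemann hn hρ hs v x)).exists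
  rw [← h1, ← h2, ← h3]
  abel

theorem busemann_le {s : Ori ρ.Tree} (hs : s ∈ (ρ.intTree hn hρ).E) (v w : ρ.Tree) :
    |ρ.busemann hn hρ hs v w| ≤ ρ.dist v w := by
  have hne := (ρ.intTree hn hρ).toward_neBot hs.1
  obtain ⟨u, h⟩ := (ρ.eventually_busemann hn hρ hs v w).exists
  rw [← h, abs_le]
  have h1 := ρ.dist_triangle v u w
  have h2 := ρ.dist_triangle w u v
  rw [ρ.dist_comm w v] at h2
  constructor <;> grind

theorem busemann_smul {s : Ori ρ.Tree} (hs : s ∈ (ρ.intTree hn hρ).E) {g : G} (hg : g • s = s)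
    (v w : ρ.Tree) : ρ.busemann hn hρ hs (g • v) (g • w) = ρ.busemann hn hρ hs v w := by
  have hne := (ρ.intTree hn hρ).toward_neBot hs.1
  have h := (ρ.intTree hn hρ).tendsto_smul_toward g s
  rw [hg] at h
  obtain ⟨u, h1, h2⟩ := ((ρ.eventually_busemann hn hρ hs v w).and
    (h.eventually (ρ.eventually_busemann hn hρ hs (g • v) (g • w)))).exists
  rw [← h1, ← h2, ρ.dist_smul, ρ.dist_smul]

theorem busemann_smul_self {s : Ori ρ.Tree} (hs : s ∈ (ρ.intTree hn hρ).E) {g : G} (hg : g • s = s)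
    (v : ρ.Tree) :
    ρ.busemann hn hρ hs (g • v) v = ρ.busemann hn hρ hs (g • ρ.root) ρ.root := by
  have h1 := ρ.busemann_add hn hρ hs (g • v) (g • ρ.root) v
  have h2 := ρ.busemann_add hn hρ hs (g • ρ.root) ρ.root v
  have h3 := ρ.busemann_add hn hρ hs v ρ.root v
  have h4 := ρ.busemann_add hn hρ hs v v v
  rw [ρ.busemann_smul hn hρ hs hg] at h1
  grind

/-- On the stabiliser of the end the cocycle at the root is a homomorphism to `ℤⁿ`, the signed
translation towards the end. -/
theorem busemann_smul_mul {s : Ori ρ.Tree} (hs : s ∈ (ρ.intTree hn hρ).E) {g h : G}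
    (hg : g • s = s) : ρ.busemann hn hρ hs ((g * h) • ρ.root) ρ.root =
      ρ.busemann hn hρ hs (g • ρ.root) ρ.root + ρ.busemann hn hρ hs (h • ρ.root) ρ.root := by
  rw [← ρ.busemann_add hn hρ hs _ (h • ρ.root) ρ.root, mul_smul, ρ.busemann_smul_self hn hρ hs hg]

/-- An element that fixes an end translates a ray towards it. -/
theorem exists_dist_smul_eq {s : Ori ρ.Tree} (hs : s ∈ (ρ.intTree hn hρ).E) {g : G}
    (hg : g • s = s) :
    ∃ x, ρ.dist x (g • x) = |ρ.busemann hn hρ hs (g • ρ.root) ρ.root| := by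
  have hne := (ρ.intTree hn hρ).toward_neBot hs.1
  have hδ0 : 0 ≤ ρ.δ ρ.root (g • ρ.root) := (ρ.intTree hn hρ).nonneg _ _
  -- Deep enough for a point `x` one level deeper than `g • root` to lie still strictly before `a`;
  -- then `x` and `g • x` are both on segments directed to the end.
  obtain ⟨a, ha, hsa⟩ := hs.2 (ρ.δ ρ.root (g • ρ.root) + 2).toNat
  replace ha : ρ.δ ρ.root (g • ρ.root) + 2 ≤ ρ.δ ρ.root a := (Int.self_le_toNat _).trans ha
  have hev := (ρ.intTree hn hρ).eventually_btw hsa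
  have hsa' : s (g • ρ.root, g • a) = true := by
    rw [← hg, Ori.smul_apply]
    rw [inv_smul_smul, inv_smul_smul]
    exact hsa
  have hev' := (ρ.intTree hn hρ).eventually_btw hsa'
  obtain ⟨u₀, hu₀⟩ := hev.exists
  obtain ⟨u, ⟨hu, hu'⟩, hb⟩ :=
    ((hev.and hev').and (ρ.eventually_busemann hn hρ hs (g • ρ.root) ρ.root)).exists
  change ρ.δ ρ.root a + ρ.δ a u₀ = ρ.δ ρ.root u₀ at hu₀
  change ρ.δ ρ.root a + ρ.δ a u = ρ.δ ρ.root u at hu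
  change ρ.δ (g • ρ.root) (g • a) + ρ.δ (g • a) u = ρ.δ (g • ρ.root) u at hu'
  have hδ : ∀ v w, ρ.δ (g • v) (g • w) = ρ.δ v w := fun v w => by unfold δ; rw [ρ.dist_smul]
  have hau : 0 ≤ ρ.δ a u₀ := (ρ.intTree hn hρ).nonneg _ _
  obtain ⟨t, ht0, ht1, ht⟩ := exists_coord_between (by omega : n - 1 < n) (inZ_top_pred _)
    (ρ.dist_nonneg ρ.root u₀) (j := ρ.δ ρ.root (g • ρ.root) + 1) (by omega)
    (by change _ ≤ ρ.δ ρ.root u₀; omega)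
  obtain ⟨x, hx1, hx2⟩ := ρ.exists_seg ρ.root u₀ ht0 ht1
  have hx : ρ.δ ρ.root x = ρ.δ ρ.root (g • ρ.root) + 1 := by unfold δ; rw [hx1]; exact ht
  have hxs : x ∈ ρ.seg ρ.root u₀ := by
    change _ + _ = _
    rw [hx1, hx2]; abel
  have hgxs : g • x ∈ ρ.seg (g • ρ.root) (g • u₀) := by
    change _ + _ = _
    rw [ρ.dist_smul, ρ.dist_smul, ρ.dist_smul]; exact hxs
  have k1 := ρ.mem_seg_of_btw hu hu₀ hxs (by omega)
  have k2 := ρ.mem_seg_rebase (b := g • ρ.root) k1 (by omega)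
  have k3 := ρ.mem_seg_of_btw hu' (by rwa [hδ, hδ, hδ]) hgxs (by rw [hδ, hδ]; omega)
  change ρ.dist _ _ + ρ.dist _ _ = ρ.dist _ _ at k1 k2 k3
  rw [ρ.dist_smul] at k3
  refine ⟨x, ?_⟩
  have f1 := ρ.four_point x (g • x) (g • ρ.root) u
  have f2 := ρ.dist_triangle x u (g • x)
  have f3 := ρ.dist_triangle (g • x) u x
  rw [ρ.dist_comm x (g • ρ.root), ρ.dist_comm (g • x) (g • ρ.root), ρ.dist_smul] at f1
  rw [ρ.dist_comm (g • x) x] at f3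
  rw [← hb]
  rcases abs_cases (ρ.dist (g • ρ.root) u - ρ.dist ρ.root u) with ⟨e, he⟩ | ⟨e, he⟩ <;> rw [e]
  · rcases f1 with f1 | f1 <;> grind
  · rcases f1 with f1 | f1 <;> grind

end Busemann

include ρ in
-- The displacement of the root grows strictly along the powers `g ^ 2 ^ k`, so a non-trivial
-- element has infinite order.
theorem eq_one_of_pow (hn : 1 ≤ n) {g : G} {m : ℕ} (hm : m ≠ 0) (h : g ^ m = 1) : g = 1 := by
  by_contra hg
  have hne : ∀ k : ℕ, g ^ 2 ^ k ≠ 1 ∧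
      ρ.dist ρ.root (g ^ 2 ^ k • ρ.root) < ρ.dist ρ.root (g ^ 2 ^ (k + 1) • ρ.root) := by
    intro k
    have step : ∀ f : G, f ≠ 1 → ρ.dist ρ.root (f • ρ.root) < ρ.dist ρ.root (f ^ 2 • ρ.root) := by
      intro f hf
      rw [pow_two, mul_smul]
      exact ρ.dist_smul_lt hn hf _
    have hk : g ^ 2 ^ k ≠ 1 := by
      induction k with
      | zero => simpa using hg
      | succ k ih =>
        intro h1
        have h2 := step _ ih
        rw [← pow_mul, ← pow_succ, h1, one_smul, dist_self] at h2
        exact absurd h2 (not_lt.2 (ρ.dist_nonneg _ _))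
    refine ⟨hk, ?_⟩
    rw [pow_succ, pow_mul]
    exact step _ hk
  have hmono : StrictMono fun k : ℕ => ρ.dist ρ.root (g ^ 2 ^ k • ρ.root) :=
    strictMono_nat_of_lt_succ fun k => (hne k).2
  have hinj : Function.Injective fun k : ℕ => g ^ 2 ^ k := by
    intro k l hkl
    refine hmono.injective ?_
    dsimp only at hkl ⊢
    rw [hkl]
  have hfin : ((Subgroup.zpowers g : Subgroup G) : Set G).Finite :=
    finite_zpowers.2 (isOfFinOrder_iff_pow_eq_one.2 ⟨m, Nat.pos_of_ne_zero hm, h⟩)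
  refine Set.infinite_range_of_injective hinj (hfin.subset ?_)
  rintro _ ⟨k, rfl⟩
  exact Subgroup.npow_mem_zpowers g _

/-- The orbit of an end is infinite. -/
theorem infinite_orbit (hn : 1 ≤ n) (hρ : ρ.IsIrreducible) (hG : ∃ a b : G, a * b ≠ b * a)
    {s : Ori ρ.Tree} (hs : s ∈ (ρ.intTree hn hρ).E) : (MulAction.orbit G s).Infinite := by
  intro hfin
  obtain ⟨a, b, hab⟩ := hG
  have : Finite (G ⧸ MulAction.stabilizer G s) :=
    @Finite.of_equiv _ _ hfin.to_subtype (MulAction.orbitEquivQuotientStabilizer G s)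
  have hfi : (MulAction.stabilizer G s).FiniteIndex := Subgroup.finiteIndex_of_finite_quotient
  -- A normal subgroup of finite index that fixes the end.
  set H := (MulAction.stabilizer G s).normalCore
  have hHs : ∀ h ∈ H, h • s = s := fun h hh => Subgroup.normalCore_le _ hh
  set χ : G → Zn n := fun h => ρ.busemann hn hρ hs (h • ρ.root) ρ.root
  have hmul : ∀ g ∈ H, ∀ h, χ (g * h) = χ g + χ h := fun g hg h =>
    ρ.busemann_smul_mul hn hρ hs (hHs g hg)
  have hone : χ 1 = 0 := by
    have := hmul 1 H.one_mem 1
    rw [one_mul] at this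
    simpa using this
  have hinv : ∀ g ∈ H, χ g⁻¹ = -χ g := by
    intro g hg
    have := hmul g hg g⁻¹
    rw [mul_inv_cancel, hone] at this
    exact (neg_eq_of_add_eq_zero_right this.symm).symm
  -- An element without translation along the end fixes a point, and the action is free.
  have hker : ∀ g ∈ H, χ g = 0 → g = 1 := by
    intro g hg h0
    by_contra hne
    obtain ⟨x, hx⟩ := ρ.exists_dist_smul_eq hn hρ hs (hHs g hg)
    rw [show ρ.busemann hn hρ hs (g • ρ.root) ρ.root = 0 from h0, abs_zero] at hx
    exact ρ.smul_ne hn hne x (ρ.eq_of_dist_eq_zero hx).symm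
  have hinj : ∀ g ∈ H, ∀ h ∈ H, χ g = χ h → g = h := by
    intro g hg h hh e
    refine mul_inv_eq_one.1 (hker _ (H.mul_mem hg (H.inv_mem hh)) ?_)
    rw [hmul g hg, hinv h hh, e, add_neg_cancel]
  have hcomm : ∀ g ∈ H, ∀ h ∈ H, g * h = h * g := by
    intro g hg h hh
    refine hinj _ (H.mul_mem hg hh) _ (H.mul_mem hh hg) ?_
    rw [hmul g hg, hmul h hh, add_comm]
  -- The value `|χ h|` bounds from below the displacement of every point and is attained, so it is
  -- invariant under conjugation.
  have hle : ∀ h ∈ H, ∀ g : G, |χ h| ≤ |χ (g * h * g⁻¹)| := by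
    intro h hh g
    have hh' : g * h * g⁻¹ ∈ H := Subgroup.Normal.conj_mem inferInstance h hh g
    obtain ⟨x, hx⟩ := ρ.exists_dist_smul_eq hn hρ hs (hHs _ hh')
    have h1 := ρ.busemann_le hn hρ hs (h • g⁻¹ • x) (g⁻¹ • x)
    rw [ρ.busemann_smul_self hn hρ hs (hHs h hh), ← ρ.dist_smul g, smul_inv_smul, smul_smul,
      smul_smul, ρ.dist_comm, hx] at h1
    exact h1
  have hconj : ∀ h ∈ H, ∀ g : G, g * h * g⁻¹ = h ∨ g * h * g⁻¹ = h⁻¹ := by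
    intro h hh g
    have hh' : g * h * g⁻¹ ∈ H := Subgroup.Normal.conj_mem inferInstance h hh g
    have h1 := hle h hh g
    have h2 := hle _ hh' g⁻¹
    have e : g⁻¹ * (g * h * g⁻¹) * g⁻¹⁻¹ = h := by group
    rw [e] at h2
    rcases abs_eq_abs.1 (le_antisymm h2 h1) with h3 | h3
    · exact Or.inl (hinj _ hh' _ hh h3)
    · exact Or.inr (hinj _ hh' _ (H.inv_mem hh) (by rw [h3, hinv h hh]))
  have hidx : H.index ≠ 0 := Subgroup.FiniteIndex.index_ne_zero
  have hpow : ∀ g : G, g ^ H.index ∈ H := fun g => Subgroup.pow_index_mem H g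
  have hcentral : H ≤ Subgroup.center G := by
    intro h hh
    rw [Subgroup.mem_center_iff]
    intro g
    rcases hconj h hh g with h1 | h1
    · exact mul_inv_eq_iff_eq_mul.1 h1
    -- Suppose `g` inverts `h`. It fixes `g ^ m ∈ H`, so it sends `h * g ^ m` to `h⁻¹ * g ^ m`. By
    -- the dichotomy for this product, `h` or `g ^ m` equals its own inverse, so `h` or `g` is
    -- trivial by torsion-freeness.
    · set m := H.index
      have hsq : ∀ f : G, f = f⁻¹ → f = 1 := fun f hf =>
        ρ.eq_one_of_pow hn two_ne_zero (by rw [pow_two]; nth_rw 1 [hf]; exact inv_mul_cancel f)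
      have h2 : g * (h * g ^ m) * g⁻¹ = h⁻¹ * g ^ m := by
        rw [← h1]
        have : Commute g (g ^ m) := (Commute.refl g).pow_right m
        rw [← mul_assoc, mul_assoc (g * h), ← this.inv_left.eq, mul_assoc, mul_assoc, mul_assoc]
      have hgm := hpow g
      rcases hconj _ (H.mul_mem hh hgm) g with h3 | h3
      · rw [h2] at h3
        rw [hsq h (mul_right_cancel h3).symm]
        simp
      · rw [h2, mul_inv_rev, hcomm _ (H.inv_mem hgm) _ (H.inv_mem hh)] at h3
        have h4 := ρ.eq_one_of_pow hn hidx (hsq _ (mul_left_cancel h3))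
        rw [h4]
        simp
  have hci : (Subgroup.center G).FiniteIndex := Subgroup.finiteIndex_of_le hcentral
  refine hab ?_
  have h1 : (Subgroup.center G).index ≠ 0 := Subgroup.FiniteIndex.index_ne_zero
  -- The transfer to the centre is the power map with exponent the index. It kills commutators,
  -- which are therefore trivial because `G` is torsion-free.
  have h2 : MonoidHom.transferCenterPow G (a * b * a⁻¹ * b⁻¹) = 1 := by
    have hc : MonoidHom.transferCenterPow G a * MonoidHom.transferCenterPow G b =
        MonoidHom.transferCenterPow G b * MonoidHom.transferCenterPow G a :=
      Subtype.ext (Subgroup.mem_center_iff.1 (MonoidHom.transferCenterPow G b).2 _)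
    rw [map_mul, map_mul, map_mul, map_inv, map_inv, hc]
    group
  have h3 := congrArg Subtype.val h2
  rw [MonoidHom.transferCenterPow_apply] at h3
  have h4 := ρ.eq_one_of_pow hn h1 h3
  rw [mul_inv_eq_one, mul_inv_eq_iff_eq_mul] at h4
  exact h4

end WordGroup

end ZnFree

namespace ZnFree

namespace WordGroup

variable {n : ℕ} {X G : Type*} [Group G] (ρ : WordGroup n X G)

/-! ### Segments -/

theorem mem_seg {v w x : ρ.Tree} : x ∈ ρ.seg v w ↔ ρ.dist v x + ρ.dist x w = ρ.dist v w := Iff.rfl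

theorem smul_mem_seg (g : G) {v w x : ρ.Tree} : g • x ∈ ρ.seg (g • v) (g • w) ↔ x ∈ ρ.seg v w := by
  simp only [mem_seg, ρ.dist_smul]

theorem left_mem_seg (v w : ρ.Tree) : v ∈ ρ.seg v w := by rw [mem_seg, dist_self, zero_add]

theorem right_mem_seg (v w : ρ.Tree) : w ∈ ρ.seg v w := by rw [mem_seg, dist_self, add_zero]

theorem mem_seg_comm {v w x : ρ.Tree} : x ∈ ρ.seg v w ↔ x ∈ ρ.seg w v := by
  rw [mem_seg, mem_seg, ρ.dist_comm v x, ρ.dist_comm x w, ρ.dist_comm v w, add_comm]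

/-- The distance to a point of a segment. -/
theorem dist_of_mem_seg {x y p : ρ.Tree} (hp : p ∈ ρ.seg x y) (w : ρ.Tree) :
    ρ.dist w p = max (ρ.dist w x - ρ.dist x p) (ρ.dist w y - ρ.dist p y) := by
  rw [mem_seg] at hp
  have h1 := ρ.dist_triangle w x p
  have h2 := ρ.dist_triangle w y p
  have h3 := ρ.four_point w p x y
  rw [ρ.dist_comm p x] at h1 h3
  refine le_antisymm (le_max_iff.2 ?_) (max_le ?_ ?_)
  · rcases h3 with h3 | h3
    · left; grind
    · right; grind
  · grind
  · grind

theorem dist_eq_abs {x y p q : ρ.Tree} (hp : p ∈ ρ.seg x y) (hq : q ∈ ρ.seg x y) :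
    ρ.dist p q = |ρ.dist x p - ρ.dist x q| := by
  rw [ρ.dist_of_mem_seg hq, ρ.dist_comm p x, abs_eq_max_neg]
  rw [mem_seg] at hp hq
  congr 1
  grind

theorem eq_of_mem_seg {x y p q : ρ.Tree} (hp : p ∈ ρ.seg x y) (hq : q ∈ ρ.seg x y)
    (h : ρ.dist x p = ρ.dist x q) : p = q := by
  refine ρ.eq_of_dist_eq_zero ?_
  rw [ρ.dist_eq_abs hp hq, h, sub_self, abs_zero]

theorem mem_seg_trans {x y p q : ρ.Tree} (hp : p ∈ ρ.seg x y) (hq : q ∈ ρ.seg x p) :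
    q ∈ ρ.seg x y ∧ p ∈ ρ.seg q y := by
  simp only [mem_seg] at *
  have h1 := ρ.dist_triangle x y q
  have h2 := ρ.dist_triangle q y p
  constructor <;> grind

theorem mem_seg_of_le {x y p q : ρ.Tree} (hp : p ∈ ρ.seg x y) (hq : q ∈ ρ.seg x y)
    (h : ρ.dist x q ≤ ρ.dist x p) : q ∈ ρ.seg x p := by
  rw [mem_seg, ρ.dist_eq_abs hq hp, abs_of_nonpos (sub_nonpos.2 h)]
  abel

theorem seg_rebase {o a w u : ρ.Tree} (hw : w ∈ ρ.seg o u) (ha : ρ.dist o a ≤ ρ.dist o w) :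
    w ∈ ρ.seg a u := by
  have h0 := ρ.dist_nonneg a w
  have h1 := ρ.dist_triangle a u w
  rw [mem_seg] at *
  rcases ρ.four_point a w o u with h2 | h2
  · rw [ρ.dist_comm a o] at h2
    have : a = w := ρ.eq_of_dist_eq_zero (by grind)
    rw [this, dist_self, zero_add]
  · rw [ρ.dist_comm w o] at h2
    grind

/-- The counterpart of `eq_of_deep` in the full metric: from `a` and from `b`, both targets are seen
through `w`. -/
theorem mem_seg_iff_of_deep {o w u u' a b : ρ.Tree} (hu : w ∈ ρ.seg o u) (hu' : w ∈ ρ.seg o u')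
    (ha : ρ.dist o a ≤ ρ.dist o w) (hb : ρ.dist o b ≤ ρ.dist o w) :
    b ∈ ρ.seg a u ↔ b ∈ ρ.seg a u' := by
  have h1 := ρ.seg_rebase hu ha
  have h2 := ρ.seg_rebase hu' ha
  have h3 := ρ.seg_rebase hu hb
  have h4 := ρ.seg_rebase hu' hb
  simp only [mem_seg] at *
  constructor <;> intro h5 <;> grind

/-- Removing an edge leaves two components. -/
theorem mem_seg_edge (hn : 1 ≤ n) {v v' : ρ.Tree} (h : ρ.dist v v' = unit n) (u : ρ.Tree) :
    v' ∈ ρ.seg v u ↔ ¬ v ∈ ρ.seg v' u := by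
  have hu := unit_pos hn
  have h1 := ρ.dist_triangle v u v'
  have h2 := ρ.dist_triangle v' u v
  obtain ⟨e, he⟩ := ρ.dist_even v v' u
  simp only [mem_seg, ρ.dist_comm v' v, h] at *
  -- The perimeter is even while the edge has odd coordinate of index `0`.
  have hne : ρ.dist v u ≠ ρ.dist v' u := by
    intro h3
    have h4 := congrArg (coord 0) he
    rw [h3, coord_add, coord_add, coord_unit_zero hn, coord_two_nsmul] at h4
    omega
  rcases hne.lt_or_gt with h3 | h3 <;> have h4 := unit_le_of_pos (sub_pos.2 h3)
  · constructor <;> intro <;> grind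
  · constructor <;> intro <;> grind

/-- Whether the path from `o` reaches `v'` is decided at the last edge; this reduces arbitrary pairs
to edges. -/
theorem mem_seg_edge_iff (hn : 1 ≤ n) {o v v' : ρ.Tree} (h : ρ.dist v v' = unit n)
    (hv : v ∈ ρ.seg o v') (u : ρ.Tree) : v' ∈ ρ.seg o u ↔ v' ∈ ρ.seg v u := by
  have hu := unit_pos hn
  refine ⟨fun h1 => (ρ.mem_seg_trans h1 hv).2, fun h1 => ?_⟩
  have h2 := ρ.dist_triangle o u v'
  simp only [mem_seg, h] at hv h1 ⊢
  rcases ρ.four_point o v' v u with h3 | h3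
  · grind
  · rw [ρ.dist_comm v' v, h] at h3
    grind

/-! ### Rays -/

namespace HalfLine

variable {n k : ℕ}

instance : Nonempty (HalfLine n k) := ⟨origin n k⟩

theorem eventually_iff {p : HalfLine n k → Prop} :
    (∀ᶠ b in atTop, p b) ↔ ∃ a, ∀ b, a ≤ b → p b := eventually_atTop

/-- Translation on the half-line. -/
def add (a b : HalfLine n k) : HalfLine n k :=
  ⟨a.1 + b.1, add_nonneg a.2.1 b.2.1, a.2.2.add b.2.2⟩

theorem le_add_left (a b : HalfLine n k) : a ≤ b.add a :=
  Subtype.coe_le_coe.1 (le_add_of_nonneg_left b.2.1)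

theorem le_add_right (a b : HalfLine n k) : a ≤ a.add b :=
  Subtype.coe_le_coe.1 (le_add_of_nonneg_right b.2.1)

theorem eventually_gt (h1 : 1 ≤ k) (hn : k ≤ n) (α : Zn n) (hα : InZ k α) :
    ∀ᶠ b : HalfLine n k in atTop, α < b.1 := by
  have hu := unit_pos (h1.trans hn)
  refine eventually_iff.2 ⟨⟨|α| + unit n, add_nonneg (abs_nonneg α) hu.le,
    hα.abs.add (inZ_unit.mono h1)⟩, fun b hb => ?_⟩
  have : |α| + unit n ≤ b.1 := hb
  have := le_abs_self α
  grind

end HalfLine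

variable {ρ}

namespace Ray

variable {k : ℕ} (γ : ρ.Ray k)

/-- The distance from `w` along the ray is eventually affine. -/
def Affine (w : ρ.Tree) (σ : ℤ) (c : Zn n) : Prop :=
  (σ = 1 ∨ σ = -1) ∧ ∀ᶠ b in atTop, ρ.dist w (γ.toFun b) = c + σ • b.1

theorem mem_seg {a b : HalfLine n k} (h : a ≤ b) :
    γ.toFun a ∈ ρ.seg (γ.toFun (origin n k)) (γ.toFun b) := by
  have h : a.1 ≤ b.1 := h
  have ha : (0 : Zn n) ≤ a.1 := a.2.1
  have hb : (0 : Zn n) ≤ b.1 := b.2.1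
  rw [WordGroup.mem_seg, γ.isometry, γ.isometry, γ.isometry]
  change |0 - a.1| + _ = |0 - b.1|
  rw [zero_sub, zero_sub, abs_neg, abs_neg, abs_of_nonneg ha, abs_of_nonneg hb,
    abs_of_nonpos (sub_nonpos.2 h)]
  abel

theorem dist_le {a b : HalfLine n k} (h : a ≤ b) :
    ρ.dist (γ.toFun a) (γ.toFun b) = b.1 - a.1 := by
  have h : a.1 ≤ b.1 := h
  rw [γ.isometry, abs_of_nonpos (sub_nonpos.2 h)]
  abel

theorem dist_origin (a : HalfLine n k) : ρ.dist (γ.toFun (origin n k)) (γ.toFun a) = a.1 := by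
  rw [γ.dist_le a.2.1]
  exact sub_zero _

/-- A ray either moves away from `w` eventually, or approaches `w` all the time. -/
theorem dichotomy (w : ρ.Tree) :
    (∃ c a, ∀ b, a ≤ b → ρ.dist w (γ.toFun b) = c + b.1) ∨
      ∃ c, ∀ b, ρ.dist w (γ.toFun b) = c - b.1 := by
  by_cases h : ∀ a, ρ.dist w (γ.toFun a) = ρ.dist w (γ.toFun (origin n k)) - a.1
  · exact Or.inr ⟨_, h⟩
  · push Not at h
    obtain ⟨a, ha⟩ := h
    refine Or.inl ⟨ρ.dist w (γ.toFun a) - a.1, a, fun b hb => ?_⟩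
    have h1 := ρ.dist_of_mem_seg (γ.mem_seg hb) w
    rw [γ.dist_origin, γ.dist_le hb] at h1
    rcases max_choice (ρ.dist w (γ.toFun (origin n k)) - a.1)
      (ρ.dist w (γ.toFun b) - (b.1 - a.1)) with h2 | h2
    · exact absurd (h1.trans h2) ha
    · rw [h2] at h1
      rw [h1]; abel

theorem exists_affine (w : ρ.Tree) : ∃ σ c, γ.Affine w σ c := by
  rcases γ.dichotomy w with ⟨c, a, h⟩ | ⟨c, h⟩
  · exact ⟨1, c, Or.inl rfl, HalfLine.eventually_iff.2 ⟨a, fun b hb => by rw [h b hb, one_smul]⟩⟩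
  · exact ⟨-1, c, Or.inr rfl, Eventually.of_forall fun b => by
      rw [h b, neg_smul, one_smul, sub_eq_add_neg]⟩

/-- Both distances are eventually affine in the parameter, so slopes and constants decide whether
the equation of the segment holds for all large parameters. -/
theorem Affine.eventually_mem_seg (h1 : 1 ≤ k) (hn : k ≤ n) {w v : ρ.Tree} {σ τ : ℤ} {c d : Zn n}
    (hw : γ.Affine w σ c) (hv : γ.Affine v τ d) :
    ∀ᶠ b in atTop, (v ∈ ρ.seg w (γ.toFun b) ↔ σ = τ ∧ ρ.dist w v + d = c) := by
  by_cases hστ : σ = τ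
  · subst hστ
    filter_upwards [hw.2, hv.2] with b e1 e2
    rw [WordGroup.mem_seg, e1, e2, ← add_assoc, add_left_inj]
    simp
  · have hne : ∀ᶠ b : HalfLine n k in atTop, ρ.dist w v + (d + τ • b.1) ≠ c + σ • b.1 := by
      by_cases hex : ∃ b₀ : HalfLine n k, ρ.dist w v + (d + τ • b₀.1) = c + σ • b₀.1
      · obtain ⟨b₀, hb₀⟩ := hex
        filter_upwards [HalfLine.eventually_gt h1 hn b₀.1 b₀.2.2] with b hb e
        rcases hw.1 with rfl | rfl <;> rcases hv.1 with rfl | rfl <;>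
          simp only [one_smul, neg_smul] at e hb₀
        · exact hστ rfl
        · grind
        · grind
        · exact hστ rfl
      · push Not at hex
        exact Eventually.of_forall hex
    filter_upwards [hw.2, hv.2, hne] with b e1 e2 e3
    rw [WordGroup.mem_seg, e1, e2]
    simp [e3, hστ]

end Ray

/-- The distances to the two rays through which adjacent subtrees are joined. -/
theorem affine_of_adjacent {k : ℕ} (h1 : 1 ≤ k) (hn : k < n) {γ γ' : ρ.Ray k} {D : Zn n}
    (hD : ρ.dist (γ.toFun (origin n k)) (γ'.toFun (origin n k)) = D)
    (h : InZ (k + 1) D) (h' : coord k D = 1)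
    (hγ : ∀ a, γ.toFun a ∈ ρ.seg (γ.toFun (origin n k)) (γ'.toFun (origin n k)))
    (hγ' : ∀ a, γ'.toFun a ∈ ρ.seg (γ.toFun (origin n k)) (γ'.toFun (origin n k)))
    (w : ρ.Tree) : ∃ σ c, γ.Affine w σ c ∧ γ'.Affine w (-σ) (c + σ • D) := by
  set x := γ.toFun (origin n k)
  set y := γ'.toFun (origin n k)
  have e1 : ∀ a, ρ.dist w (γ.toFun a) = max (ρ.dist w x - a.1) (ρ.dist w y - (D - a.1)) := by
    intro a
    have h2 := hγ a
    rw [mem_seg, γ.dist_origin, hD] at h2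
    rw [ρ.dist_of_mem_seg (hγ a) w, γ.dist_origin]
    congr 2
    rw [← h2]; abel
  have e2 : ∀ a, ρ.dist w (γ'.toFun a) = max (ρ.dist w x - (D - a.1)) (ρ.dist w y - a.1) := by
    intro a
    have h2 := hγ' a
    rw [mem_seg, ρ.dist_comm _ y, γ'.dist_origin, hD] at h2
    rw [ρ.dist_of_mem_seg (hγ' a) w, ρ.dist_comm (γ'.toFun a) y, γ'.dist_origin]
    congr 2
    rw [← h2]; abel
  obtain ⟨e, he⟩ := ρ.dist_even w x y
  have t1 := ρ.dist_triangle w y x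
  have t2 := ρ.dist_triangle x y w
  have t3 := ρ.dist_triangle w x y
  rw [ρ.dist_comm x w] at t2
  rw [ρ.dist_comm y x] at t3
  rw [hD] at he t1 t2 t3
  -- The distance from `x` to the projection of `w` on the segment from `x` to `y`. Its coordinate
  -- of index `k` is `0` or `1` and tells which of the two subtrees contains the projection; the ray
  -- there moves away from `w`, the other one approaches `w`.
  set t := e - ρ.dist w y with ht
  have ht2 : 2 • t = ρ.dist w x + D - ρ.dist w y := by rw [ht, nsmul_sub, ← he, two_nsmul]; abel
  have ht0 : 0 ≤ t := by grind
  have htD : t ≤ D := by grind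
  have htk : InZ (k + 1) t := h.convex ht0 htD
  have c0 := htk.coord_nonneg ht0
  have c1 := htk.coord_mono h htD
  rw [h'] at c1
  rcases (show coord k t = 0 ∨ coord k t = 1 by omega) with hc | hc
  · have htk' := htk.pred hc
    refine ⟨1, ρ.dist w y - D, ⟨Or.inl rfl, ?_⟩, Or.inr rfl, ?_⟩
    · filter_upwards [HalfLine.eventually_gt h1 hn.le t htk'] with b hb
      rw [e1, max_eq_right (by grind), one_smul]; abel
    · refine Eventually.of_forall fun b => ?_
      have hb : b.1 < D - t := ((b.2.2.mono k.le_succ).lt_of_coord_lt (h.sub htk) (by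
        rw [b.2.2 k le_rfl, coord_sub, h', hc]; norm_num))
      rw [e2, max_eq_right (by grind), one_smul, neg_smul, one_smul]; abel
  · have htk' : InZ k (D - t) := (h.sub htk).pred (by rw [coord_sub, h', hc]; rfl)
    refine ⟨-1, ρ.dist w x, ⟨Or.inr rfl, ?_⟩, Or.inl rfl, ?_⟩
    · refine Eventually.of_forall fun b => ?_
      have hb : b.1 < t := ((b.2.2.mono k.le_succ).lt_of_coord_lt htk (by
        rw [b.2.2 k le_rfl, hc]; norm_num))
      rw [e1, max_eq_left (by grind), neg_smul, one_smul, sub_eq_add_neg]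
    · filter_upwards [HalfLine.eventually_gt h1 hn.le _ htk'] with b hb
      rw [e2, max_eq_left (by grind), neg_smul, one_smul, neg_neg, one_smul]; abel

/-- The vertices that converge to a representative of a point. -/
def PrePoint.lim : ρ.PrePoint → Filter ρ.Tree
  | .vertex v => pure v
  | .ray _ _ _ γ => map γ.toFun atTop

instance (p : ρ.PrePoint) : p.lim.NeBot := by
  cases p <;> unfold PrePoint.lim <;> infer_instance

theorem PrePoint.between_iff (w v : ρ.Tree) (p : ρ.PrePoint) :
    PrePoint.Between w v p ↔ ∀ᶠ u in p.lim, v ∈ ρ.seg w u := by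
  cases p with
  | vertex u => exact Iff.rfl
  | ray k h1 hn γ => exact HalfLine.eventually_iff.symm

theorem PrePoint.eventually_between (w v : ρ.Tree) (p : ρ.PrePoint) :
    ∀ᶠ u in p.lim, (v ∈ ρ.seg w u ↔ PrePoint.Between w v p) := by
  cases p with
  | vertex u => exact Iff.rfl
  | ray k h1 hn γ =>
    obtain ⟨σ, c, h⟩ := γ.exists_affine w
    obtain ⟨τ, d, h'⟩ := γ.exists_affine v
    have h2 := h.eventually_mem_seg γ h1 hn h'
    rw [PrePoint.between_iff]
    change ∀ᶠ b in atTop, (_ ↔ ∀ᶠ b in atTop, v ∈ ρ.seg w (γ.toFun b))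
    filter_upwards [h2] with b hb
    rw [hb, eventually_congr h2]
    exact (eventually_const).symm

/-- Geodesics do not see the identifications. For adjacent subtrees the slopes for `w` and for `v`
change sign simultaneously, and if they are equal, both constants are shifted by the same amount. -/
theorem Glue.between_iff (w v : ρ.Tree) {p q : ρ.PrePoint} (h : ρ.Glue p q) :
    PrePoint.Between w v p ↔ PrePoint.Between w v q := by
  cases h with
  | tail k h1 hn γ γ' h =>
    have key : ∀ γ γ' : ρ.Ray k, (∃ a b, γ.toFun '' Set.Ici a = γ'.toFun '' Set.Ici b) →
        PrePoint.Between w v (.ray k h1 hn γ) → PrePoint.Between w v (.ray k h1 hn γ') := by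
      rintro γ γ' ⟨a, b, hab⟩ ⟨a₀, ha₀⟩
      have hsub : ∀ b', b ≤ b' → ∃ a', a ≤ a' ∧ γ.toFun a' = γ'.toFun b' := by
        intro b' hb'
        have : γ'.toFun b' ∈ γ.toFun '' Set.Ici a := by rw [hab]; exact ⟨b', hb', rfl⟩
        exact this
      obtain ⟨a₁, ha₁, e₁⟩ := hsub b le_rfl
      change ∃ b₀, ∀ b', b₀ ≤ b' → v ∈ ρ.seg w (γ'.toFun b')
      refine HalfLine.eventually_iff.1 ?_
      filter_upwards [HalfLine.eventually_gt h1 hn (b.1 + a₀.1 + a₁.1)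
        ((b.2.2.add a₀.2.2).add a₁.2.2)] with b' hb'
      have hb0 := b.2.1
      have ha00 := a₀.2.1
      have ha10 := a₁.2.1
      have hbb : b ≤ b' := by
        change b.1 ≤ b'.1
        grind
      obtain ⟨a', ha', e'⟩ := hsub b' hbb
      rw [← e']
      refine ha₀ a' ?_
      have h3 := γ'.dist_le hbb
      rw [← e₁, ← e', γ.isometry] at h3
      change a₀.1 ≤ a'.1
      have ha'0 := a'.2.1
      rcases abs_choice (a₁.1 - a'.1) with h4 | h4 <;> rw [h4] at h3 <;> grind
    obtain ⟨a, b, hab⟩ := h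
    exact ⟨key γ γ' ⟨a, b, hab⟩, key γ' γ ⟨b, a, hab.symm⟩⟩
  | adjacent k h1 hn γ γ' h h' hγ hγ' =>
    obtain ⟨σ, c, f1, f2⟩ := affine_of_adjacent h1 hn rfl h h' hγ hγ' w
    obtain ⟨τ, d, g1, g2⟩ := affine_of_adjacent h1 hn rfl h h' hγ hγ' v
    rw [PrePoint.between_iff, PrePoint.between_iff]
    change (∀ᶠ b in atTop, v ∈ ρ.seg w (γ.toFun b)) ↔ ∀ᶠ b in atTop, v ∈ ρ.seg w (γ'.toFun b)
    rw [eventually_congr (f1.eventually_mem_seg γ h1 hn.le g1),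
      eventually_congr (f2.eventually_mem_seg γ' h1 hn.le g2), eventually_const, eventually_const,
      neg_inj]
    refine and_congr_right fun e => ?_
    rw [e, ← add_assoc, add_left_inj]

theorem mem_geodesic_mk (w v : ρ.Tree) (p : ρ.PrePoint) :
    v ∈ ρ.geodesic w (Quot.mk _ p) ↔ PrePoint.Between w v p := by
  constructor
  · rintro ⟨q, hq, hb⟩
    have : ∀ x : ρ.Points, x = Quot.mk _ p → (Quot.lift (fun p => PrePoint.Between w v p)
        (fun _ _ h => propext (Glue.between_iff w v h)) x ↔ PrePoint.Between w v p) := by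
      rintro _ rfl; exact Iff.rfl
    exact (this _ hq).1 hb
  · exact fun h => ⟨p, rfl, h⟩

theorem mem_geodesic_vertex (w v u : ρ.Tree) :
    v ∈ ρ.geodesic w (Quot.mk _ (.vertex u)) ↔ v ∈ ρ.seg w u := mem_geodesic_mk _ _ _

/-- A point looks like a vertex with respect to finitely many pairs of vertices. -/
theorem exists_vertex (x : ρ.Points) (J : List (ρ.Tree × ρ.Tree)) :
    ∃ u, ∀ p ∈ J, p.2 ∈ ρ.geodesic p.1 x ↔ p.2 ∈ ρ.seg p.1 u := by
  induction x using Quot.inductionOn with | _ q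
  have : ∀ᶠ u in q.lim, ∀ p ∈ J, (p.2 ∈ ρ.seg p.1 u ↔ PrePoint.Between p.1 p.2 q) := by
    induction J with
    | nil => simp
    | cons p J ih =>
      filter_upwards [ih, q.eventually_between p.1 p.2] with u h1 h2
      simp only [List.forall_mem_cons]
      exact ⟨h2, h1⟩
  obtain ⟨u, hu⟩ := this.exists
  exact ⟨u, fun p hp => by rw [hu p hp, mem_geodesic_mk]⟩

theorem smul_mem_geodesic (g : G) {w v : ρ.Tree} {x : ρ.Points} :
    g • v ∈ ρ.geodesic (g • w) (g • x) ↔ v ∈ ρ.geodesic w x := by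
  induction x using Quot.inductionOn with | _ q
  change _ ∈ ρ.geodesic _ (Quot.mk _ (q.smul g)) ↔ _
  rw [mem_geodesic_mk, mem_geodesic_mk]
  cases q with
  | vertex u => exact ρ.smul_mem_seg g
  | ray k h1 hn γ => exact exists_congr fun a => forall₂_congr fun b _ => ρ.smul_mem_seg g

end WordGroup

end ZnFree

namespace ZnFree

namespace WordGroup

variable {n : ℕ} {X G : Type*} [Group G] {ρ : WordGroup n X G}

/-! ### Geodesics to points of the compactification -/

theorem mem_seg_of_mem_geodesic {w p q : ρ.Tree} {x : ρ.Points} (hp : p ∈ ρ.geodesic w x)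
    (hq : q ∈ ρ.geodesic w x) (h : ρ.dist w q ≤ ρ.dist w p) : q ∈ ρ.seg w p := by
  obtain ⟨u, hu⟩ := exists_vertex x [(w, p), (w, q)]
  simp only [List.forall_mem_cons, hp, hq, true_iff] at hu
  exact ρ.mem_seg_of_le hu.1 hu.2.1 h

theorem mem_geodesic_of_mem_seg {w p q : ρ.Tree} {x : ρ.Points} (hp : p ∈ ρ.geodesic w x)
    (hq : q ∈ ρ.seg w p) : q ∈ ρ.geodesic w x := by
  obtain ⟨u, hu⟩ := exists_vertex x [(w, p), (w, q)]
  simp only [List.forall_mem_cons, hp, true_iff] at hu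
  exact hu.2.1.2 (ρ.mem_seg_trans hu.1 hq).1

theorem left_mem_geodesic (w : ρ.Tree) (x : ρ.Points) : w ∈ ρ.geodesic w x := by
  obtain ⟨u, hu⟩ := exists_vertex x [(w, w)]
  simp only [List.forall_mem_cons] at hu
  exact hu.1.2 (ρ.left_mem_seg w u)

theorem mem_geodesic_edge (hn : 1 ≤ n) {v v' : ρ.Tree} (h : ρ.dist v v' = unit n) (x : ρ.Points) :
    v' ∈ ρ.geodesic v x ↔ ¬ v ∈ ρ.geodesic v' x := by
  obtain ⟨u, hu⟩ := exists_vertex x [(v, v'), (v', v)]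
  simp only [List.forall_mem_cons] at hu
  rw [hu.1, hu.2.1, ρ.mem_seg_edge hn h]

theorem mem_geodesic_edge_iff (hn : 1 ≤ n) {o v v' : ρ.Tree} (h : ρ.dist v v' = unit n)
    (hv : v ∈ ρ.seg o v') (x : ρ.Points) : v' ∈ ρ.geodesic o x ↔ v' ∈ ρ.geodesic v x := by
  obtain ⟨u, hu⟩ := exists_vertex x [(o, v'), (v, v')]
  simp only [List.forall_mem_cons] at hu
  rw [hu.1, hu.2.1, ρ.mem_seg_edge_iff hn h hv]

theorem mem_geodesic_iff_of_deep {o w a b : ρ.Tree} {x y : ρ.Points} (hx : w ∈ ρ.geodesic o x)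
    (hy : w ∈ ρ.geodesic o y) (ha : ρ.dist o a ≤ ρ.dist o w) (hb : ρ.dist o b ≤ ρ.dist o w) :
    b ∈ ρ.geodesic a x ↔ b ∈ ρ.geodesic a y := by
  obtain ⟨u, hu⟩ := exists_vertex x [(o, w), (a, b)]
  obtain ⟨u', hu'⟩ := exists_vertex y [(o, w), (a, b)]
  simp only [List.forall_mem_cons] at hu hu'
  rw [hu.2.1, hu'.2.1, ρ.mem_seg_iff_of_deep (hu.1.1 hx) (hu'.1.1 hy) ha hb]

theorem exists_unit_step (hn : 1 ≤ n) {v w : ρ.Tree} (h : v ≠ w) :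
    ∃ z ∈ ρ.seg v w, ρ.dist v z = unit n := by
  have h0 : 0 < ρ.dist v w := lt_of_le_of_ne (ρ.dist_nonneg v w) fun h1 =>
    h (ρ.eq_of_dist_eq_zero h1.symm)
  obtain ⟨z, h1, h2⟩ := ρ.exists_seg v w (unit_pos hn).le (unit_le_of_pos h0)
  exact ⟨z, by rw [mem_seg, h1, h2]; abel, h1⟩

/-- The geodesic to a point that is not a vertex does not stop at a vertex. -/
theorem exists_next (hn : 1 ≤ n) {b v : ρ.Tree} {x : ρ.Points} (hv : v ∈ ρ.geodesic b x)
    (hx : x ≠ Quot.mk _ (.vertex v)) :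
    ∃ v' ∈ ρ.geodesic b x, ρ.dist v v' = unit n ∧ v ∈ ρ.seg b v' := by
  have key : ∀ u ∈ ρ.geodesic b x, v ∈ ρ.seg b u → v ≠ u →
      ∃ v' ∈ ρ.geodesic b x, ρ.dist v v' = unit n ∧ v ∈ ρ.seg b v' := by
    intro u hu hvu hne
    obtain ⟨z, hz, hz1⟩ := exists_unit_step hn hne
    have h1 := ρ.mem_seg_trans (ρ.mem_seg_comm.1 hvu) (ρ.mem_seg_comm.1 hz)
    exact ⟨z, mem_geodesic_of_mem_seg hu (ρ.mem_seg_comm.1 h1.1), hz1, ρ.mem_seg_comm.1 h1.2⟩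
  induction x using Quot.inductionOn with | _ p
  cases p with
  | vertex u =>
    rw [mem_geodesic_vertex] at hv
    exact key u ((mem_geodesic_vertex _ _ _).2 (ρ.right_mem_seg _ _)) hv fun h => hx (by rw [h])
  | ray k h1 hk γ =>
    have hu := unit_pos hn
    have huk : InZ k (unit n) := inZ_unit.mono h1
    rw [mem_geodesic_mk] at hv
    rcases γ.dichotomy b with ⟨c, a, h⟩ | ⟨c, h⟩
    -- The ray moves away from `b`: its late points are on the geodesic, and one of them is beyond
    -- `v`.
    · have hg : ∀ d, a ≤ d → γ.toFun d ∈ ρ.geodesic b (Quot.mk _ (.ray k h1 hk γ)) := by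
        intro d hd
        rw [mem_geodesic_mk]
        refine ⟨d, fun e he => ?_⟩
        rw [mem_seg, h d hd, h e (hd.trans he), γ.dist_le he]
        abel
      obtain ⟨a', ha'⟩ := hv
      have h2 := ha' (a'.add a) (HalfLine.le_add_right _ _)
      have h2' := ha' ((a'.add a).add ⟨unit n, hu.le, huk⟩)
        ((HalfLine.le_add_right a' a).trans (HalfLine.le_add_right _ _))
      have h3 := hg _ (HalfLine.le_add_left a a')
      have h3' := hg ((a'.add a).add ⟨unit n, hu.le, huk⟩)
        ((HalfLine.le_add_left a a').trans (HalfLine.le_add_right _ _))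
      by_cases hne : v = γ.toFun (a'.add a)
      · refine key _ h3' h2' fun hne' => ?_
        have h4 := γ.dist_le (HalfLine.le_add_right (a'.add a) ⟨unit n, hu.le, huk⟩)
        rw [← hne, ← hne', dist_self] at h4
        have h5 : ((a'.add a).add ⟨unit n, hu.le, huk⟩).1 - (a'.add a).1 = unit n :=
          add_sub_cancel_left _ _
        rw [h5] at h4
        exact hu.ne h4
      · exact key _ h3 h2 hne
    -- The ray approaches `b` and the geodesic never reaches it; yet every late point of the ray is
    -- at least one unit farther from `b` than `v`, which leaves room for the next vertex.
    · obtain ⟨a, ha⟩ := hv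
      have hmem : ∀ d, γ.toFun d ∈ ρ.seg b (γ.toFun (origin n k)) := by
        intro d
        rw [mem_seg, h, h, ρ.dist_comm _ (γ.toFun (origin n k)), γ.dist_origin]
        change _ = c - 0
        abel
      have hlt : ∀ d, a ≤ d → ρ.dist b v + unit n ≤ c - d.1 := by
        intro d hd
        have h2 := ha (d.add ⟨unit n, hu.le, huk⟩) (hd.trans (HalfLine.le_add_right _ _))
        rw [mem_seg, h] at h2
        change _ = c - (d.1 + unit n) at h2
        have h3 := ρ.dist_nonneg v (γ.toFun (d.add ⟨unit n, hu.le, huk⟩))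
        grind
      have hne : v ≠ γ.toFun a := by
        intro h2
        have h3 := hlt a le_rfl
        have h4 := h a
        rw [h2, h4] at h3
        grind
      obtain ⟨z, hz, hz1⟩ := exists_unit_step hn hne
      have h1' := ρ.mem_seg_trans (ρ.mem_seg_comm.1 (ha a le_rfl)) (ρ.mem_seg_comm.1 hz)
      have hvz : v ∈ ρ.seg b z := ρ.mem_seg_comm.1 h1'.2
      refine ⟨z, ?_, hz1, hvz⟩
      rw [mem_geodesic_mk]
      refine ⟨a, fun d hd => ?_⟩
      have hz2 := (ρ.mem_seg_trans (hmem a) (ρ.mem_seg_comm.1 h1'.1)).1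
      refine ρ.mem_seg_of_le (hmem d) hz2 ?_
      rw [mem_seg, hz1] at hvz
      rw [h, ← hvz]
      exact hlt d hd

/-! ### Top ends -/

/-- A ray of full type cannot approach `w` forever, because the distance would become negative. -/
theorem Ray.top_spec (hn : 1 ≤ n) (γ : ρ.Ray n) (w : ρ.Tree) : ∃ c a, ∀ b, a ≤ b →
    ρ.dist w (γ.toFun b) = c + b.1 ∧
      γ.toFun b ∈ ρ.geodesic w (Quot.mk _ (.ray n hn le_rfl γ)) := by
  rcases γ.dichotomy w with ⟨c, a, h⟩ | ⟨c, h⟩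
  · refine ⟨c, a, fun b hb => ⟨h b hb, (mem_geodesic_mk _ _ _).2 ⟨b, fun e he => ?_⟩⟩⟩
    rw [WordGroup.mem_seg, h b hb, h e (hb.trans he), γ.dist_le he]
    abel
  · obtain ⟨b, hb⟩ := (HalfLine.eventually_gt hn le_rfl c (inZ_top c)).exists
    have h1 := ρ.dist_nonneg w (γ.toFun b)
    rw [h] at h1
    exact absurd hb (not_lt.2 (sub_nonneg.1 h1))

/-- Vertices and ends of lower type stay at bounded top distance from the root. The criterion uses
countably many geodesic conditions, which gives measurability. -/
theorem mem_ends_iff (hn : 1 ≤ n) (x : ρ.Points) : x ∈ ρ.ends n ↔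
    ∀ m : ℕ, ∃ v, (m : ℤ) ≤ ρ.δ ρ.root v ∧ v ∈ ρ.geodesic ρ.root x := by
  constructor
  · rintro ⟨h1, h2, γ, rfl⟩ m
    obtain ⟨c, a, h⟩ := γ.top_spec hn ρ.root
    obtain ⟨α, hα⟩ := exists_top hn (m - top c)
    obtain ⟨b, hb1, hb2⟩ := ((HalfLine.eventually_gt hn le_rfl α (inZ_top α)).and
      (eventually_ge_atTop a)).exists
    refine ⟨γ.toFun b, ?_, (h b hb2).2⟩
    unfold δ
    rw [(h b hb2).1, top_add]
    have := top_mono hb1.le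
    omega
  · intro h
    induction x using Quot.inductionOn with | _ p
    cases p with
    | vertex u =>
      obtain ⟨v, h1, h2⟩ := h (ρ.δ ρ.root u + 1).toNat
      rw [mem_geodesic_vertex, mem_seg] at h2
      have h3 := congrArg top h2
      have h4 := top_mono (ρ.dist_nonneg v u)
      rw [top_add] at h3
      rw [top_zero] at h4
      have h5 := (Int.self_le_toNat _).trans h1
      unfold δ at h5
      omega
    | ray k h1 hk γ =>
      rcases hk.eq_or_lt with rfl | hlt
      · exact ⟨h1, le_rfl, γ, rfl⟩
      · obtain ⟨v, h3, h2⟩ := h (ρ.δ ρ.root (γ.toFun (origin n k)) + 1).toNat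
        rw [mem_geodesic_mk] at h2
        obtain ⟨b, hb⟩ := h2
        have h4 := congrArg top (ρ.mem_seg.1 (hb b le_rfl))
        have h5 := top_mono (ρ.dist_nonneg v (γ.toFun b))
        have h6 := ρ.δ_tri ρ.root (γ.toFun b) (γ.toFun (origin n k))
        have h7 : ρ.δ (γ.toFun (origin n k)) (γ.toFun b) = 0 := by
          unfold δ
          rw [γ.dist_origin]
          exact top_eq_zero_of_inZ hlt b.2.2
        rw [top_add] at h4
        rw [top_zero] at h5
        have h8 := (Int.self_le_toNat _).trans h3
        unfold δ at *
        omega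

theorem δ_nonneg (v w : ρ.Tree) : 0 ≤ ρ.δ v w := by
  have := top_mono (ρ.dist_nonneg v w)
  rwa [top_zero] at this

theorem δ_self (v : ρ.Tree) : ρ.δ v v = 0 := by unfold δ; rw [dist_self, top_zero]

theorem δ_of_mem_seg {v w x : ρ.Tree} (h : x ∈ ρ.seg v w) : ρ.δ v x + ρ.δ x w = ρ.δ v w := by
  have := congrArg top (ρ.mem_seg.1 h)
  rwa [top_add] at this

theorem exists_seg_δ (hn : 1 ≤ n) (v w : ρ.Tree) {j : ℤ} (h0 : 0 ≤ j) (h1 : j ≤ ρ.δ v w) :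
    ∃ z ∈ ρ.seg v w, ρ.δ v z = j := by
  obtain ⟨t, ht0, ht1, ht⟩ := exists_coord_between (by omega : n - 1 < n) (inZ_top_pred _)
    (ρ.dist_nonneg v w) h0 h1
  obtain ⟨z, hz1, hz2⟩ := ρ.exists_seg v w ht0 ht1
  refine ⟨z, by rw [mem_seg, hz1, hz2]; abel, ?_⟩
  unfold δ
  rw [hz1]
  exact ht

open Classical in
/-- The orientation of the pairs of vertices towards a point. -/
def orient (y : ρ.Points) : Ori ρ.Tree :=
  fun p => decide (∃ v, ρ.δ p.2 v = 0 ∧ v ∈ ρ.geodesic p.1 y)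

theorem orient_eq_true {y : ρ.Points} {w v : ρ.Tree} :
    orient y (w, v) = true ↔ ∃ v', ρ.δ v v' = 0 ∧ v' ∈ ρ.geodesic w y := by
  simp [orient]

theorem orient_smul (g : G) (y : ρ.Points) : orient (g • y) = g • orient y := by
  funext ⟨a, b⟩
  rw [Ori.smul_apply, Bool.eq_iff_iff, orient_eq_true, orient_eq_true]
  have hδ : ∀ v w, ρ.δ (g • v) (g • w) = ρ.δ v w := fun v w => by unfold δ; rw [ρ.dist_smul]
  constructor
  · rintro ⟨v, h1, h2⟩
    refine ⟨g⁻¹ • v, ?_, ?_⟩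
    · rw [← hδ, smul_inv_smul, smul_inv_smul, h1]
    · rwa [← smul_mem_geodesic g, smul_inv_smul, smul_inv_smul]
  · rintro ⟨v, h1, h2⟩
    refine ⟨g • v, ?_, ?_⟩
    · rw [← hδ, smul_inv_smul] at h1; exact h1
    · rw [← smul_mem_geodesic g, smul_inv_smul] at h2; exact h2

section Ends

variable (hn : 1 ≤ n) (hρ : ρ.IsIrreducible)

/-- It identifies the orientation of a top end with the limit of the vertex orientations along a
ray, so that it belongs to `K`. -/
theorem eventually_orient (γ : ρ.Ray n) (w v : ρ.Tree) : ∀ᶠ b in atTop,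
    (orient (Quot.mk _ (.ray n hn le_rfl γ)) (w, v) = true ↔
      ρ.δ w v + ρ.δ v (γ.toFun b) = ρ.δ w (γ.toFun b)) := by
  obtain ⟨c, a, h⟩ := γ.top_spec hn w
  by_cases ho : orient (Quot.mk _ (.ray n hn le_rfl γ)) (w, v) = true
  · simp only [ho, true_iff]
    obtain ⟨v', h1, h2⟩ := orient_eq_true.1 ho
    rw [mem_geodesic_mk, PrePoint.between_iff] at h2
    change ∀ᶠ b in atTop, v' ∈ ρ.seg w (γ.toFun b) at h2
    filter_upwards [h2] with b hb
    have h3 := δ_of_mem_seg hb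
    have h4 := ρ.δ_tri w v v'
    have h5 := ρ.δ_tri w v' v
    have h6 := ρ.δ_tri v (γ.toFun b) v'
    have h7 := ρ.δ_tri v' (γ.toFun b) v
    have h8 := ρ.δ_comm v v'
    omega
  · filter_upwards [eventually_ge_atTop a] with b hb
    refine ⟨fun h' => absurd h' ho, fun h1 => orient_eq_true.2 ?_⟩
    obtain ⟨z, hz, hz1⟩ := exists_seg_δ hn w (γ.toFun b) (δ_nonneg w v)
      (by have := δ_nonneg v (γ.toFun b); omega)
    refine ⟨z, ?_, mem_geodesic_of_mem_seg (h b hb).2 hz⟩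
    have h2 := δ_of_mem_seg hz
    have h3 := δ_nonneg v z
    have h4 := ρ.δ_comm v w
    have h5 := ρ.δ_comm z w
    rcases ρ.four_point v z w (γ.toFun b) with h6 | h6 <;> replace h6 := top_mono h6 <;>
      rw [top_add, top_add] at h6 <;> unfold δ at * <;> omega

theorem orient_mem_E {x : ρ.Points} (hx : x ∈ ρ.ends n) : orient x ∈ (ρ.intTree hn hρ).E := by
  refine ⟨?_, fun m => ?_⟩
  · obtain ⟨-, -, γ, rfl⟩ := hx
    intro J
    have : ∀ᶠ b in atTop, ∀ p ∈ J, (orient (Quot.mk _ (.ray n hn le_rfl γ)) (p.1, p.2) = true ↔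
        ρ.δ p.1 p.2 + ρ.δ p.2 (γ.toFun b) = ρ.δ p.1 (γ.toFun b)) :=
      (Filter.eventually_all_finset J).2 fun p _ => eventually_orient hn γ p.1 p.2
    obtain ⟨b, hb⟩ := this.exists
    refine ⟨γ.toFun b, fun p hp => ?_⟩
    rw [Bool.eq_iff_iff, IntTree.ori_eq_true]
    exact hb p hp
  · obtain ⟨v, h1, h2⟩ := (mem_ends_iff hn x).1 hx m
    exact ⟨v, h1, orient_eq_true.2 ⟨v, δ_self v, h2⟩⟩

/-- The vertex `v` is chosen one level deeper than `α`, so that by `mem_seg_of_btw` all segments to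
vertices behind `v` share their point at distance `α`. -/
theorem exists_point {s : Ori ρ.Tree} (hs : s ∈ (ρ.intTree hn hρ).E) (α : HalfLine n n) :
    ∃ x, ρ.dist ρ.root x = α.1 ∧ ∃ v, s (ρ.root, v) = true ∧
      ∀ u, ρ.δ ρ.root v + ρ.δ v u = ρ.δ ρ.root u → x ∈ ρ.seg ρ.root u := by
  obtain ⟨v, h1, h2⟩ := hs.2 (top α.1 + 1).toNat
  replace h1 : top α.1 + 1 ≤ ρ.δ ρ.root v := (Int.self_le_toNat _).trans h1
  replace h2 : s (ρ.root, v) = true := h2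
  obtain ⟨u₀, hu₀⟩ := (ρ.intTree hn hρ).exists_match hs.1 [(ρ.root, v)]
  simp only [List.forall_mem_cons, h2, true_iff] at hu₀
  have hu₀ : ρ.δ ρ.root v + ρ.δ v u₀ = ρ.δ ρ.root u₀ := hu₀.1
  have h3 := δ_nonneg v u₀
  obtain ⟨x, hx1, hx2⟩ := ρ.exists_seg ρ.root u₀ α.2.1 (lt_of_top_lt (by
    change _ < ρ.δ ρ.root u₀; omega)).le
  refine ⟨x, hx1, v, h2, fun u hu => ρ.mem_seg_of_btw hu hu₀ ?_ ?_⟩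
  · rw [mem_seg, hx1, hx2]; abel
  · unfold δ at *; rw [hx1]; omega

/-- The ray from the root to an end. -/
def rayOf {s : Ori ρ.Tree} (hs : s ∈ (ρ.intTree hn hρ).E) : ρ.Ray n where
  toFun α := (exists_point hn hρ hs α).choose
  isometry α β := by
    obtain ⟨h1, v, h2, h3⟩ := (exists_point hn hρ hs α).choose_spec
    obtain ⟨h1', v', h2', h3'⟩ := (exists_point hn hρ hs β).choose_spec
    obtain ⟨u, hu⟩ := (ρ.intTree hn hρ).exists_match hs.1 [(ρ.root, v), (ρ.root, v')]
    simp only [List.forall_mem_cons, h2, h2', true_iff] at hu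
    rw [ρ.dist_eq_abs (h3 u hu.1) (h3' u hu.2.1), h1, h1']

theorem rayOf_spec {s : Ori ρ.Tree} (hs : s ∈ (ρ.intTree hn hρ).E) (α : HalfLine n n) :
    ρ.dist ρ.root ((rayOf hn hρ hs).toFun α) = α.1 ∧ ∃ v, s (ρ.root, v) = true ∧
      ∀ u, ρ.δ ρ.root v + ρ.δ v u = ρ.δ ρ.root u →
        (rayOf hn hρ hs).toFun α ∈ ρ.seg ρ.root u :=
  (exists_point hn hρ hs α).choose_spec

/-- The end with a given orientation. -/
def endOf {s : Ori ρ.Tree} (hs : s ∈ (ρ.intTree hn hρ).E) : ρ.Points :=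
  Quot.mk _ (.ray n hn le_rfl (rayOf hn hρ hs))

theorem endOf_mem_ends {s : Ori ρ.Tree} (hs : s ∈ (ρ.intTree hn hρ).E) :
    endOf hn hρ hs ∈ ρ.ends n := ⟨hn, le_rfl, _, rfl⟩

theorem orient_endOf {s : Ori ρ.Tree} (hs : s ∈ (ρ.intTree hn hρ).E) :
    orient (endOf hn hρ hs) = s := by
  funext ⟨w, v⟩
  obtain ⟨α, hα⟩ := exists_top hn (ρ.δ ρ.root w + ρ.δ ρ.root v)
  obtain ⟨b, hb, hbα⟩ := ((eventually_orient hn (rayOf hn hρ hs) w v).and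
    (HalfLine.eventually_gt hn le_rfl α (inZ_top α))).exists
  obtain ⟨h1, v', h2, h3⟩ := rayOf_spec hn hρ hs b
  set y := (rayOf hn hρ hs).toFun b
  have hy : ρ.δ ρ.root w + ρ.δ ρ.root v ≤ ρ.δ ρ.root y := by
    rw [← hα]
    unfold δ
    rw [h1]
    exact top_mono hbα.le
  have hsy : s (ρ.root, y) = true := by
    obtain ⟨u, hu⟩ := (ρ.intTree hn hρ).exists_match hs.1 [(ρ.root, v'), (ρ.root, y)]
    simp only [List.forall_mem_cons, h2, true_iff] at hu
    exact hu.2.1.2 (δ_of_mem_seg (h3 u hu.1))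
  have h4 := δ_nonneg ρ.root w
  have h5 := δ_nonneg ρ.root v
  have h6 := (ρ.intTree hn hρ).eq_of_deep hs.1 ((ρ.intTree hn hρ).ori_mem_K y) hsy
    ((ρ.intTree hn hρ).ori_eq_true.2 (δ_of_mem_seg (ρ.right_mem_seg ρ.root y)))
    (a := w) (b := v) (show ρ.δ ρ.root w ≤ ρ.δ ρ.root y by omega)
    (show ρ.δ ρ.root v ≤ ρ.δ ρ.root y by omega)
  rw [h6, Bool.eq_iff_iff, IntTree.ori_eq_true]
  exact hb

/-- After a shift by `c` the given ray and the ray from the root have the same points: at any given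
height a segment from the root has only one point. -/
theorem endOf_orient {x : ρ.Points} (hx : x ∈ ρ.ends n) {s : Ori ρ.Tree}
    (hs : s ∈ (ρ.intTree hn hρ).E) (h : orient x = s) : endOf hn hρ hs = x := by
  obtain ⟨h1, h2, γ, rfl⟩ := hx
  obtain ⟨c, a, hγ⟩ := γ.top_spec hn ρ.root
  have hpos : ∀ b, a ≤ b → 0 ≤ c + b.1 := fun b hb => by
    rw [← (hγ b hb).1]; exact ρ.dist_nonneg _ _
  have key : ∀ b (hb : a ≤ b),
      (rayOf hn hρ hs).toFun ⟨c + b.1, hpos b hb, inZ_top _⟩ = γ.toFun b := by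
    intro b hb
    obtain ⟨h1, v, h2, h3⟩ := rayOf_spec hn hρ hs ⟨c + b.1, hpos b hb, inZ_top _⟩
    rw [← h] at h2
    have h4 := (hγ b hb).2
    rw [mem_geodesic_mk, PrePoint.between_iff] at h4
    change ∀ᶠ d in atTop, _ ∈ ρ.seg _ (γ.toFun d) at h4
    obtain ⟨d, hd, hd'⟩ := (h4.and (eventually_orient hn γ ρ.root v)).exists
    exact ρ.eq_of_mem_seg (h3 _ (hd'.1 h2)) hd (h1.trans (hγ b hb).1.symm)
  refine Quot.sound (Glue.tail n hn le_rfl _ _ ⟨⟨c + a.1, hpos a le_rfl, inZ_top _⟩, a, ?_⟩)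
  ext y
  constructor
  · rintro ⟨b, hb, rfl⟩
    have hb : c + a.1 ≤ b.1 := hb
    have ha := a.2.1
    have hab : a.1 ≤ b.1 - c := by grind
    refine ⟨⟨b.1 - c, ha.trans hab, inZ_top _⟩, hab, ?_⟩
    rw [← key _ hab]
    congr 1
    exact Subtype.ext (add_sub_cancel c b.1)
  · rintro ⟨b, hb, rfl⟩
    exact ⟨_, add_le_add_right (show a.1 ≤ b.1 from hb) c, key b hb⟩

/-- An orientation records only that the subtree of `v` is reached; strictness in the top coordinate
makes up for this. -/
theorem mem_geodesic_of_orient {x y : ρ.Points} {w v : ρ.Tree}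
    (hw : w ∈ ρ.geodesic ρ.root x) (hv : v ∈ ρ.geodesic ρ.root x)
    (hlt : ρ.δ ρ.root w < ρ.δ ρ.root v) (hy : orient y (ρ.root, v) = true) :
    w ∈ ρ.geodesic ρ.root y := by
  obtain ⟨v', h1, h2⟩ := orient_eq_true.1 hy
  refine mem_geodesic_of_mem_seg h2 (ρ.mem_seg_of_btw (v := v) (u₀ := v) ?_ ?_ ?_ hlt)
  · have h3 := ρ.δ_tri ρ.root v v'
    have h4 := ρ.δ_tri ρ.root v' v
    have h5 := ρ.δ_comm v v'
    omega
  · rw [δ_self, add_zero]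
  · exact mem_seg_of_mem_geodesic hv hw (lt_of_top_lt hlt).le

end Ends

/-! ### Points that are not top ends -/

theorem exists_bounded (hn : 1 ≤ n) {y : ρ.Points} (hy : y ∉ ρ.ends n) :
    ∃ v, ∀ w ∈ ρ.geodesic v y, ρ.δ v w = 0 := by
  induction y using Quot.inductionOn with | _ p
  cases p with
  | vertex u =>
    refine ⟨u, fun w hw => ?_⟩
    rw [mem_geodesic_vertex] at hw
    have h1 := δ_of_mem_seg hw
    have h2 := δ_nonneg u w
    have h3 := δ_nonneg w u
    rw [δ_self] at h1
    omega
  | ray k h1 hk γ =>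
    have hlt : k < n := lt_of_le_of_ne hk fun h => by
      subst h
      exact hy ⟨h1, le_rfl, γ, rfl⟩
    refine ⟨γ.toFun (origin n k), fun w hw => ?_⟩
    rw [mem_geodesic_mk] at hw
    obtain ⟨b, hb⟩ := hw
    have h2 := δ_of_mem_seg (hb b le_rfl)
    have h3 := δ_nonneg (γ.toFun (origin n k)) w
    have h4 := δ_nonneg w (γ.toFun b)
    have h7 : ρ.δ (γ.toFun (origin n k)) (γ.toFun b) = 0 := by
      unfold δ
      rw [γ.dist_origin]
      exact top_eq_zero_of_inZ hlt b.2.2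
    omega

/-- At distance two or more there would be a vertex `z` one level away from `v` on the way to `w`,
and the geodesic to `y` from one of the two would pass `z`. Distance one does occur, at the glued
ends of adjacent subtrees. -/
theorem δ_le_one_of_bounded (hn : 1 ≤ n) {y : ρ.Points} {v w : ρ.Tree}
    (hv : ∀ u ∈ ρ.geodesic v y, ρ.δ v u = 0) (hw : ∀ u ∈ ρ.geodesic w y, ρ.δ w u = 0) :
    ρ.δ v w ≤ 1 := by
  by_contra hlt
  rw [not_le] at hlt
  obtain ⟨z, hz, hz1⟩ := exists_seg_δ hn v w zero_le_one hlt.le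
  have hz2 := δ_of_mem_seg hz
  obtain ⟨u, hu⟩ := exists_vertex y [(v, z), (w, z)]
  simp only [List.forall_mem_cons] at hu
  have h1 := ρ.dist_of_mem_seg hz u
  rcases max_choice (ρ.dist u v - ρ.dist v z) (ρ.dist u w - ρ.dist z w) with h2 | h2
  · have h3 : z ∈ ρ.seg v u := by
      rw [mem_seg, ρ.dist_comm z u, h1, h2, ρ.dist_comm u v]; abel
    have := hv z (hu.1.2 h3)
    omega
  · have h3 : z ∈ ρ.seg w u := by
      rw [mem_seg, ρ.dist_comm z u, h1, h2, ρ.dist_comm u w, ρ.dist_comm w z]; abel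
    have := hw z (hu.2.1.2 h3)
    rw [ρ.δ_comm] at this
    omega

end WordGroup

end ZnFree

namespace ZnFree

namespace WordGroup

variable {n : ℕ} {X G : Type*} [Group G] {ρ : WordGroup n X G}

/-! ### The metric of the compactification -/

theorem isSubtree_class (k : ℕ) (v : ρ.Tree) : ρ.IsSubtree k {w | InZ k (ρ.dist v w)} := ⟨v, rfl⟩

theorem IsSubtree.eq_of_mem {k : ℕ} {T : Set ρ.Tree} (hT : ρ.IsSubtree k T) {v : ρ.Tree}
    (hv : v ∈ T) : T = {w | InZ k (ρ.dist v w)} := by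
  obtain ⟨u, rfl⟩ := hT
  have hv : InZ k (ρ.dist u v) := hv
  ext w
  change InZ k (ρ.dist u w) ↔ InZ k (ρ.dist v w)
  constructor <;> intro h
  · refine (hv.add h).convex (ρ.dist_nonneg _ _) ?_
    rw [ρ.dist_comm u v]; exact ρ.dist_triangle _ _ _
  · exact (hv.add h).convex (ρ.dist_nonneg _ _) (ρ.dist_triangle _ _ _)

theorem IsSubtree.nonempty {k : ℕ} {T : Set ρ.Tree} (hT : ρ.IsSubtree k T) : T.Nonempty := by
  obtain ⟨u, rfl⟩ := hT
  exact ⟨u, by change InZ k (ρ.dist u u); rw [dist_self]; exact InZ.zero k⟩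

namespace MetricChoice

variable (C : ρ.MetricChoice)

/-- The position of a subtree in the enumeration by levels. -/
def position (j : ℕ) (T S : Set ρ.Tree) : ℕ × ℕ :=
  open Classical in
  (C.level j T S, if C.base (j + 1) T ∈ S then 0 else C.index j S)

variable {C} {j : ℕ} {T S S' : Set ρ.Tree}

theorem exists_level (hT : ρ.IsSubtree (j + 1) T) (hS : ρ.IsSubtree j S) (hST : S ⊆ T) :
    ∃ v ∈ S, coord j (ρ.dist (C.base (j + 1) T) v) = C.level j T S := by
  have hne : {m : ℕ | ∃ v ∈ S, coord j (ρ.dist (C.base (j + 1) T) v) = m}.Nonempty := by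
    obtain ⟨v, hv⟩ := hS.nonempty
    have hb := C.base_mem (j + 1) T hT
    have h1 : v ∈ {w | InZ (j + 1) (ρ.dist (C.base (j + 1) T) w)} := by
      rw [← hT.eq_of_mem hb]; exact hST hv
    exact ⟨_, v, hv, (Int.toNat_of_nonneg (InZ.coord_nonneg h1 (ρ.dist_nonneg _ _))).symm⟩
  exact Nat.sInf_mem hne

theorem base_mem_iff (hT : ρ.IsSubtree (j + 1) T) (hS : ρ.IsSubtree j S) (hST : S ⊆ T) :
    C.base (j + 1) T ∈ S ↔ C.level j T S = 0 := by
  constructor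
  · intro h
    refine Nat.sInf_eq_zero.2 (Or.inl ⟨_, h, ?_⟩)
    rw [dist_self, coord_zero]; rfl
  · intro h
    obtain ⟨v, hv, hv0⟩ := exists_level (C := C) hT hS hST
    have hb := C.base_mem (j + 1) T hT
    have h1 : v ∈ {w | InZ (j + 1) (ρ.dist (C.base (j + 1) T) w)} := by
      rw [← hT.eq_of_mem hb]; exact hST hv
    rw [h] at hv0
    have h2 := InZ.pred h1 hv0
    rw [hS.eq_of_mem hv]
    change InZ j (ρ.dist v _)
    rwa [ρ.dist_comm]

theorem scale_eq (hT : ρ.IsSubtree (j + 1) T) (hS : ρ.IsSubtree j S) (hST : S ⊆ T) :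
    C.scale j T S = (1 / 2) ^ (C.position j T S).1 * (1 / 2) ^ (C.position j T S).2 := by
  unfold scale position
  by_cases h : C.base (j + 1) T ∈ S
  · simp only [if_pos h, (base_mem_iff hT hS hST).1 h, pow_zero, mul_one]
  · simp only [if_neg h]
    rw [← pow_add, one_div_pow]

theorem position_injective (hT : ρ.IsSubtree (j + 1) T) (hS : ρ.IsSubtree j S) (hST : S ⊆ T)
    (hS' : ρ.IsSubtree j S') (hST' : S' ⊆ T) (h : C.position j T S = C.position j T S') :
    S = S' := by
  have h1 : C.level j T S = C.level j T S' := congrArg Prod.fst h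
  by_cases hb : C.base (j + 1) T ∈ S
  · have hb' : C.base (j + 1) T ∈ S' := by
      rwa [base_mem_iff hT hS' hST', ← h1, ← base_mem_iff hT hS hST]
    rw [hS.eq_of_mem hb, hS'.eq_of_mem hb']
  · have hb' : C.base (j + 1) T ∉ S' := by
      rwa [base_mem_iff hT hS' hST', ← h1, ← base_mem_iff hT hS hST]
    have h2 := congrArg Prod.snd h
    simp only [position, if_neg hb, if_neg hb'] at h2
    obtain ⟨v, hv, e⟩ := exists_level (C := C) hT hS hST
    obtain ⟨v', hv', e'⟩ := exists_level (C := C) hT hS' hST'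
    exact C.index_injective j T S S' hT hS hS' hST hST' ⟨v, hv, v', hv', by rw [e, e', h1]⟩ h2

theorem summable_pow : Summable fun p : ℕ × ℕ => (1 / 2 : ℝ) ^ p.1 * (1 / 2) ^ p.2 :=
  summable_geometric_two.mul_of_nonneg summable_geometric_two (fun _ => by positivity)
    fun _ => by positivity

/-- Different subtrees have different positions, so the scales are dominated by a double geometric
series. -/
theorem summable_scale (hT : ρ.IsSubtree (j + 1) T) :
    Summable (fun S : {S : Set ρ.Tree // ρ.IsSubtree j S ∧ S ⊆ T} => C.scale j T S.1) ∧
    ∑' S : {S : Set ρ.Tree // ρ.IsSubtree j S ∧ S ⊆ T}, C.scale j T S.1 ≤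
      ∑' p : ℕ × ℕ, (1 / 2 : ℝ) ^ p.1 * (1 / 2) ^ p.2 := by
  have hinj : Function.Injective fun S : {S : Set ρ.Tree // ρ.IsSubtree j S ∧ S ⊆ T} =>
      C.position j T S.1 := fun S S' h =>
    Subtype.ext (position_injective hT S.2.1 S.2.2 S'.2.1 S'.2.2 h)
  have heq : (fun S : {S : Set ρ.Tree // ρ.IsSubtree j S ∧ S ⊆ T} => C.scale j T S.1) =
      (fun p : ℕ × ℕ => (1 / 2 : ℝ) ^ p.1 * (1 / 2) ^ p.2) ∘ fun S => C.position j T S.1 :=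
    funext fun S => scale_eq hT S.2.1 S.2.2
  rw [heq]
  exact ⟨summable_pow.comp_injective hinj,
    tsum_comp_le_tsum_of_inj summable_pow (fun _ => by positivity) hinj⟩

theorem scale_pos : 0 < C.scale j T S := by
  unfold scale
  split_ifs <;> positivity

variable (C)

theorem subtreeDist_bound_step {B : ℝ} (hB : 0 ≤ B) (h : ∀ T, ρ.IsSubtree (j + 1) T → ∀ x y,
    0 ≤ C.subtreeDist (j + 1) T x y ∧ C.subtreeDist (j + 1) T x y ≤ B) {T : Set ρ.Tree}
    (hT : ρ.IsSubtree (j + 2) T) (x y : ρ.Points) : 0 ≤ C.subtreeDist (j + 2) T x y ∧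
      C.subtreeDist (j + 2) T x y ≤ (∑' p : ℕ × ℕ, (1 / 2 : ℝ) ^ p.1 * (1 / 2) ^ p.2) * B := by
  rw [subtreeDist]
  obtain ⟨h1, h2⟩ := summable_scale (C := C) hT
  have h0 : ∀ S : {S : Set ρ.Tree // ρ.IsSubtree (j + 1) S ∧ S ⊆ T},
      0 ≤ C.scale (j + 1) T S.1 * C.subtreeDist (j + 1) S.1 x y :=
    fun S => mul_nonneg scale_pos.le (h S.1 S.2.1 x y).1
  have h3 : ∀ S : {S : Set ρ.Tree // ρ.IsSubtree (j + 1) S ∧ S ⊆ T},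
      C.scale (j + 1) T S.1 * C.subtreeDist (j + 1) S.1 x y ≤ C.scale (j + 1) T S.1 * B :=
    fun S => mul_le_mul_of_nonneg_left (h S.1 S.2.1 x y).2 scale_pos.le
  refine ⟨tsum_nonneg h0, ?_⟩
  refine ((Summable.of_nonneg_of_le h0 h3 (h1.mul_right B)).tsum_le_tsum h3
    (h1.mul_right B)).trans ?_
  rw [tsum_mul_right]
  exact mul_le_mul_of_nonneg_right h2 hB

/-- Uniform bounds on each level make all the sums converge, so the value `0` of a divergent `tsum`
never interferes. -/
theorem subtreeDist_bound (j : ℕ) : ∃ B : ℝ, 0 ≤ B ∧ ∀ T, ρ.IsSubtree (j + 1) T → ∀ x y,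
    0 ≤ C.subtreeDist (j + 1) T x y ∧ C.subtreeDist (j + 1) T x y ≤ B := by
  induction j with
  | zero =>
    refine ⟨1, zero_le_one, fun T _ x y => ?_⟩
    rw [subtreeDist]
    split_ifs
    · exact ⟨le_rfl, zero_le_one⟩
    · exact ⟨(Real.exp_pos _).le, Real.exp_le_one_iff.2 (neg_nonpos.2 (Nat.cast_nonneg _))⟩
  | succ j ih =>
    obtain ⟨B, hB, h⟩ := ih
    exact ⟨_, mul_nonneg (tsum_nonneg fun _ => by positivity) hB, fun T hT x y =>
      C.subtreeDist_bound_step hB h hT x y⟩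

theorem summable_subtreeDist {T : Set ρ.Tree} (hT : ρ.IsSubtree (j + 2) T) (x y : ρ.Points) :
    Summable fun S : {S : Set ρ.Tree // ρ.IsSubtree (j + 1) S ∧ S ⊆ T} =>
      C.scale (j + 1) T S.1 * C.subtreeDist (j + 1) S.1 x y := by
  obtain ⟨B, hB, h⟩ := C.subtreeDist_bound j
  exact Summable.of_nonneg_of_le (fun S => mul_nonneg scale_pos.le (h S.1 S.2.1 x y).1)
    (fun S => mul_le_mul_of_nonneg_left (h S.1 S.2.1 x y).2 scale_pos.le)
    ((summable_scale hT).1.mul_right B)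

/-- The metric of a `ℤ`-subtree is dominated by the metric of a larger subtree. -/
theorem exists_mul_le (v : ρ.Tree) (j : ℕ) : ∃ c > 0, ∀ x y,
    c * C.subtreeDist 1 {w | InZ 1 (ρ.dist v w)} x y ≤
      C.subtreeDist (j + 1) {w | InZ (j + 1) (ρ.dist v w)} x y := by
  induction j with
  | zero => exact ⟨1, one_pos, fun x y => (one_mul _).le⟩
  | succ j ih =>
    obtain ⟨c, hc, h⟩ := ih
    have hT := isSubtree_class (j + 2) v
    have hS := isSubtree_class (j + 1) v
    have hST : {w | InZ (j + 1) (ρ.dist v w)} ⊆ {w | InZ (j + 2) (ρ.dist v w)} :=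
      fun w hw => InZ.mono (Nat.le_succ _) hw
    refine ⟨C.scale (j + 1) {w | InZ (j + 2) (ρ.dist v w)} {w | InZ (j + 1) (ρ.dist v w)} * c,
      mul_pos scale_pos hc, fun x y => ?_⟩
    rw [mul_assoc, show j + 1 + 1 = j + 2 from rfl, subtreeDist]
    refine (mul_le_mul_of_nonneg_left (h x y) scale_pos.le).trans ?_
    obtain ⟨B, hB, hb⟩ := C.subtreeDist_bound j
    exact (C.summable_subtreeDist hT x y).le_tsum ⟨_, hS, hST⟩
      fun S _ => mul_nonneg scale_pos.le (hb S.1 S.2.1 x y).1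

/-- A bounded set of vertices of a `ℤ`-subtree that lie on one geodesic is finite. -/
theorem ncard_le_of_geodesic {P : Set ρ.Tree} {o : ρ.Tree} {x : ρ.Points} {m : ℕ}
    (hP : ∀ p ∈ P, InZ 1 (ρ.dist o p) ∧ p ∈ ρ.geodesic o x ∧ coord 0 (ρ.dist o p) ≤ m) :
    (P \ {o}).Finite ∧ (P \ {o}).ncard ≤ m := by
  have hmaps : Set.MapsTo (fun p => coord 0 (ρ.dist o p)) (P \ {o}) (Finset.Icc (1 : ℤ) m) := by
    rintro p ⟨hp, hpo⟩
    obtain ⟨h1, h2, h3⟩ := hP p hp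
    rw [Finset.mem_coe, Finset.mem_Icc]
    refine ⟨?_, h3⟩
    change 1 ≤ coord 0 (ρ.dist o p)
    have h4 : 0 ≤ coord 0 (ρ.dist o p) := h1.coord_nonneg (k := 0) (ρ.dist_nonneg o p)
    by_contra h5
    have h6 : coord 0 (ρ.dist o p) = 0 := by omega
    refine hpo (ρ.eq_of_dist_eq_zero ?_).symm
    exact h1.eq_of_coord_zero (InZ.zero 1) (by rw [h6, coord_zero])
  have hinj : Set.InjOn (fun p => coord 0 (ρ.dist o p)) (P \ {o}) := by
    rintro p ⟨hp, -⟩ q ⟨hq, -⟩ hpq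
    have h1 := (hP p hp).1.eq_of_coord_zero (hP q hq).1 hpq
    exact ρ.eq_of_mem_seg (ρ.right_mem_seg o p)
      (mem_seg_of_mem_geodesic (hP p hp).2.1 (hP q hq).2.1 h1.ge) h1
  refine ⟨Set.Finite.of_injOn hmaps hinj (Finset.finite_toSet _), ?_⟩
  have := Set.ncard_le_ncard_of_injOn _ hmaps hinj (Finset.finite_toSet _)
  rwa [Set.ncard_coe_finset, Int.card_Icc, add_sub_cancel_right, Int.toNat_natCast] at this

/-- A vertex that separates `x` from `y` is at least as far from the base point as everything the
two geodesics share, so it bounds the Gromov product. -/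
theorem le_subtreeDist_one {T : Set ρ.Tree} (hT : ρ.IsSubtree 1 T) {v : ρ.Tree}
    (hvT : v ∈ T) {x y : ρ.Points}
    (hxy : ¬ (v ∈ ρ.geodesic (C.base 1 T) x ↔ v ∈ ρ.geodesic (C.base 1 T) y)) :
    Real.exp (-((coord 0 (ρ.dist (C.base 1 T) v)).toNat : ℝ)) ≤ C.subtreeDist 1 T x y := by
  have ho := C.base_mem 1 T hT
  have hTo := hT.eq_of_mem ho
  set o := C.base 1 T with ho_def
  have hT1 : ∀ p ∈ T, InZ 1 (ρ.dist o p) := fun p hp => by rw [hTo] at hp; exact hp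
  have hv1 := hT1 v hvT
  rw [subtreeDist, if_neg]
  · refine Real.exp_le_exp.2 (neg_le_neg (Nat.cast_le.2 ?_))
    refine (ncard_le_of_geodesic (x := x) fun p hp => ?_).2
    obtain ⟨⟨hpT, hpx⟩, hpy⟩ := hp
    refine ⟨hT1 p hpT, hpx, ?_⟩
    have h0 := hv1.coord_nonneg (k := 0) (ρ.dist_nonneg o v)
    rw [Int.toNat_of_nonneg h0]
    refine (hT1 p hpT).coord_mono hv1 ?_
    by_contra hlt
    rw [not_le] at hlt
    refine hxy ⟨fun hv => ?_, fun hv => ?_⟩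
    · exact mem_geodesic_of_mem_seg hpy (mem_seg_of_mem_geodesic hpx hv hlt.le)
    · exact mem_geodesic_of_mem_seg hpx (mem_seg_of_mem_geodesic hpy hv hlt.le)
  · intro h
    refine hxy ?_
    have := Set.ext_iff.1 h v
    simpa only [Set.mem_inter_iff, hvT, true_and] using this

/-- Points that look like `x` with respect to suitable finitely many pairs are close to `x`. -/
theorem exists_agree (hn : 1 ≤ n) {x : ρ.Points} (hx : ∀ v, x ≠ Quot.mk _ (.vertex v)) :
    ∀ k T, ρ.IsSubtree k T → ∀ ε > 0, ∃ F : Finset (ρ.Tree × ρ.Tree), ∀ y : ρ.Points,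
      (∀ p ∈ F, p.2 ∈ ρ.geodesic p.1 x ↔ p.2 ∈ ρ.geodesic p.1 y) → C.subtreeDist k T x y < ε
  | 0 => fun T _ ε hε => ⟨∅, fun y _ => by rw [subtreeDist]; exact hε⟩
  | 1 => by
    intro T hT ε hε
    have ho := C.base_mem 1 T hT
    set o := C.base 1 T with ho_def
    have hTo := hT.eq_of_mem ho
    have hT1 : ∀ p ∈ T, InZ 1 (ρ.dist o p) := fun p hp => by rw [hTo] at hp; exact hp
    -- The geodesic to a point that is not a vertex never stops, so it has a vertex of `T` at each
    -- distance from the base point.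
    have hex : ∀ i : ℕ, ∃ v ∈ T, v ∈ ρ.geodesic o x ∧ coord 0 (ρ.dist o v) = i := by
      intro i
      induction i with
      | zero => exact ⟨o, ho, left_mem_geodesic o x, by rw [dist_self, coord_zero]; rfl⟩
      | succ i ih =>
        obtain ⟨v, hv, hvx, hvi⟩ := ih
        obtain ⟨v', h1, h2, h3⟩ := exists_next hn hvx (hx v)
        have h4 : ρ.dist o v' = ρ.dist o v + unit n := by rw [← ρ.mem_seg.1 h3, h2]
        refine ⟨v', ?_, h1, ?_⟩
        · rw [hTo]
          change InZ 1 _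
          rw [h4]
          exact (hT1 v hv).add inZ_unit
        · rw [h4, coord_add, hvi, coord_unit_zero hn]; push_cast; rfl
    choose f hf1 hf2 hf3 using hex
    obtain ⟨N, hN⟩ := exists_nat_gt (-Real.log ε)
    refine ⟨{(o, f N)}, fun y hy => ?_⟩
    have hy : f N ∈ ρ.geodesic o y := (hy _ (Finset.mem_singleton_self _)).1 (hf2 N)
    rw [subtreeDist]
    split_ifs with hAB
    · exact hε
    · have hle : ∀ i, i ≤ N → f i ∈ ρ.geodesic o y := by
        intro i hi
        refine mem_geodesic_of_mem_seg hy (mem_seg_of_mem_geodesic (hf2 N) (hf2 i) ?_)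
        by_contra hlt
        have := (hT1 _ (hf1 N)).coord_mono (hT1 _ (hf1 i)) (not_le.1 hlt).le
        rw [hf3, hf3] at this
        have : i = N := by omega
        subst this
        exact hlt le_rfl
      -- As the two geodesics differ in `T`, their common part is bounded, hence finite; otherwise
      -- `ncard` would take the value `0`.
      have hbd : ∃ a ∈ T, ∀ p ∈ T ∩ ρ.geodesic o x ∩ ρ.geodesic o y, ρ.dist o p ≤ ρ.dist o a := by
        by_contra hno
        push Not at hno
        refine hAB (Set.ext fun a => ⟨fun ha => ⟨ha.1, ?_⟩, fun ha => ⟨ha.1, ?_⟩⟩)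
        · obtain ⟨p, hp, hlt⟩ := hno a ha.1
          exact mem_geodesic_of_mem_seg hp.2 (mem_seg_of_mem_geodesic hp.1.2 ha.2 hlt.le)
        · obtain ⟨p, hp, hlt⟩ := hno a ha.1
          exact mem_geodesic_of_mem_seg hp.1.2 (mem_seg_of_mem_geodesic hp.2 ha.2 hlt.le)
      obtain ⟨a, ha, hap⟩ := hbd
      have hfin := (ncard_le_of_geodesic (P := T ∩ ρ.geodesic o x ∩ ρ.geodesic o y) (o := o)
        (x := x) (m := (coord 0 (ρ.dist o a)).toNat) fun p hp => ⟨hT1 p hp.1.1, hp.1.2, by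
          rw [Int.toNat_of_nonneg ((hT1 a ha).coord_nonneg (k := 0) (ρ.dist_nonneg o a))]
          exact (hT1 p hp.1.1).coord_mono (hT1 a ha) (hap p hp)⟩).1
      have hcard : N ≤ ((T ∩ ρ.geodesic o x ∩ ρ.geodesic o y) \ {o}).ncard := by
        have hinj : Function.Injective f := by
          intro i i' h
          have h1 := hf3 i
          rw [h, hf3] at h1
          exact_mod_cast h1.symm
        have h1 : (f '' (Finset.Icc 1 N : Finset ℕ)).ncard = N := by
          rw [Set.ncard_image_of_injective _ hinj, Set.ncard_coe_finset, Nat.card_Icc]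
          omega
        rw [← h1]
        refine Set.ncard_le_ncard ?_ hfin
        rintro _ ⟨i, hi, rfl⟩
        rw [Finset.mem_coe, Finset.mem_Icc] at hi
        refine ⟨⟨⟨hf1 i, hf2 i⟩, hle i hi.2⟩, fun h => ?_⟩
        have h2 := hf3 i
        rw [show f i = o from h, dist_self, coord_zero] at h2
        omega
      rw [← Real.lt_log_iff_exp_lt hε]
      have : (N : ℝ) ≤ ((T ∩ ρ.geodesic o x ∩ ρ.geodesic o y) \ {o}).ncard := by
        exact_mod_cast hcard
      linarith
  | j + 2 => by
    classical
    intro T hT ε hε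
    obtain ⟨B, hB, hb⟩ := C.subtreeDist_bound j
    have hs := (summable_scale (C := C) hT).1.mul_right B
    -- All but finitely many subtrees contribute less than `ε / 2` together, and each of the others
    -- is controlled by finitely many pairs.
    have htail := tendsto_order.1 (tendsto_tsum_compl_atTop_zero
      fun S : {S : Set ρ.Tree // ρ.IsSubtree (j + 1) S ∧ S ⊆ T} => C.scale (j + 1) T S.1 * B)
    obtain ⟨I, hI⟩ := (htail.2 (ε / 2) (half_pos hε)).exists
    set K : ℝ := ∑ S ∈ I, C.scale (j + 1) T S.1 + 1
    have hK : 0 < K := add_pos_of_nonneg_of_pos (Finset.sum_nonneg fun _ _ => scale_pos.le) one_pos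
    choose F hF using fun S : {S : Set ρ.Tree // ρ.IsSubtree (j + 1) S ∧ S ⊆ T} =>
      exists_agree hn hx (j + 1) S.1 S.2.1 (ε / 2 / K) (by positivity)
    refine ⟨I.biUnion F, fun y hy => ?_⟩
    have hsum := C.summable_subtreeDist hT x y
    rw [subtreeDist, ← hsum.sum_add_tsum_compl (s := I)]
    have h1 : ∑ S ∈ I, C.scale (j + 1) T S.1 * C.subtreeDist (j + 1) S.1 x y ≤
        ∑ S ∈ I, C.scale (j + 1) T S.1 * (ε / 2 / K) :=
      Finset.sum_le_sum fun S hS => mul_le_mul_of_nonneg_left (hF S y fun p hp =>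
        hy p (Finset.mem_biUnion.2 ⟨S, hS, hp⟩)).le scale_pos.le
    have h2 : ∑ S ∈ I, C.scale (j + 1) T S.1 * (ε / 2 / K) ≤ ε / 2 := by
      rw [← Finset.sum_mul, mul_div_assoc', div_le_iff₀ hK]
      have : ∑ S ∈ I, C.scale (j + 1) T S.1 ≤ K := by simp [K]
      nlinarith
    have h3 : ∑' S : ((I : Set {S : Set ρ.Tree // ρ.IsSubtree (j + 1) S ∧ S ⊆ T})ᶜ : Set _),
        C.scale (j + 1) T S.1.1 * C.subtreeDist (j + 1) S.1.1 x y ≤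
        ∑' S : ((I : Set {S : Set ρ.Tree // ρ.IsSubtree (j + 1) S ∧ S ⊆ T})ᶜ : Set _),
          C.scale (j + 1) T S.1.1 * B :=
      (hsum.subtype _).tsum_le_tsum (fun S => mul_le_mul_of_nonneg_left
        (hb S.1.1 S.1.2.1 x y).2 scale_pos.le) (hs.subtype _)
    have h4 : ∑' S : ((I : Set {S : Set ρ.Tree // ρ.IsSubtree (j + 1) S ∧ S ⊆ T})ᶜ : Set _),
          C.scale (j + 1) T S.1.1 * B < ε / 2 := hI
    linarith

end MetricChoice

/-! ### The topology of the compactification -/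

variable (C : ρ.MetricChoice)

theorem univ_eq_class (v : ρ.Tree) : (Set.univ : Set ρ.Tree) = {w | InZ n (ρ.dist v w)} :=
  (Set.eq_univ_of_forall fun _ => inZ_top _).symm

theorem exists_le_compactDist (hn : 1 ≤ n) {T : Set ρ.Tree} (hT : ρ.IsSubtree 1 T) :
    ∃ c > 0, ∀ v ∈ T, ∀ x y : ρ.Points,
      ¬ (v ∈ ρ.geodesic (C.base 1 T) x ↔ v ∈ ρ.geodesic (C.base 1 T) y) →
        c * Real.exp (-((coord 0 (ρ.dist (C.base 1 T) v)).toNat : ℝ)) ≤ compactDist C x y := by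
  obtain ⟨u, rfl⟩ := id hT
  obtain ⟨c, hc, h⟩ := C.exists_mul_le u (n - 1)
  refine ⟨c, hc, fun v hv x y hxy => ?_⟩
  have h1 := h x y
  rw [Nat.sub_add_cancel hn, ← univ_eq_class] at h1
  exact (mul_le_mul_of_nonneg_left (C.le_subtreeDist_one hT hv hxy) hc.le).trans h1

/-- Passing `v` is decided at the last edge, which lies in a single `ℤ`-subtree, and the visual
metric there detects on which side of the edge a point lies. -/
theorem exists_compactDist_lt (hn : 1 ≤ n) (w v : ρ.Tree) : ∃ c > 0, ∀ x y : ρ.Points,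
    compactDist C x y < c → (v ∈ ρ.geodesic w x ↔ v ∈ ρ.geodesic w y) := by
  by_cases hvw : v = w
  · subst hvw
    exact ⟨1, one_pos, fun x y _ => iff_of_true (left_mem_geodesic _ _) (left_mem_geodesic _ _)⟩
  obtain ⟨z, hz, hvz⟩ := exists_unit_step hn hvw
  have hzv : ρ.dist z v = unit n := by rw [ρ.dist_comm, hvz]
  have hT := isSubtree_class 1 v
  have hv : v ∈ {u | InZ 1 (ρ.dist v u)} := by
    change InZ 1 (ρ.dist v v); rw [dist_self]; exact InZ.zero 1
  have hzT : z ∈ {u | InZ 1 (ρ.dist v u)} := by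
    change InZ 1 (ρ.dist v z); rw [hvz]; exact inZ_unit
  obtain ⟨c, hc, h⟩ := exists_le_compactDist C hn hT
  by_cases ho : z ∈ ρ.seg (C.base 1 {u | InZ 1 (ρ.dist v u)}) v
  · refine ⟨c * Real.exp (-((coord 0 (ρ.dist (C.base 1 {w | InZ 1 (ρ.dist v w)}) v)).toNat : ℝ)),
      mul_pos hc (Real.exp_pos _), fun x y hxy => ?_⟩
    rw [mem_geodesic_edge_iff hn hzv (ρ.mem_seg_comm.1 hz),
      mem_geodesic_edge_iff hn hzv (ρ.mem_seg_comm.1 hz), ← mem_geodesic_edge_iff hn hzv ho,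
      ← mem_geodesic_edge_iff hn hzv ho]
    by_contra hne
    exact absurd hxy (not_lt.2 (h v hv x y hne))
  · refine ⟨c * Real.exp (-((coord 0 (ρ.dist (C.base 1 {w | InZ 1 (ρ.dist v w)}) z)).toNat : ℝ)),
      mul_pos hc (Real.exp_pos _), fun x y hxy => ?_⟩
    have ho' : v ∈ ρ.seg (C.base 1 {u | InZ 1 (ρ.dist v u)}) z := by
      rw [ρ.mem_seg_comm] at ho ⊢
      exact (ρ.mem_seg_edge hn hzv _).2 ho
    rw [mem_geodesic_edge_iff hn hzv (ρ.mem_seg_comm.1 hz),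
      mem_geodesic_edge_iff hn hzv (ρ.mem_seg_comm.1 hz), mem_geodesic_edge hn hzv,
      mem_geodesic_edge hn hzv, ← mem_geodesic_edge_iff hn hvz ho',
      ← mem_geodesic_edge_iff hn hvz ho', not_iff_not]
    by_contra hne
    exact absurd hxy (not_lt.2 (h z hzT x y hne))

theorem isOpen_agree (hn : 1 ≤ n) (x : ρ.Points) (F : Finset (ρ.Tree × ρ.Tree)) :
    IsOpen {y : Compactification C | ∀ p ∈ F, p.2 ∈ ρ.geodesic p.1 x ↔ p.2 ∈ ρ.geodesic p.1 y} := by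
  have : {y : Compactification C | ∀ p ∈ F, p.2 ∈ ρ.geodesic p.1 x ↔ p.2 ∈ ρ.geodesic p.1 y} =
      ⋂ p ∈ F, {y : Compactification C | p.2 ∈ ρ.geodesic p.1 x ↔ p.2 ∈ ρ.geodesic p.1 y} := by
    ext y; simp
  rw [this]
  refine isOpen_biInter_finset fun p _ => ?_
  obtain ⟨c, hc, h⟩ := exists_compactDist_lt C hn p.1 p.2
  exact fun y hy => ⟨c, hc, fun z hz => Iff.trans hy (h y z hz)⟩

theorem isOpen_geodesic (hn : 1 ≤ n) (w v : ρ.Tree) :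
    IsOpen {y : Compactification C | v ∈ ρ.geodesic w y} := by
  obtain ⟨c, hc, h⟩ := exists_compactDist_lt C hn w v
  exact fun y hy => ⟨c, hc, fun z hz => (h y z hz).1 hy⟩

/-- Any other point either is not reached through `v` or continues to a neighbour of `v`, and both
are detected at a fixed distance. Thus vertices are isolated. -/
theorem isOpen_vertex (hn : 1 ≤ n) (v : ρ.Tree) :
    IsOpen ({Quot.mk _ (.vertex v)} : Set (Compactification C)) := by
  have hT := isSubtree_class 1 v
  have hvT : v ∈ {w | InZ 1 (ρ.dist v w)} := by
    change InZ 1 (ρ.dist v v); rw [dist_self]; exact InZ.zero 1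
  obtain ⟨c, hc, h⟩ := exists_le_compactDist C hn hT
  have hT1 := hT.eq_of_mem (C.base_mem 1 _ hT)
  set T := {w | InZ 1 (ρ.dist v w)}
  set o := C.base 1 T
  have hov : InZ 1 (ρ.dist o v) := by rw [hT1] at hvT; exact hvT
  have h0 := hov.coord_nonneg (k := 0) (ρ.dist_nonneg o v)
  rintro _ rfl
  refine ⟨c * Real.exp (-((coord 0 (ρ.dist o v)).toNat + 1 : ℝ)), mul_pos hc (Real.exp_pos _),
    fun y hy => ?_⟩
  by_contra hne
  have hv : v ∈ ρ.geodesic o (Quot.mk _ (.vertex v)) :=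
    (mem_geodesic_vertex _ _ _).2 (ρ.right_mem_seg o v)
  by_cases hvy : v ∈ ρ.geodesic o y
  · obtain ⟨v', h1, h2, h3⟩ := exists_next hn hvy hne
    have h4 : ρ.dist o v' = ρ.dist o v + unit n := by rw [← ρ.mem_seg.1 h3, h2]
    have hv' : ¬ (v' ∈ ρ.geodesic o (Quot.mk _ (.vertex v)) ↔ v' ∈ ρ.geodesic o y) := by
      intro h5
      have h6 := (mem_geodesic_vertex _ _ _).1 (h5.2 h1)
      rw [mem_seg, h4] at h6
      have h7 := ρ.dist_nonneg v' v
      have h8 := unit_pos hn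
      grind
    have h9 := h v' (by change InZ 1 (ρ.dist v v'); rw [h2]; exact inZ_unit) _ _ hv'
    rw [h4, coord_add, coord_unit_zero hn, show (coord 0 (ρ.dist o v) + 1).toNat =
      (coord 0 (ρ.dist o v)).toNat + 1 by omega, Nat.cast_add, Nat.cast_one] at h9
    exact absurd hy (not_lt.2 h9)
  · have h9 := h v hvT (Quot.mk _ (.vertex v)) y fun h5 => hvy (h5.1 hv)
    refine absurd hy (not_lt.2 (le_trans (mul_le_mul_of_nonneg_left ?_ hc.le) h9))
    exact Real.exp_le_exp.2 (neg_le_neg (le_add_of_nonneg_right zero_le_one))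

theorem exists_agree_subset (hn : 1 ≤ n) {E : Set (Compactification C)} (hE : IsOpen E)
    {x : ρ.Points} (hxE : x ∈ E) (hx : ∀ v, x ≠ Quot.mk _ (.vertex v)) :
    ∃ F : Finset (ρ.Tree × ρ.Tree), ∀ y : ρ.Points,
      (∀ p ∈ F, p.2 ∈ ρ.geodesic p.1 x ↔ p.2 ∈ ρ.geodesic p.1 y) → y ∈ E := by
  obtain ⟨ε, hε, h⟩ := hE x hxE
  have hT : ρ.IsSubtree n Set.univ := ⟨ρ.root, univ_eq_class _⟩
  obtain ⟨F, hF⟩ := C.exists_agree hn hx n Set.univ hT ε hε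
  exact ⟨F, fun y hy => h y (hF y hy)⟩

/-- The choices in the metric are not invariant, but away from the isolated vertices neighbourhoods
are described by finitely many pairs, which `G` permutes. -/
theorem continuous_smul (hn : 1 ≤ n) (g : G) :
    Continuous fun x : Compactification C => g • x := by
  classical
  refine ⟨fun E hE => isOpen_iff_forall_mem_open.2 fun x hx => ?_⟩
  by_cases hv : ∃ v, x = Quot.mk _ (.vertex v)
  · obtain ⟨v, rfl⟩ := hv
    exact ⟨_, Set.singleton_subset_iff.2 hx, isOpen_vertex C hn v, rfl⟩
  · push Not at hv
    have hgx : ∀ v, (g • x : ρ.Points) ≠ Quot.mk _ (.vertex v) := by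
      intro v h
      refine hv (g⁻¹ • v) ?_
      have h1 : x = g⁻¹ • (g • x) := (inv_smul_smul g x).symm
      rw [h1]
      change g⁻¹ • (g • x : ρ.Points) = _
      rw [h]
      rfl
    obtain ⟨F, hF⟩ := exists_agree_subset C hn hE hx hgx
    refine ⟨_, fun y hy => ?_, isOpen_agree C hn x (F.image fun p => (g⁻¹ • p.1, g⁻¹ • p.2)),
      fun p _ => Iff.rfl⟩
    refine hF _ fun p hp => ?_
    have h1 := hy _ (Finset.mem_image_of_mem _ hp)
    have h2 : ∀ z : ρ.Points, g⁻¹ • p.2 ∈ ρ.geodesic (g⁻¹ • p.1) z ↔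
        p.2 ∈ ρ.geodesic p.1 (g • z) := by
      intro z
      rw [← smul_mem_geodesic g, smul_inv_smul, smul_inv_smul]
    exact (h2 x).symm.trans (Iff.trans h1 (h2 y))

theorem measurableSet_geodesic (hn : 1 ≤ n) (w v : ρ.Tree) :
    MeasurableSet {y : Compactification C | v ∈ ρ.geodesic w y} :=
  (isOpen_geodesic C hn w v).measurableSet

theorem measurable_smul (hn : 1 ≤ n) (g : G) : Measurable fun x : Compactification C => g • x :=
  (continuous_smul C hn g).measurable

theorem measurable_orient [Countable G] (hn : 1 ≤ n) :
    Measurable fun x : Compactification C => (orient (ρ := ρ) x : Ori ρ.Tree) := by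
  refine measurable_pi_lambda _ fun p => measurable_to_bool ?_
  have : (fun x : Compactification C => orient (ρ := ρ) x p) ⁻¹' {true} =
      ⋃ v, ⋃ _ : ρ.δ p.2 v = 0, {y : Compactification C | v ∈ ρ.geodesic p.1 y} := by
    ext x
    rw [Set.mem_preimage, Set.mem_singleton_iff]
    refine (orient_eq_true (y := (x : ρ.Points)) (w := p.1) (v := p.2)).trans ?_
    simp
  rw [this]
  exact MeasurableSet.iUnion fun v => MeasurableSet.iUnion fun _ =>
    measurableSet_geodesic C hn _ _

theorem measurableSet_topEnds [Countable G] (hn : 1 ≤ n) : MeasurableSet (topEnds C) := by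
  have : topEnds C = ⋂ m : ℕ, ⋃ v, ⋃ _ : (m : ℤ) ≤ ρ.δ ρ.root v,
      {y : Compactification C | v ∈ ρ.geodesic ρ.root y} := by
    ext x
    have := mem_ends_iff hn (ρ := ρ) x
    simp only [Set.mem_iInter, Set.mem_iUnion, exists_prop]
    exact this
  rw [this]
  exact MeasurableSet.iInter fun m => MeasurableSet.iUnion fun v => MeasurableSet.iUnion fun _ =>
    measurableSet_geodesic C hn _ _

theorem ne_vertex_of_mem_ends (hn : 1 ≤ n) {x : ρ.Points} (hx : x ∈ ρ.ends n) (v : ρ.Tree) :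
    x ≠ Quot.mk _ (.vertex v) := by
  rintro rfl
  obtain ⟨w, h1, h2⟩ := (mem_ends_iff hn _).1 hx (ρ.δ ρ.root v + 1).toNat
  have h3 := δ_of_mem_seg ((mem_geodesic_vertex _ _ _).1 h2)
  have h4 := δ_nonneg w v
  have h5 := (Int.self_le_toNat _).trans h1
  omega

/-- A neighbourhood of a top end contains all points in the direction of some vertex. -/
theorem exists_orient_subset (hn : 1 ≤ n) {E : Set (Compactification C)} (hE : IsOpen E)
    {x : ρ.Points} (hxE : x ∈ E) (hx : x ∈ ρ.ends n) :
    ∃ v, orient x (ρ.root, v) = true ∧ ∀ y : ρ.Points, orient y (ρ.root, v) = true → y ∈ E := by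
  obtain ⟨F, hF⟩ := exists_agree_subset C hn hE hxE (ne_vertex_of_mem_ends hn hx)
  have hbd : ∃ m : ℕ, ∀ p ∈ F, ρ.δ ρ.root p.1 < m ∧ ρ.δ ρ.root p.2 < m := by
    refine ⟨F.sup (fun p => (ρ.δ ρ.root p.1 + ρ.δ ρ.root p.2 + 1).toNat), fun p hp => ?_⟩
    have h1 := Finset.le_sup (f := fun p : ρ.Tree × ρ.Tree =>
      (ρ.δ ρ.root p.1 + ρ.δ ρ.root p.2 + 1).toNat) hp
    have h2 := δ_nonneg ρ.root p.1
    have h3 := δ_nonneg ρ.root p.2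
    omega
  obtain ⟨m, hm⟩ := hbd
  -- Deeper than all pairs in `F`. The vertex `v` has to lie one level further, since an orientation
  -- sees it only up to its subtree.
  obtain ⟨w, hw1, hw2⟩ := (mem_ends_iff hn x).1 hx m
  obtain ⟨v, hv1, hv2⟩ := (mem_ends_iff hn x).1 hx (ρ.δ ρ.root w + 1).toNat
  replace hv1 := (Int.self_le_toNat _).trans hv1
  refine ⟨v, orient_eq_true.2 ⟨v, δ_self v, hv2⟩, fun y hy => hF y fun p hp => ?_⟩
  obtain ⟨h1, h2⟩ := hm p hp
  exact mem_geodesic_iff_of_deep hw2 (mem_geodesic_of_orient hw2 hv2 (by omega) hy)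
    (lt_of_top_lt (h1.trans_le hw1)).le (lt_of_top_lt (h2.trans_le hw1)).le

end WordGroup

end ZnFree

namespace ZnFree

open scoped ENNReal

namespace WordGroup

variable {n : ℕ} {X G : Type*} [Group G] {ρ : WordGroup n X G}

/-! ### Stationary measures are concentrated on the top ends -/

variable (ρ) in
/-- Two points are equivalent if they lie in the same subtree of type one below the top. -/
def blockSetoid : Setoid ρ.Tree where
  r v w := ρ.δ v w = 0
  iseqv := ⟨δ_self, fun {v w} h => by rw [δ_comm]; exact h, fun {x y z} h1 h2 => by
    have := ρ.δ_tri x z y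
    have := δ_nonneg x z
    omega⟩

variable (ρ) in
/-- The subtrees of type one below the top. -/
def Block : Type _ := Quotient ρ.blockSetoid

theorem δ_smul (g : G) (v w : ρ.Tree) : ρ.δ (g • v) (g • w) = ρ.δ v w := by
  unfold δ; rw [ρ.dist_smul]

/-- The block of a point. -/
def block (v : ρ.Tree) : ρ.Block := Quotient.mk _ v

theorem block_eq_iff {v w : ρ.Tree} : block v = block w ↔ ρ.δ v w = 0 := Quotient.eq

theorem exists_block (A : ρ.Block) : ∃ v, block v = A := Quotient.exists_rep A

instance [Countable G] : Countable ρ.Block :=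
  Function.Surjective.countable (f := block) exists_block

instance : MulAction G ρ.Block where
  smul g := Quotient.map (g • ·) fun v w (h : ρ.δ v w = 0) =>
    show ρ.δ (g • v) (g • w) = 0 by rw [δ_smul, h]
  one_smul A := by
    obtain ⟨v, rfl⟩ := exists_block A
    exact congrArg block (one_smul G v)
  mul_smul g h A := by
    obtain ⟨v, rfl⟩ := exists_block A
    exact congrArg block (mul_smul g h v)

theorem smul_block (g : G) (v : ρ.Tree) : g • block v = block (g • v) := rfl

theorem infinite_orbit_block (hn : 1 ≤ n) (hρ : ρ.IsIrreducible) (A : ρ.Block) :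
    (MulAction.orbit G A).Infinite := by
  obtain ⟨v, rfl⟩ := exists_block A
  refine IntTree.infinite_orbit_of_unbounded _ (fun g => ρ.δ v (g • v)) (fun g g' h => ?_)
    ((ρ.intTree hn hρ).unbounded_at v)
  rw [smul_block, smul_block, block_eq_iff] at h
  have h1 := ρ.δ_tri v (g • v) (g' • v)
  have h2 := ρ.δ_tri v (g' • v) (g • v)
  rw [δ_comm] at h
  have h3 := ρ.δ_comm (g • v) (g' • v)
  omega

variable (C : ρ.MetricChoice)

/-- The points whose geodesic from a point of the block stays in the block. -/
def bounded (A : ρ.Block) : Set (Compactification C) :=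
  {y | ∃ v, block v = A ∧ ∀ w, w ∈ ρ.geodesic v y → ρ.δ v w = 0}

theorem measurableSet_bounded [Countable G] (hn : 1 ≤ n) (A : ρ.Block) :
    MeasurableSet (bounded C A) := by
  have : bounded C A = ⋃ v, ⋃ _ : block v = A, ⋂ w, ⋂ _ : ρ.δ v w ≠ 0,
      {y : Compactification C | w ∈ ρ.geodesic v y}ᶜ := by
    ext y
    simp only [Set.mem_iUnion, Set.mem_iInter, Set.mem_compl_iff, exists_prop]
    refine exists_congr fun v => and_congr_right fun _ => forall_congr' fun w => ?_
    exact not_imp_not.symm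
  rw [this]
  exact MeasurableSet.iUnion fun v => MeasurableSet.iUnion fun _ => MeasurableSet.iInter fun w =>
    MeasurableSet.iInter fun _ => (measurableSet_geodesic C hn v w).compl

theorem smul_mem_bounded (g : G) {A : ρ.Block} {y : Compactification C} (hy : y ∈ bounded C A) :
    g • y ∈ bounded C (g • A) := by
  obtain ⟨v, rfl, hv⟩ := hy
  refine ⟨g • v, rfl, fun w hw => ?_⟩
  have h1 : g⁻¹ • w ∈ ρ.geodesic v (y : ρ.Points) := by
    refine (smul_mem_geodesic g (x := (y : ρ.Points))).1 ?_
    rw [smul_inv_smul]; exact hw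
  rw [← hv _ h1, ← δ_smul g v, smul_inv_smul]

theorem preimage_bounded (g : G) (A : ρ.Block) :
    (g • ·) ⁻¹' (bounded C A) = bounded C (g⁻¹ • A) := by
  ext y
  refine ⟨fun h => ?_, fun h => ?_⟩
  · have := smul_mem_bounded C g⁻¹ (y := g • y) h
    rwa [inv_smul_smul] at this
  · have := smul_mem_bounded C g h
    rwa [smul_inv_smul] at this

/-- Three blocks would be pairwise at distance one, and a triangle has even perimeter. -/
theorem card_bounded_le (hn : 1 ≤ n) (hρ : ρ.IsIrreducible) (y : Compactification C)
    (s : Finset ρ.Block) (hs : ∀ A ∈ s, y ∈ bounded C A) : s.card ≤ 2 := by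
  by_contra hlt
  obtain ⟨A, hA, B, hB, D, hD, hAB, hAD, hBD⟩ := Finset.two_lt_card.1 (not_le.1 hlt)
  obtain ⟨a, rfl, ha⟩ := hs A hA
  obtain ⟨b, rfl, hb⟩ := hs B hB
  obtain ⟨d, rfl, hd⟩ := hs D hD
  rw [Ne, block_eq_iff] at hAB hAD hBD
  have h1 := δ_le_one_of_bounded hn ha hb
  have h2 := δ_le_one_of_bounded hn ha hd
  have h3 := δ_le_one_of_bounded hn hb hd
  have h4 := δ_nonneg a b
  have h5 := δ_nonneg a d
  have h6 := δ_nonneg b d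
  obtain ⟨k, hk⟩ := (ρ.intTree hn hρ).even a b d
  replace hk : ρ.δ a b + ρ.δ b d + ρ.δ a d = 2 * k := hk
  omega

variable [MeasurableSpace G] [DiscreteMeasurableSpace G] [Countable G]

/-- The masses of the sets `bounded C A` have sum at most `2` and form a harmonic function of `A`.
Orbits of blocks are infinite, so the masses vanish, and these countably many sets contain all
points other than top ends. -/
theorem ae_mem_topEnds (hn : 1 ≤ n) (hρ : ρ.IsIrreducible) {μ : Measure G}
    [IsProbabilityMeasure μ] (hμ : IsNonDegenerate μ) {ν : Measure (Compactification C)}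
    [IsProbabilityMeasure ν] (hν : IsStationary μ ν) : ∀ᵐ y ∂ν, y ∈ topEnds C := by
  have hsum : ∑' A, ν (bounded C A) ≤ 2 := by
    have h1 : ∀ A, ν (bounded C A) = ∫⁻ y, (bounded C A).indicator 1 y ∂ν := fun A =>
      (lintegral_indicator_one (measurableSet_bounded C hn A)).symm
    simp_rw [h1]
    rw [← lintegral_tsum fun A =>
      (measurable_one.indicator (measurableSet_bounded C hn A)).aemeasurable]
    have h2 : ∀ y, ∑' A, (bounded C A).indicator (1 : Compactification C → ℝ≥0∞) y ≤ 2 := by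
      classical
      refine fun y => ENNReal.summable.tsum_le_of_sum_le fun s => ?_
      have h3 : ∑ A ∈ s, (bounded C A).indicator (1 : Compactification C → ℝ≥0∞) y =
          ((s.filter fun A => y ∈ bounded C A).card : ℝ≥0∞) := by
        simp [Set.indicator_apply, Finset.sum_boole]
      rw [h3]
      exact_mod_cast card_bounded_le C hn hρ y _ fun A hA => (Finset.mem_filter.1 hA).2
    exact (lintegral_mono h2).trans (by simp)
  have hzero : ∀ A, ν (bounded C A) = 0 := fun A => by
    by_contra hA
    refine infinite_orbit_block hn hρ A (finite_orbit_of_subharmonic μ hμ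
      (fun A => ν (bounded C A)) (ne_top_of_le_ne_top (by simp) hsum) (fun B => ?_) hA)
    rw [hν.apply (measurable_smul C hn) (measurableSet_bounded C hn B)]
    simp_rw [preimage_bounded]
    exact le_rfl
  refine measure_mono_null (fun y hy => ?_) (measure_iUnion_null hzero)
  obtain ⟨v, hv⟩ := exists_bounded hn hy
  exact Set.mem_iUnion.2 ⟨block v, v, rfl, hv⟩

/-! ### The end of an orientation -/

open Classical in
/-- The end of an orientation; a junk value for orientations without an end. -/
def endPoint (hn : 1 ≤ n) (hρ : ρ.IsIrreducible) (s : Ori ρ.Tree) : Compactification C :=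
  if h : s ∈ (ρ.intTree hn hρ).E then endOf hn hρ h else (Quot.mk _ (.vertex ρ.root) : ρ.Points)

variable (hn : 1 ≤ n) (hρ : ρ.IsIrreducible)

omit [MeasurableSpace G] [DiscreteMeasurableSpace G] [Countable G] in
theorem endPoint_eq {s : Ori ρ.Tree} (hs : s ∈ (ρ.intTree hn hρ).E) :
    endPoint C hn hρ s = endOf hn hρ hs := dif_pos hs

omit [MeasurableSpace G] [DiscreteMeasurableSpace G] [Countable G] in
theorem endPoint_mem_topEnds {s : Ori ρ.Tree} (hs : s ∈ (ρ.intTree hn hρ).E) :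
    endPoint C hn hρ s ∈ topEnds C := by
  rw [endPoint_eq C hn hρ hs]; exact endOf_mem_ends hn hρ hs

omit [MeasurableSpace G] [DiscreteMeasurableSpace G] [Countable G] in
theorem orient_endPoint {s : Ori ρ.Tree} (hs : s ∈ (ρ.intTree hn hρ).E) :
    orient (endPoint C hn hρ s : ρ.Points) = s := by
  rw [endPoint_eq C hn hρ hs]; exact orient_endOf hn hρ hs

omit [MeasurableSpace G] [DiscreteMeasurableSpace G] [Countable G] in
theorem endPoint_orient {x : Compactification C} (hx : x ∈ topEnds C) :
    endPoint C hn hρ (orient (x : ρ.Points)) = x := by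
  rw [endPoint_eq C hn hρ (orient_mem_E hn hρ hx)]
  exact endOf_orient hn hρ hx _ rfl

omit [MeasurableSpace G] [DiscreteMeasurableSpace G] [Countable G] in
theorem smul_mem_topEnds (g : G) {x : Compactification C} (hx : x ∈ topEnds C) :
    g • x ∈ topEnds C := by
  obtain ⟨h1, h2, γ, rfl⟩ := hx
  exact ⟨h1, h2, γ.smul g, rfl⟩

omit [MeasurableSpace G] [DiscreteMeasurableSpace G] [Countable G] in
theorem orient_smul_endPoint (g : G) {s : Ori ρ.Tree} (hs : s ∈ (ρ.intTree hn hρ).E) :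
    orient ((g • endPoint C hn hρ s : Compactification C) : ρ.Points) = g • s := by
  have := orient_smul g (endPoint C hn hρ s : ρ.Points)
  rw [orient_endPoint C hn hρ hs] at this
  exact this

omit [MeasurableSpace G] [DiscreteMeasurableSpace G] [Countable G] in
theorem endPoint_smul (g : G) {s : Ori ρ.Tree} (hs : s ∈ (ρ.intTree hn hρ).E) :
    endPoint C hn hρ (g • s) = g • endPoint C hn hρ s := by
  rw [← orient_smul_endPoint C hn hρ g hs]
  exact endPoint_orient C hn hρ (smul_mem_topEnds C g (endPoint_mem_topEnds C hn hρ hs))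

omit [MeasurableSpace G] [DiscreteMeasurableSpace G] in
-- On `E` the preimage of an open set is a countable union of conditions on single vertices, by
-- `exists_orient_subset`; outside `E` the map is constant.
theorem measurable_endPoint : Measurable (endPoint C hn hρ) := by
  classical
  refine measurable_of_isOpen fun U hU => ?_
  have hE := (ρ.intTree hn hρ).measurableSet_E
  have h1 : endPoint C hn hρ ⁻¹' U ∩ (ρ.intTree hn hρ).E = (ρ.intTree hn hρ).E ∩
      ⋃ v, ⋃ _ : ∀ y : ρ.Points, orient y (ρ.root, v) = true → y ∈ U,
        {s | s (ρ.root, v) = true} := by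
    ext s
    simp only [Set.mem_inter_iff, Set.mem_iUnion, exists_prop, Set.mem_preimage]
    constructor
    · rintro ⟨hsU, hs⟩
      refine ⟨hs, ?_⟩
      obtain ⟨v, hv, h⟩ := exists_orient_subset C hn hU hsU (endPoint_mem_topEnds C hn hρ hs)
      rw [orient_endPoint C hn hρ hs] at hv
      exact ⟨v, h, hv⟩
    · rintro ⟨hs, v, h, hv⟩
      refine ⟨h _ ?_, hs⟩
      rw [orient_endPoint C hn hρ hs]
      exact hv
  have h2 : endPoint C hn hρ ⁻¹' U ∩ (ρ.intTree hn hρ).Eᶜ =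
      if (Quot.mk _ (.vertex ρ.root) : ρ.Points) ∈ U then (ρ.intTree hn hρ).Eᶜ else ∅ := by
    ext s
    simp only [Set.mem_inter_iff, Set.mem_preimage]
    by_cases hs : s ∈ (ρ.intTree hn hρ).E
    · split_ifs <;> simp [hs]
    · have h3 : endPoint C hn hρ s = (Quot.mk _ (.vertex ρ.root) : ρ.Points) := dif_neg hs
      rw [h3]
      split_ifs with hU
      · exact ⟨fun h => h.2, fun h => ⟨hU, h⟩⟩
      · exact ⟨fun h => hU h.1, fun h => h.elim⟩
  rw [← Set.inter_union_compl (endPoint C hn hρ ⁻¹' U) (ρ.intTree hn hρ).E, h1, h2]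
  refine MeasurableSet.union (hE.inter (MeasurableSet.iUnion fun v => MeasurableSet.iUnion fun _ =>
    Ori.measurableSet_one _)) ?_
  split_ifs
  · exact hE.compl
  · exact MeasurableSet.empty

end WordGroup

end ZnFree

namespace ZnFree

open IntTree

namespace WordGroup

variable {n : ℕ} {X G : Type*} [Group G] {ρ : WordGroup n X G}

/-! ### Weak convergence to the end of the limit orientation -/

variable (C : ρ.MetricChoice) (hn : 1 ≤ n) (hρ : ρ.IsIrreducible) [Countable G]

/-- Near the end `f` is almost constant on all points in the direction of some `v`. The translated
measures give these points mass tending to `1`, and the rest contributes at most `2 * ‖f‖` times the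
remaining mass. -/
theorem weaklyTendsto_endPoint {ν : Measure (Ori ρ.Tree)} [IsProbabilityMeasure ν]
    (hν : ∀ᵐ t ∂ν, t ∈ (ρ.intTree hn hρ).E) {τ : ℕ → G} {s : Ori ρ.Tree}
    (hs : s ∈ (ρ.intTree hn hρ).E) (hτ : ConvTo ν τ s) :
    WeaklyTendsto (fun i => (ν.map (endPoint C hn hρ)).map (τ i • ·))
      (Measure.dirac (endPoint C hn hρ s)) := by
  intro f
  set ω := endPoint C hn hρ s with hω
  have hf : Measurable f := f.continuous.measurable
  have hψ := measurable_endPoint C hn hρ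
  rw [integral_dirac' _ _ hf.stronglyMeasurable]
  have hint : ∀ i, ∫ x, f x ∂((ν.map (endPoint C hn hρ)).map (τ i • ·)) =
      ∫ t, f (τ i • endPoint C hn hρ t) ∂ν := fun i => by
    rw [integral_map (measurable_smul C hn (τ i)).aemeasurable hf.aestronglyMeasurable,
      integral_map hψ.aemeasurable
        (f := fun x => f (τ i • x)) (hf.comp (measurable_smul C hn (τ i))).aestronglyMeasurable]
  simp_rw [hint]
  rw [Metric.tendsto_atTop]
  intro ε hε
  have hU : IsOpen {y : Compactification C | |f y - f ω| < ε / 2} :=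
    isOpen_lt (f.continuous.sub continuous_const).abs continuous_const
  obtain ⟨v, hv, hvU⟩ := exists_orient_subset C hn hU (x := ω)
    (by change |f ω - f ω| < ε / 2; rw [sub_self, abs_zero]; exact half_pos hε)
    (endPoint_mem_topEnds C hn hρ hs)
  rw [hω, orient_endPoint C hn hρ hs] at hv
  have h1 := hτ ρ.root v
  rw [if_pos hv] at h1
  have h2 : Tendsto (fun i => 2 * ‖f‖ *
      (1 - ν.real (one ((τ i)⁻¹ • ρ.root) ((τ i)⁻¹ • v)))) atTop (𝓝 0) := by
    have := (h1.const_sub 1).const_mul (2 * ‖f‖)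
    rwa [sub_self, mul_zero] at this
  obtain ⟨N, hN⟩ := eventually_atTop.1 (h2.eventually_lt_const (half_pos hε))
  refine ⟨N, fun i hi => ?_⟩
  set A := one ((τ i)⁻¹ • ρ.root) ((τ i)⁻¹ • v) with hA
  have hAm : MeasurableSet A := measurableSet_one _ _
  have hgm : Measurable fun t => f (τ i • endPoint C hn hρ t) :=
    hf.comp ((measurable_smul C hn (τ i)).comp hψ)
  have hgi : Integrable (fun t => f (τ i • endPoint C hn hρ t)) ν :=
    Integrable.of_bound hgm.aestronglyMeasurable ‖f‖ (ae_of_all _ fun t => f.norm_coe_le_norm _)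
  have hbound : ∀ᵐ t ∂ν, ‖f (τ i • endPoint C hn hρ t) - f ω‖ ≤
      ε / 2 + Aᶜ.indicator (fun _ => 2 * ‖f‖) t := by
    filter_upwards [hν] with t ht
    by_cases htA : t ∈ A
    · rw [Set.indicator_of_notMem (Set.notMem_compl_iff.2 htA), add_zero, Real.norm_eq_abs]
      refine (show _ < _ from hvU (τ i • endPoint C hn hρ t : Compactification C) ?_).le
      rw [orient_smul_endPoint C hn hρ _ ht]
      exact htA
    · rw [Set.indicator_of_mem htA]
      have := norm_sub_le (f (τ i • endPoint C hn hρ t)) (f ω)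
      have h3 := f.norm_coe_le_norm (τ i • endPoint C hn hρ t)
      have h4 := f.norm_coe_le_norm ω
      linarith
  have hbi : Integrable (fun t => ε / 2 + Aᶜ.indicator (fun _ => 2 * ‖f‖) t) ν :=
    (integrable_const _).add ((integrable_const _).indicator hAm.compl)
  have h3 := norm_integral_le_of_norm_le hbi hbound
  rw [integral_sub hgi (integrable_const _), integral_const, integral_add (integrable_const _)
    ((integrable_const _).indicator hAm.compl), integral_indicator_const _ hAm.compl,
    integral_const, probReal_univ, one_smul, one_smul, measureReal_compl hAm, probReal_univ,
    smul_eq_mul, mul_comm] at h3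
  rw [dist_eq_norm]
  have := hN i hi
  linarith

variable [MeasurableSpace G] [DiscreteMeasurableSpace G]

theorem ae_weaklyTendsto (hG : ∃ a b : G, a * b ≠ b * a) {μ : Measure G} [IsProbabilityMeasure μ]
    (hμ : IsNonDegenerate μ) {ν : Measure (Ori ρ.Tree)} [IsProbabilityMeasure ν]
    (hν : IsStationary μ ν) (hK : ν (ρ.intTree hn hρ).K = 1) :
    ∀ᵐ τ ∂(walkMeasure μ), ∃ ω ∈ topEnds C,
      WeaklyTendsto (fun i => (ν.map (endPoint C hn hρ)).map (τ i • ·)) (Measure.dirac ω) := by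
  set T := ρ.intTree hn hρ
  have hE : ∀ s ∈ T.E, (MulAction.orbit G s).Infinite := fun s hs => ρ.infinite_orbit hn hρ hG hs
  -- The event must be measurable in path space to be transported from the increments to the walk;
  -- the convergence statement itself is not obviously so.
  have hmeas : MeasurableSet {τ : ℕ → G | limOri ν τ ∈ T.E ∧ ∀ w v,
      Tendsto (fun i => ν.real (one ((τ i)⁻¹ • w) ((τ i)⁻¹ • v))) atTop (𝓝 0) ∨
      Tendsto (fun i => ν.real (one ((τ i)⁻¹ • w) ((τ i)⁻¹ • v))) atTop (𝓝 1)} := by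
    refine (measurable_limOri T.measurableSet_E).inter ?_
    have : ∀ w v i, Measurable fun τ : ℕ → G => ν.real (one ((τ i)⁻¹ • w) ((τ i)⁻¹ • v)) :=
      fun w v i => (measurable_of_countable
        fun g : G => ν.real (one (g⁻¹ • w) (g⁻¹ • v))).comp (measurable_pi_apply i)
    refine measurableSet_setOfPred.2 (Measurable.forall fun w => Measurable.forall fun v =>
      measurableSet_setOfPred.1 ?_)
    exact (measurableSet_tendsto _ fun i => this w v i).union
      (measurableSet_tendsto _ fun i => this w v i)
  have hwalk : Measurable fun (h : ℕ → G) (i : ℕ) => ((List.range i).map h).prod :=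
    measurable_pi_lambda _ fun i => measurable_walk i
  have hae : ∀ᵐ τ ∂(walkMeasure μ), limOri ν τ ∈ T.E ∧ ∀ w v,
      Tendsto (fun i => ν.real (one ((τ i)⁻¹ • w) ((τ i)⁻¹ • v))) atTop (𝓝 0) ∨
      Tendsto (fun i => ν.real (one ((τ i)⁻¹ • w) ((τ i)⁻¹ • v))) atTop (𝓝 1) := by
    refine (ae_map_iff hwalk.aemeasurable hmeas).2 ?_
    filter_upwards [T.ae_limOri_mem_E hE hμ hν hK, T.ae_convTo hE hμ hν hK] with h h1 h2
    refine ⟨h1, fun w v => ?_⟩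
    have h3 := h2 w v
    split_ifs at h3
    · exact Or.inr h3
    · exact Or.inl h3
  filter_upwards [hae] with τ hτ
  exact ⟨_, endPoint_mem_topEnds C hn hρ hτ.1, weaklyTendsto_endPoint C hn hρ
    (T.measure_E hμ hν hK) hτ.1 (convTo_limOri hτ.2)⟩

/-- A stationary measure is the image of its distribution of orientations. -/
theorem map_orient_spec {μ : Measure G} [IsProbabilityMeasure μ]
    (hμ : IsNonDegenerate μ) {ν : Measure (Compactification C)} [IsProbabilityMeasure ν]
    (hν : IsStationary μ ν) :
    IsStationary μ (ν.map fun x : Compactification C => orient (x : ρ.Points)) ∧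
      (ν.map fun x : Compactification C => orient (x : ρ.Points)) (ρ.intTree hn hρ).K = 1 ∧
      (ν.map fun x : Compactification C => orient (x : ρ.Points)).map (endPoint C hn hρ) = ν := by
  have hor := measurable_orient C hn
  have htop := ae_mem_topEnds C hn hρ hμ hν
  refine ⟨hν.map (measurable_smul C hn) Ori.measurable_smul hor
    fun g => ae_of_all _ fun x => orient_smul g (x : ρ.Points), ?_, ?_⟩
  · rw [Measure.map_apply hor (ρ.intTree hn hρ).isClosed_K.measurableSet, ← mem_ae_iff_prob_eq_one (hor (ρ.intTree hn hρ).isClosed_K.measurableSet)]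
    filter_upwards [htop] with x hx
    exact (orient_mem_E hn hρ hx).1
  · rw [Measure.map_map (measurable_endPoint C hn hρ) hor]
    refine (Measure.map_congr (g := id) ?_).trans Measure.map_id
    filter_upwards [htop] with x hx
    exact endPoint_orient C hn hρ hx

end WordGroup

end ZnFree

end

/-! ### The main theorem. -/

theorem mainTheorem3 {n : ℕ} (hn : 1 ≤ n) {X G : Type*} [Group G] [Group.FG G]
    [MeasurableSpace G] [DiscreteMeasurableSpace G]
    (hG : ∃ a b : G, a * b ≠ b * a)
    (ρ : ZnFree.WordGroup n X G) (hρ : ρ.IsIrreducible) (C : ρ.MetricChoice)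
    (μ : Measure G) [IsProbabilityMeasure μ] (hμ : ZnFree.IsNonDegenerate μ) :
    ∃ ν : Measure (ZnFree.WordGroup.Compactification C),
      (IsProbabilityMeasure ν ∧ ZnFree.IsStationary μ ν) ∧
      (∀ ν' : Measure (ZnFree.WordGroup.Compactification C),
        IsProbabilityMeasure ν' → ZnFree.IsStationary μ ν' → ν' = ν) ∧
      (∀ x, ν {x} = 0) ∧
      MeasurableSet (ZnFree.WordGroup.topEnds C) ∧
      ν (ZnFree.WordGroup.topEnds C) = 1 ∧
      (∀ E : Set (ZnFree.WordGroup.Compactification C), IsOpen E →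
        (E ∩ ZnFree.WordGroup.topEnds C).Nonempty → 0 < ν E) ∧
      ZnFree.IsMuBoundary μ ν ∧
      ∀ᵐ τ ∂(ZnFree.walkMeasure μ), ∃ ω ∈ ZnFree.WordGroup.topEnds C,
        ZnFree.WeaklyTendsto (fun i => ν.map (τ i • ·)) (Measure.dirac ω) := by
  -- A quotient of a free group of finite rank is countable.
  obtain ⟨α, hα, φ, hφ⟩ := Group.fg_iff_exists_freeGroup_hom_surjective_finite.1 ‹Group.FG G›
  have : Countable G := hφ.countable
  obtain ⟨ν₀, hp, hst, hK⟩ := (ρ.intTree hn hρ).exists_stationary μ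
  have hE : ∀ s ∈ (ρ.intTree hn hρ).E, (MulAction.orbit G s).Infinite :=
    fun s hs => ρ.infinite_orbit hn hρ hG hs
  have hνE := (ρ.intTree hn hρ).measure_E hμ hst hK
  have hψ := ZnFree.WordGroup.measurable_endPoint C hn hρ
  have hprob : IsProbabilityMeasure (ν₀.map (ZnFree.WordGroup.endPoint C hn hρ)) :=
    Measure.isProbabilityMeasure_map hψ.aemeasurable
  have hstat : ZnFree.IsStationary μ (ν₀.map (ZnFree.WordGroup.endPoint C hn hρ)) := by
    refine hst.map ZnFree.Ori.measurable_smul (ZnFree.WordGroup.measurable_smul C hn) hψ fun g => ?_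
    filter_upwards [hνE] with s hs
    exact ZnFree.WordGroup.endPoint_smul C hn hρ g hs
  have huniq : ∀ ν' : Measure (ZnFree.WordGroup.Compactification C), IsProbabilityMeasure ν' →
      ZnFree.IsStationary μ ν' → ν' = ν₀.map (ZnFree.WordGroup.endPoint C hn hρ) := by
    intro ν' hν' hs'
    -- A stationary measure is recovered from its image on orientations, where uniqueness is known.
    obtain ⟨h1, h2, h3⟩ := ZnFree.WordGroup.map_orient_spec C hn hρ hμ hs'
    have : IsProbabilityMeasure (ν'.map fun x : ZnFree.WordGroup.Compactification C =>
        ZnFree.WordGroup.orient (ρ := ρ) x) :=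
      Measure.isProbabilityMeasure_map (ZnFree.WordGroup.measurable_orient C hn).aemeasurable
    rw [(ρ.intTree hn hρ).isStationary_unique hE hμ hst hK h1 h2]
    exact h3.symm
  have htop := ZnFree.WordGroup.ae_mem_topEnds C hn hρ hμ hstat
  have htopm := ZnFree.WordGroup.measurableSet_topEnds C hn
  have hconv := ZnFree.WordGroup.ae_weaklyTendsto C hn hρ hG hμ hst hK
  refine ⟨_, ⟨hprob, hstat⟩, huniq, fun x => ?_, htopm, ?_, fun U hU hne => ?_,
    ⟨hstat, hconv.mono fun τ ⟨ω, _, h⟩ => ⟨ω, h⟩⟩, hconv⟩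
  · set s : ZnFree.Ori ρ.Tree := ZnFree.WordGroup.orient (ρ := ρ) x
    -- The orientations whose end is `x` lie in this null set, because on `E` an orientation is
    -- determined by its end.
    have h0 : ν₀ ({s} ∪ (ρ.intTree hn hρ).Eᶜ) = 0 := by
      refine measure_union_null ?_ hνE
      by_cases hs : s ∈ (ρ.intTree hn hρ).E
      · exact (ρ.intTree hn hρ).measure_singleton_E hE hμ hst s hs
      · exact measure_mono_null (Set.singleton_subset_iff.2 hs) hνE
    have hs := (measurableSet_singleton s).preimage (ZnFree.WordGroup.measurable_orient C hn)
    refine measure_mono_null (t := (fun y => ZnFree.WordGroup.orient (ρ := ρ) y) ⁻¹' {s})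
      (Set.singleton_subset_iff.2 rfl) ?_
    rw [Measure.map_apply hψ hs]
    refine measure_mono_null (fun t ht => ?_) h0
    by_cases htE : t ∈ (ρ.intTree hn hρ).E
    · exact Or.inl ((ZnFree.WordGroup.orient_endPoint C hn hρ htE).symm.trans ht)
    · exact Or.inr htE
  · exact (prob_compl_eq_zero_iff htopm).1 htop
  · obtain ⟨x, hxU, hx⟩ := hne
    obtain ⟨v, hv, hvU⟩ := ZnFree.WordGroup.exists_orient_subset C hn hU hxU hx
    have h1 := (ρ.intTree hn hρ).measure_one_pos hE hμ hst hK
      (ZnFree.WordGroup.orient_mem_E hn hρ hx) hv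
    rw [Measure.map_apply hψ hU.measurableSet]
    refine (pos_iff_ne_zero.2 h1).trans_le (measure_mono_ae ?_)
    filter_upwards [hνE] with t htE ht
    refine hvU _ ?_
    rw [ZnFree.WordGroup.orient_endPoint C hn hρ htE]
    exact ht
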